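/- Let $\mathbb T^3=\mathbb R^3/\mathbb Z^3$ and write $\langle\cdot,\cdot\rangle$ for the inner product of $L^2=L^2(\mathbb T^3;\mathbb R^3)$. Given $\nu>0$, a divergence-free $v_{\rm in}\in L^2$ and $f\in L^1(0,1;L^2)$, a *Leray–Hopf solution* on $[0,1]\times\mathbb T^3$ of $$\partial_t v+v\cdot\nabla v+\nabla p=\nu\Delta v+f,\qquad \operatorname{div}v=0,\qquad v(0)=v_{\rm in}$$ is a divergence-free $v\in L^\infty(0,1;L^2)\cap L^2(0,1;H^1)\cap C_w([0,1];L^2)$ with $v(0)=v_{\rm in}$ such that, for all $t\in[0,1]$ and all smooth divergence-free $\psi:\mathbb T^3\to\mathbb R^3$, $$\langle v(t),\psi\rangle-\langle v(0),\psi\rangle=\nu\int_0^t\langle v,\Delta\psi\rangle\,dr+\int_0^t\langle v\otimes v,\nabla\psi\rangle\,dr+\int_0^t\langle f,\psi\rangle\,dr ,$$ and, for all $t\in(0,1]$, $$\|v(t)\|_{L^2}^2+2\nu\int_0^t\|\nabla v\|_{L^2}^2\,dr\le\|v_{\rm in}\|_{L^2}^2+2\int_0^t\langle f,v\rangle\,dr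 .$$ For $\delta_hu(x)=u(x+h)-u(x)$ and $\ell>0$, put $$S_\parallel^\nu(t,\ell)=\frac1{4\pi}\int_{\mathbb S^2}\int_{\mathbb T^3}\bigl(\delta_{\ell\hat n}v_\nu(t,x)\cdot\hat n\bigr)^3dx\,dS(\hat n),\qquad S_0^\nu(t,\ell)=\frac1{4\pi}\int_{\mathbb S^2}\int_{\mathbb T^3}|\delta_{\ell\hat n}v_\nu(t,x)|^2\,\delta_{\ell\hat n}v_\nu(t,x)\cdot\hat n\,dx\,dS(\hat n),$$ $$\varepsilon_\nu(t)=\tfrac12\|v_\nu(0)\|_{L^2}^2-\tfrac12\|v_\nu(t)\|_{L^2}^2+\int_0^t\langle f_\nu,v_\nu\rangle\,dr .$$ **Theorem.** Let $v_{\rm in}\in L^2$ be divergence-free and, for each $\nu\in(0,1)$, let $v_\nu$ be a Leray–Hopf solution with viscosity $\nu$, force $f_\nu$ and initial datum $v_{\rm in}$ (the same for all $\nu$). Suppose that for some $\sigma>0$, $\alpha\in(0,1)$, $q\in[1,2]$ $$\sup_{\nu\in(0,1)}\Bigl(\|v_\nu\|_{L^\infty(0,1;L^2)}+\|v_\nu\|_{L^q(0,1;H^\alpha)}+\|f_\nu\|_{L^{1+\sigma}(0,1;L^2)}\Bigr)<\infty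 .$$ Then for every $\nu\in(0,1)$ one has $v_\nu(t)\in L^3(\mathbb T^3)$ for a.e. $t\in(0,1)$, and $S_\parallel^\nu(\cdot,\ell)$, $S_0^\nu(\cdot,\ell)$ are integrable on $(0,1)$ for every $\ell>0$. For every $K<\frac1{2-\alpha q}$, with $\ell_D=\nu^K$, and every $p\in[1,\infty)$, $$\lim_{\ell_I\to0}\limsup_{\nu\to0}\sup_{\ell\in[\ell_D,\ell_I]}\Bigl\|\int_0^\cdot\frac{S_\parallel^\nu(r,\ell)}{\ell}\,dr+\frac45\varepsilon_\nu\Bigr\|_{L^p(0,1)}=0,\qquad \lim_{\ell_I\to0}\limsup_{\nu\to0}\sup_{\ell\in[\ell_D,\ell_I]}\Bigl\|\int_0^\cdot\frac{S_0^\nu(r,\ell)}{\ell}\,dr+\frac43\varepsilon_\nu\Bigr\|_{L^p(0,1)}=0$$ (a supremum over the empty set being $0$). Moreover, for each $\nu\in(0,1)$ for which the energy inequality is an equality for all $t\in(0,1]$, $\varepsilon_\nu(t)=\nu\int_0^t\|\nabla v_\nu(s)\|_{L^2}^2\,ds$ for all $t\in[0,1]$. -/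

import Mathlib

open MeasureTheory Set Filter Topology
open scoped ENNReal

noncomputable section

namespace NavierStokes

/-- Three dimensional Euclidean space. -/
abbrev Vec : Type := EuclideanSpace ℝ (Fin 3)

/-- The torus `𝕋³ = ℝ³ / ℤ³`. -/
abbrev Torus : Type := UnitAddTorus (Fin 3)

/-- Lebesgue measure on the torus, of total mass one. -/
abbrev torusMeasure : Measure Torus :=
  Measure.pi fun _ : Fin 3 => (AddCircle.haarAddCircle : Measure UnitAddCircle)

/-- Lebesgue measure on the time interval `(0, 1)`. -/
abbrev timeMeasure : Measure ℝ := volume.restrict (Ioo (0 : ℝ) 1)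

/-- The Hilbert space `L²(𝕋³; ℝ³)`. -/
abbrev L2 : Type := Lp Vec 2 torusMeasure

/-- The quotient map `ℝ³ → 𝕋³`. -/
def proj (y : Vec) : Torus := fun j => ((y j : ℝ) : UnitAddCircle)

/-- A function on the torus is smooth if its periodic lift to `ℝ³` is `C^∞`. -/
def Smooth {F : Type*} [NormedAddCommGroup F] [NormedSpace ℝ F] (g : Torus → F) : Prop :=
  ContDiff ℝ (⊤ : ℕ∞) fun y : Vec => g (proj y)

/-- The classical partial derivative `∂_j g` of a function on the torus. -/
def pderiv {F : Type*} [NormedAddCommGroup F] [NormedSpace ℝ F] (j : Fin 3) (g : Torus → F) :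
    Torus → F :=
  fun x => deriv (fun s : ℝ => g (x + proj (EuclideanSpace.single j s))) 0

/-- The Laplacian `Δ g = ∑_j ∂_j ∂_j g` on the torus. -/
def lap {F : Type*} [NormedAddCommGroup F] [NormedSpace ℝ F] (g : Torus → F) : Torus → F :=
  fun x => ∑ j : Fin 3, pderiv j (pderiv j g) x

/-- Smooth divergence-free vector fields on the torus. -/
def SolenoidalTest (ψ : Torus → Vec) : Prop :=
  Smooth ψ ∧ ∀ x, ∑ j : Fin 3, pderiv j ψ x j = 0

/-- `div u = 0` in the sense of distributions. -/
def WeaklyDivFree (u : L2) : Prop :=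
  ∀ φ : Torus → ℝ, Smooth φ →
    ∫ x, ∑ j : Fin 3, u x j * pderiv j φ x ∂torusMeasure = 0

/-- `|û(k)|²`, where `û(k) = ∫ u(x) e^{-2πi k·x} dx ∈ ℂ³`. -/
def fourierSq (u : L2) (k : Fin 3 → ℤ) : ℝ :=
  ∑ j : Fin 3, ‖UnitAddTorus.mFourierCoeff (fun x : Torus => ((u x j : ℝ) : ℂ)) k‖ ^ 2

/-- `|k|²` for a frequency `k ∈ ℤ³`. -/
def freqSq (k : Fin 3 → ℤ) : ℝ := ∑ j : Fin 3, (k j : ℝ) ^ 2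

/-- The norm of the Sobolev space `H^s(𝕋³; ℝ³)`; it is `∞` if `u` is not in that space. -/
def sobolevNorm (s : ℝ) (u : L2) : ℝ≥0∞ :=
  (∑' k : Fin 3 → ℤ, ENNReal.ofReal ((1 + freqSq k) ^ s * fourierSq u k)) ^ (1 / 2 : ℝ)

/-- `‖∇u‖²_{L²}`; it is `∞` if `u` is not in `H¹`. -/
def gradSq (u : L2) : ℝ≥0∞ :=
  ∑' k : Fin 3 → ℤ, ENNReal.ofReal ((2 * Real.pi) ^ 2 * freqSq k * fourierSq u k)

/-- `∫_0^t ‖∇v(s)‖²_{L²} ds`, which is finite for `v ∈ L²(0,1;H¹)` and `t ≤ 1`. -/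
def gradEnergy (v : ℝ → L2) (t : ℝ) : ℝ :=
  (∫⁻ s in Ioc 0 t, gradSq (v s)).toReal

/-- The pairing `⟨u, ψ⟩ = ∫ u · ψ dx`. -/
def pair (u : L2) (ψ : Torus → Vec) : ℝ := ∫ x, inner ℝ (u x) (ψ x) ∂torusMeasure

/-- The convection term, `⟨u ⊗ u, ∇ψ⟩ = ∫ ∑_{i,j} u_i u_j ∂_j ψ_i dx`. For divergence-free
`u ∈ H¹` it equals `-⟨u · ∇u, ψ⟩`. -/
def convection (u : L2) (ψ : Torus → Vec) : ℝ :=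
  ∫ x, ∑ i : Fin 3, ∑ j : Fin 3, u x i * u x j * pderiv j ψ x i ∂torusMeasure

/-- `v` is a Leray--Hopf solution on `[0,1] × 𝕋³` of
`∂_t v + v·∇v + ∇p = ν Δv + f`, `div v = 0`, `v(0) = vin`.
The pressure is eliminated by testing with divergence-free fields. -/
structure IsLerayHopf (ν : ℝ) (vin : L2) (f v : ℝ → L2) : Prop where
  initial_divFree : WeaklyDivFree vin
  force_L1L2 : MemLp f 1 timeMeasure
  divFree : ∀ t ∈ Icc (0 : ℝ) 1, WeaklyDivFree (v t)
  linfty_L2 : MemLp v ∞ timeMeasure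
  l2_H1 : eLpNorm (fun t => sobolevNorm 1 (v t)) 2 timeMeasure < ∞
  weak_continuous : ∀ w : L2, ContinuousOn (fun t => inner ℝ (v t) w) (Icc 0 1)
  initial : v 0 = vin
  weak_form : ∀ t ∈ Icc (0 : ℝ) 1, ∀ ψ : Torus → Vec, SolenoidalTest ψ →
    pair (v t) ψ - pair (v 0) ψ =
      ν * (∫ r in (0 : ℝ)..t, pair (v r) (lap ψ))
        + (∫ r in (0 : ℝ)..t, convection (v r) ψ)
        + ∫ r in (0 : ℝ)..t, pair (f r) ψ
  energy_inequality : ∀ t ∈ Ioc (0 : ℝ) 1,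
    ‖v t‖ ^ 2 + 2 * ν * gradEnergy v t ≤
      ‖vin‖ ^ 2 + 2 * ∫ r in (0 : ℝ)..t, inner ℝ (f r) (v r)

/-- Equality in the energy inequality, at all times. -/
def EnergyEquality (ν : ℝ) (f v : ℝ → L2) : Prop :=
  ∀ t ∈ Ioc (0 : ℝ) 1,
    ‖v t‖ ^ 2 + 2 * ν * gradEnergy v t =
      ‖v 0‖ ^ 2 + 2 * ∫ r in (0 : ℝ)..t, inner ℝ (f r) (v r)

/-- The uniform bound
`sup_{ν ∈ (0,1)} (‖v_ν‖_{L^∞ L²} + ‖v_ν‖_{L^q H^α} + ‖f_ν‖_{L^{1+σ} L²}) < ∞`. -/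
def UniformBound (σ α q : ℝ) (f v : ℝ → ℝ → L2) : Prop :=
  ⨆ ν ∈ Ioo (0 : ℝ) 1,
    (eLpNorm (v ν) ∞ timeMeasure
      + eLpNorm (fun t => sobolevNorm α (v ν t)) (ENNReal.ofReal q) timeMeasure
      + eLpNorm (f ν) (ENNReal.ofReal (1 + σ)) timeMeasure) < ∞

/-- The increment `δ_h u(x) = u(x + h) - u(x)`. -/
def increment (u : L2) (h : Vec) (x : Torus) : Vec := u (x + proj h) - u x

/-- Surface measure on the unit sphere `𝕊² ⊂ ℝ³`, of total mass `4π`. -/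
abbrev sphereMeasure : Measure (Metric.sphere (0 : Vec) 1) := (volume : Measure Vec).toSphere

/-- The averaged longitudinal structure function `S_∥(ℓ)` of the field `u`. -/
def Spar (u : L2) (ℓ : ℝ) : ℝ :=
  1 / (4 * Real.pi) * ∫ n : Metric.sphere (0 : Vec) 1,
    (∫ x, inner ℝ (increment u (ℓ • (n : Vec)) x) (n : Vec) ^ 3 ∂torusMeasure) ∂sphereMeasure

/-- The averaged structure function `S_0(ℓ)` of the field `u`. -/
def Szero (u : L2) (ℓ : ℝ) : ℝ :=
  1 / (4 * Real.pi) * ∫ n : Metric.sphere (0 : Vec) 1,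
    (∫ x, ‖increment u (ℓ • (n : Vec)) x‖ ^ 2
        * inner ℝ (increment u (ℓ • (n : Vec)) x) (n : Vec) ∂torusMeasure) ∂sphereMeasure

/-- The dissipation
`ε(t) = ½‖v(0)‖²_{L²} - ½‖v(t)‖²_{L²} + ∫_0^t ⟨f, v⟩ dr`. -/
def dissipation (f v : ℝ → L2) (t : ℝ) : ℝ :=
  1 / 2 * ‖v 0‖ ^ 2 - 1 / 2 * ‖v t‖ ^ 2 + ∫ r in (0 : ℝ)..t, inner ℝ (f r) (v r)

/-- `lim_{ℓ_I → 0} limsup_{ν → 0} sup_{ℓ ∈ [ν^K, ℓ_I]}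
‖ ∫_0^· S(v_ν(r), ℓ)/ℓ dr + c ε_ν(·) ‖_{L^p(0,1)} = 0`. -/
def StructureLaw (S : L2 → ℝ → ℝ) (c K p : ℝ) (f v : ℝ → ℝ → L2) : Prop :=
  Tendsto (fun ℓI : ℝ =>
      limsup (fun ν : ℝ =>
        ⨆ ℓ ∈ Icc (ν ^ K) ℓI,
          eLpNorm (fun t => (∫ r in (0 : ℝ)..t, S (v ν r) ℓ / ℓ) + c * dissipation (f ν) (v ν) t)
            (ENNReal.ofReal p) timeMeasure)
        (𝓝[>] 0))
    (𝓝[>] 0) (𝓝 0)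

end NavierStokes

end

/-! Write `A` for correlation with a smooth, even, nonnegative, compactly supported radial kernel
`k(h) = a(|h|²)` of mass `Z`. The field `A v` is smooth and divergence-free, so it may be used to
test the equation. Although `v` is only weakly continuous in time, this gives an exact balance for
`⟨v, A v⟩` (`IsLerayHopf.energy_balance`): its increment is twice the time integral of a viscous
term, the convective flux `convection v (A v)` and a forcing term.

The flux has exact Kármán–Howarth–Monin expressions through third order increments: as an integral
of `a'(|h|²)` against `∫ |δ_h v|² δ_h v · h`, or of `a''(|h|²)` against `∫ (δ_h v · h)³`
(`convection_radial_eq_incrZero`, `convection_radial_eq_incrPar`). Let `-a'`, respectively `a''`, be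
a bump concentrating at `ℓ²`. Then `k` approaches, up to a factor, the indicator of the ball of
radius `ℓ`, respectively `(ℓ² - |h|²)₊`, and the flux divided by `Z` tends to `(3/4) S_0(ℓ)/ℓ`,
respectively `(5/4) S_∥(ℓ)/ℓ`. Both laws thus arise at each single scale `ℓ`, without averaging in
`ℓ`, and share the remaining argument through `IsStructureProfile`.

Dividing the balance by `2Z` and adding `ε_ν`, which enters through its definition only, leaves
errors measured by `rough u ℓ`, a Fourier quantity dominating the squared `L²` increments over
separations up to `2ℓ` (`IsLerayHopf.deviation_le`). The endpoint terms cost `rough vin ℓ` and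
`rough (v t) ℓ`. The viscous term costs `ν ℓ⁻² ∫ rough`, by the quadratic Fourier decay of `k / Z`.
The force costs `∫ ‖f‖ √rough`.

Interpolation between `L²` and `H^α` gives `∫ rough (v r) ℓ dr ≤ C ℓ^{αq}` uniformly in `ν`. Hence
the viscous error is at most a constant times `ν ℓ^{αq-2} ≤ ν^{1-K(2-αq)}` for `ℓ ≥ ν^K`, which
vanishes exactly because `K < 1/(2-αq)`. The datum is independent of `ν`, so `rough vin ℓ → 0` needs
no rate. The force is handled by a truncation that uses its integrability exponent `1 + σ`. The term
`rough (v t) ℓ` is bounded in `t` but small only in time average, which is why the conclusion is in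
`L^p(0,1)` with `p < ∞`.

The embedding of `H¹` in `L³` makes the cubic quantities meaningful and dominates the limit of
profiles for each fixed `ν`; it does not enter the estimates uniform in `ν`. -/

noncomputable section

namespace NavierStokes

/-! ### Measure theory of the covering `ℝ³ → 𝕋³` -/

section Torus

lemma proj_add (a b : Vec) : proj (a + b) = proj a + proj b := by
  ext j; simp [proj]

@[simp] lemma proj_zero : proj 0 = 0 := by
  ext j; simp [proj]

@[fun_prop] lemma continuous_proj : Continuous proj := by
  unfold proj
  refine continuous_pi fun j => ?_
  exact (AddCircle.continuous_mk' 1).comp (by fun_prop)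

@[fun_prop] lemma measurable_proj : Measurable proj := continuous_proj.measurable

/-- The unit cell centred at the origin. -/
def cell : Set Vec := {h | ∀ j, h j ∈ Ioc (-(1 / 2) : ℝ) (-(1 / 2) + 1)}

lemma measurableSet_cell : MeasurableSet cell := by
  unfold cell
  simp only [ofPred_forall]
  refine MeasurableSet.iInter fun j => ?_
  exact measurableSet_Ioc.preimage (by fun_prop)

lemma cell_mem_nhds : cell ∈ 𝓝 (0 : Vec) := by
  unfold cell
  simp only [ofPred_forall]
  refine (Filter.iInter_mem).2 fun j => ?_
  have : Continuous fun h : Vec => h j := by fun_prop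
  refine this.continuousAt.preimage_mem_nhds ?_
  exact Ioc_mem_nhds (by simp) (by norm_num)

lemma measurePreserving_proj :
    MeasurePreserving proj (volume.restrict cell) torusMeasure := by
  have h1 : MeasurePreserving (fun (x : Fin 3 → ℝ) (i : Fin 3) => ((x i : ℝ) : UnitAddCircle))
      (Measure.pi fun _ : Fin 3 => volume.restrict (Ioc (-(1 / 2) : ℝ) (-(1 / 2) + 1)))
      torusMeasure := by
    refine measurePreserving_pi _ _ (fun i => ?_)
    have := AddCircle.measurePreserving_mk 1 (-(1/2) : ℝ)
    convert! this
    simp [volume, AddCircle.haarAddCircle]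
  rw [← Measure.restrict_pi_pi] at h1
  have h2 := (EuclideanSpace.volume_preserving_symm_measurableEquiv_toLp (Fin 3)).restrict_preimage
    (s := univ.pi fun _ : Fin 3 => Ioc (-(1 / 2) : ℝ) (-(1 / 2) + 1))
    (MeasurableSet.univ_pi fun _ => measurableSet_Ioc)
  have h3 := h1.comp h2
  convert! h3 using 2
  ext x; simp [cell]

lemma lintegral_cell (F : Torus → ℝ≥0∞) (hF : Measurable F) (x : Torus) (y : Vec) :
    ∫⁻ h in (fun h => -y + h) ⁻¹' cell, F (x + proj h) = ∫⁻ z, F z ∂torusMeasure := by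
  have hm : Measurable fun z : Torus => F (x + proj y + z) := by fun_prop
  have h1 : ∫⁻ h in (fun h => -y + h) ⁻¹' cell, F (x + proj h)
      = ∫⁻ h in cell, F (x + proj y + proj h) := by
    have := ((measurePreserving_add_left (volume : Measure Vec) (-y)).restrict_preimage
      measurableSet_cell).lintegral_comp (f := fun h => F (x + proj y + proj h)) (by fun_prop)
    rw [← this]
    congr 1
    ext h
    rw [add_assoc, ← proj_add]; simp
  rw [h1, measurePreserving_proj.lintegral_comp hm]
  exact (measurePreserving_add_left torusMeasure (x + proj y)).lintegral_comp hF

/-- The ball is compact, so finitely many translates of the unit cell cover it, and each translate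
contributes exactly one integral over the torus. The constant depends on `R` alone, hence the later
kernel bounds are uniform in `x`. -/
lemma exists_lintegral_closedBall_le (R : ℝ) : ∃ C : ℝ≥0∞, C ≠ ∞ ∧
    ∀ F : Torus → ℝ≥0∞, Measurable F → ∀ x,
      ∫⁻ h in Metric.closedBall (0 : Vec) R, F (x + proj h) ≤ C * ∫⁻ z, F z ∂torusMeasure := by
  obtain ⟨t, -, ht⟩ := (isCompact_closedBall (0 : Vec) R).elim_nhds_subcover
    (fun y => (fun h => -y + h) ⁻¹' cell) (fun y _ => by
      have : ContinuousAt (fun h : Vec => -y + h) y := by fun_prop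
      exact this.preimage_mem_nhds (by simpa using cell_mem_nhds))
  refine ⟨t.card, by simp, fun F hF x => ?_⟩
  have ht' : Metric.closedBall (0 : Vec) R ⊆ ⋃ y : t, (fun h => -(y : Vec) + h) ⁻¹' cell := by
    simpa [iUnion_subtype] using ht
  calc _ ≤ ∫⁻ h in ⋃ y : t, (fun h => -(y : Vec) + h) ⁻¹' cell, F (x + proj h) :=
        lintegral_mono_set ht'
    _ ≤ ∑' y : t, ∫⁻ h in (fun h => -(y : Vec) + h) ⁻¹' cell, F (x + proj h) := by
        rw [← lintegral_sum_measure]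
        exact lintegral_mono' Measure.restrict_iUnion_le le_rfl
    _ = _ := by simp [lintegral_cell F hF, tsum_fintype]

/-- Lets almost everywhere statements on the torus be lifted to almost every separation `h`, with
the base point `x` fixed. -/
lemma quasiMeasurePreserving_add_proj (x : Torus) :
    Measure.QuasiMeasurePreserving (fun h : Vec => x + proj h) volume torusMeasure := by
  refine ⟨by fun_prop, Measure.AbsolutelyContinuous.mk fun s hs h0 => ?_⟩
  rw [Measure.map_apply (by fun_prop) hs]
  have hu : (fun h : Vec => x + proj h) ⁻¹' s
      ⊆ ⋃ n : ℕ, ((fun h : Vec => x + proj h) ⁻¹' s) ∩ Metric.closedBall 0 n := by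
    intro h hh
    obtain ⟨n, hn⟩ := exists_nat_ge ‖h‖
    exact mem_iUnion.2 ⟨n, hh, by simpa using hn⟩
  refine measure_mono_null hu (measure_iUnion_null fun n => ?_)
  obtain ⟨C, hC, H⟩ := exists_lintegral_closedBall_le n
  have := H (s.indicator 1) (measurable_one.indicator hs) x
  rw [lintegral_indicator_one hs, h0, mul_zero, nonpos_iff_eq_zero] at this
  rw [← this, ← Measure.restrict_apply (hs.preimage (by fun_prop)),
    ← lintegral_indicator_one (hs.preimage (by fun_prop))]
  rfl

variable {F : Type*} [NormedAddCommGroup F]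

lemma integrableOn_closedBall {u : Torus → F} (hu : Integrable u torusMeasure) (x : Torus)
    (R : ℝ) : IntegrableOn (fun h : Vec => u (x + proj h)) (Metric.closedBall 0 R) := by
  have hm : AEStronglyMeasurable (fun h : Vec => u (x + proj h)) volume :=
    hu.1.comp_quasiMeasurePreserving (quasiMeasurePreserving_add_proj x)
  refine ⟨hm.restrict, ?_⟩
  obtain ⟨C, hC, H⟩ := exists_lintegral_closedBall_le R
  obtain ⟨g, hg, hge⟩ := hu.1.enorm
  have h1 : ∀ᵐ h : Vec, ‖u (x + proj h)‖ₑ = g (x + proj h) :=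
    (quasiMeasurePreserving_add_proj x).ae hge
  rw [HasFiniteIntegral, lintegral_congr_ae (ae_restrict_of_ae h1)]
  refine (H g hg x).trans_lt (ENNReal.mul_lt_top hC.lt_top ?_)
  rw [← lintegral_congr_ae hge]
  exact hu.2

lemma exists_integral_closedBall_le (R : ℝ) : ∃ C : ℝ, 0 ≤ C ∧
    ∀ u : Torus → ℝ, Integrable u torusMeasure → (∀ z, 0 ≤ u z) → ∀ x,
      ∫ h in Metric.closedBall (0 : Vec) R, u (x + proj h) ≤ C * ∫ z, u z ∂torusMeasure := by
  obtain ⟨C, hC, H⟩ := exists_lintegral_closedBall_le R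
  refine ⟨C.toReal, by positivity, fun u hu h0 x => ?_⟩
  obtain ⟨g, hg, hge⟩ := hu.1.aemeasurable.ennreal_ofReal
  have h1 : ∀ᵐ h : Vec, ENNReal.ofReal (u (x + proj h)) = g (x + proj h) :=
    (quasiMeasurePreserving_add_proj x).ae hge
  rw [integral_eq_lintegral_of_nonneg_ae (by filter_upwards with z using h0 z) hu.1,
    integral_eq_lintegral_of_nonneg_ae (by filter_upwards with z using h0 _)
      (integrableOn_closedBall hu x R).1, ← ENNReal.toReal_mul]
  have h2 : ∫⁻ z, ENNReal.ofReal (u z) ∂torusMeasure ≠ ∞ := by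
    refine ((hasFiniteIntegral_iff_ofReal (by filter_upwards with z using h0 z)).1 hu.2).ne
  refine ENNReal.toReal_mono (ENNReal.mul_ne_top hC h2) ?_
  rw [lintegral_congr_ae (ae_restrict_of_ae h1), lintegral_congr_ae hge]
  exact H g hg x

lemma locallyIntegrable_comp_proj {u : Torus → F} (hu : Integrable u torusMeasure) (x : Torus) :
    LocallyIntegrable (fun h : Vec => u (x + proj h)) := by
  intro y
  refine ⟨Metric.closedBall 0 (‖y‖ + 1), ?_, integrableOn_closedBall hu x _⟩
  refine mem_of_superset (Metric.ball_mem_nhds y one_pos) fun z hz => ?_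
  have := norm_sub_norm_le z y
  rw [Metric.mem_ball, dist_eq_norm] at hz
  simp; linarith

/-- The shear `(x, h) ↦ (x + h, h)` preserves the measure of `𝕋³ × ℝ³`. -/
lemma measurePreserving_shear :
    MeasurePreserving (fun p : Torus × Vec => (p.1 + proj p.2, p.2))
      (torusMeasure.prod volume) (torusMeasure.prod volume) := by
  have h1 : MeasurePreserving (fun p : Vec × Torus => (p.1, p.2 + proj p.1))
      (volume.prod torusMeasure) (volume.prod torusMeasure) := by
    refine (MeasurePreserving.id volume).skew_product (g := fun h x => x + proj h) ?_ ?_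
    · fun_prop
    · exact Eventually.of_forall fun h => (measurePreserving_add_right torusMeasure (proj h)).map_eq
  exact Measure.measurePreserving_swap.comp (h1.comp Measure.measurePreserving_swap)

/-- The exchange `(x, h) ↦ (x + h, -h)` of the two points preserves the measure. -/
lemma measurePreserving_exchange :
    MeasurePreserving (fun p : Torus × Vec => (p.1 + proj p.2, -p.2))
      (torusMeasure.prod volume) (torusMeasure.prod volume) :=
  ((MeasurePreserving.id torusMeasure).prod
    (Measure.measurePreserving_neg (volume : Measure Vec))).comp measurePreserving_shear

end Torus

/-! ### Regularization by kernels and divergence-free fields -/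

section Regularization

open scoped Convolution

lemma isOpenQuotientMap_proj : IsOpenQuotientMap proj := by
  have h1 : IsOpenQuotientMap (fun t : ℝ => (t : UnitAddCircle)) :=
    QuotientAddGroup.isOpenQuotientMap_mk
  have h2 := IsOpenQuotientMap.piMap (fun _ : Fin 3 => h1)
  exact h2.comp (EuclideanSpace.equiv (Fin 3) ℝ).toHomeomorph.isOpenQuotientMap

section
variable {F : Type*} [NormedAddCommGroup F] [NormedSpace ℝ F]

lemma Smooth.continuous {g : Torus → F} (hg : Smooth g) : Continuous g :=
  isOpenQuotientMap_proj.isQuotientMap.continuous_iff.2 (ContDiff.continuous hg)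

/-- The correlation of a field on the torus with a kernel on `ℝ³`. -/
def conv (k : Vec → ℝ) (u : Torus → F) (x : Torus) : F := ∫ h : Vec, k h • u (x + proj h)

/-- The partial derivative of a kernel. -/
def kderiv (j : Fin 3) (k : Vec → ℝ) (h : Vec) : ℝ := fderiv ℝ k h (EuclideanSpace.single j 1)

variable {k : Vec → ℝ} {u : Torus → F}

lemma integrable_kernel_smul (hk : Continuous k) (hc : HasCompactSupport k)
    (hu : Integrable u torusMeasure) (x : Torus) :
    Integrable (fun h : Vec => k h • u (x + proj h)) :=
  (locallyIntegrable_comp_proj hu x).integrable_smul_left_of_hasCompactSupport hk hc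

lemma exists_norm_conv_le (hk : Continuous k) (hc : HasCompactSupport k) : ∃ C : ℝ, 0 ≤ C ∧
    ∀ u : Torus → F, Integrable u torusMeasure → ∀ x,
      ∫ h : Vec, ‖k h • u (x + proj h)‖ ≤ C * ∫ z, ‖u z‖ ∂torusMeasure := by
  obtain ⟨R, hR⟩ := hc.isCompact.isBounded.subset_closedBall 0
  obtain ⟨M, hM⟩ := hc.exists_bound_of_continuous hk
  obtain ⟨C, hC0, hC⟩ := exists_integral_closedBall_le R
  have hM0 : 0 ≤ M := (norm_nonneg _).trans (hM 0)
  refine ⟨M * C, by positivity, fun u hu x => ?_⟩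
  have hs : ∀ h ∉ Metric.closedBall (0 : Vec) R, ‖k h • u (x + proj h)‖ = 0 := by
    intro h hh
    have : k h = 0 := image_eq_zero_of_notMem_tsupport fun h' => hh (hR h')
    simp [this]
  rw [← setIntegral_eq_integral_of_forall_compl_eq_zero hs]
  calc _ ≤ ∫ h in Metric.closedBall (0 : Vec) R, M * ‖u (x + proj h)‖ := by
        refine integral_mono (integrable_kernel_smul hk hc hu x).norm.integrableOn
          ((integrableOn_closedBall hu x R).norm.const_mul M) fun h => ?_
        rw [norm_smul]
        gcongr
        exact hM h
    _ = M * ∫ h in Metric.closedBall (0 : Vec) R, ‖u (x + proj h)‖ := integral_const_mul _ _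
    _ ≤ _ := by
        rw [mul_assoc]
        gcongr
        exact hC _ hu.norm (fun _ => norm_nonneg _) x

omit [NormedSpace ℝ F] in
lemma fderiv_reflect (hk : Differentiable ℝ k) (h : Vec) :
    fderiv ℝ (fun h => k (-h)) h = -fderiv ℝ k (-h) := by
  have := (hk (-h)).hasFDerivAt.comp h (hasFDerivAt_id h).neg
  rw [show (fun h => k (-h)) = k ∘ Neg.neg from rfl, this.fderiv]
  ext; simp

/-- A correlation becomes a convolution after reflecting the kernel. This gives access to the
differentiation theory of convolutions on `ℝ³`, and it is the source of the minus sign in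
`pderiv_conv`. -/
lemma conv_proj (k : Vec → ℝ) (u : Torus → F) (y : Vec) :
    conv k u (proj y)
      = ((fun h => k (-h)) ⋆[ContinuousLinearMap.lsmul ℝ ℝ, volume] fun h => u (proj h)) y := by
  rw [conv, convolution_def, ← integral_neg_eq_self]
  simp [proj_add, sub_eq_add_neg]

variable (hk : ContDiff ℝ (⊤ : ℕ∞) k) (hc : HasCompactSupport k) (hu : Integrable u torusMeasure)
include hk hc

omit hc in
lemma contDiff_kderiv (j : Fin 3) : ContDiff ℝ (⊤ : ℕ∞) (kderiv j k) := by
  unfold kderiv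
  exact (hk.fderiv_right (by simp)).clm_apply contDiff_const

omit hk in
lemma hasCompactSupport_kderiv (j : Fin 3) : HasCompactSupport (kderiv j k) :=
  hc.fderiv_apply (𝕜 := ℝ) _

include hu

lemma smooth_conv : Smooth (conv k u) := by
  unfold Smooth
  simp_rw [conv_proj]
  have hu' := locallyIntegrable_comp_proj hu 0
  simp only [zero_add] at hu'
  exact (hc.comp_homeomorph (Homeomorph.neg Vec)).contDiff_convolution_left _
    (hk.comp contDiff_neg) hu'

lemma pderiv_conv (j : Fin 3) (x : Torus) : pderiv j (conv k u) x = -conv (kderiv j k) u x := by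
  obtain ⟨y, rfl⟩ := isOpenQuotientMap_proj.surjective x
  have hu' := locallyIntegrable_comp_proj hu 0
  simp only [zero_add] at hu'
  set e : Vec := EuclideanSpace.single j 1
  have hcn : HasCompactSupport fun h => k (-h) := hc.comp_homeomorph (Homeomorph.neg Vec)
  have hkn : ContDiff ℝ (⊤ : ℕ∞) fun h => k (-h) := hk.comp contDiff_neg
  have h1 := hcn.hasFDerivAt_convolution_left (ContinuousLinearMap.lsmul ℝ ℝ)
    (hkn.of_le (by exact_mod_cast le_top)) hu' (x₀ := y)
  have h2 : HasDerivAt (fun s : ℝ => y + EuclideanSpace.single j s) e 0 := by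
    have : (fun s : ℝ => y + EuclideanSpace.single j s) = fun s => y + s • e := by
      ext s i; simp [e]
    rw [this]
    simpa using ((hasDerivAt_id (0 : ℝ)).smul_const e).const_add y
  have h3 := HasFDerivAt.comp_hasDerivAt_of_eq (0 : ℝ) h1 h2 (by simp)
  have h4 : pderiv j (conv k u) (proj y) = deriv (((fun h => k (-h))
      ⋆[ContinuousLinearMap.lsmul ℝ ℝ, volume] fun h => u (proj h)) ∘
        fun s : ℝ => y + EuclideanSpace.single j s) 0 := by
    unfold pderiv
    simp_rw [← proj_add, conv_proj]
    rfl
  rw [h4, h3.deriv, conv_proj]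
  rw [convolution_def, convolution_def, ContinuousLinearMap.integral_apply, ← integral_neg]
  · congr 1
    ext h
    have : fderiv ℝ (fun h => k (-h)) h = -fderiv ℝ k (-h) := by
      exact fderiv_reflect (hk.differentiable (by simp)) h
    simp [this, kderiv, ContinuousLinearMap.precompL_apply, e]
  · exact (hcn.fderiv ℝ).convolutionExists_left _
      (hkn.continuous_fderiv (by simp)) hu' y

lemma lap_conv (x : Torus) :
    lap (conv k u) x = conv (fun h => ∑ j, kderiv j (kderiv j k) h) u x := by
  have h1 : ∀ j, pderiv j (pderiv j (conv k u)) x = conv (kderiv j (kderiv j k)) u x := by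
    intro j
    have h2 : pderiv j (conv k u) = fun x => conv (fun h => -kderiv j k h) u x := by
      ext1 x
      rw [pderiv_conv hk hc hu]; simp [conv, integral_neg]
    have hk' := contDiff_kderiv hk j
    have hc' := hasCompactSupport_kderiv hc j
    rw [h2, pderiv_conv hk'.neg hc'.neg hu]
    simp only [conv, ← integral_neg]
    congr 1; ext h
    have : kderiv j (fun h => -kderiv j k h) h = -kderiv j (kderiv j k) h := by
      rw [kderiv, fderiv_fun_neg]; rfl
    simp [this]
  simp only [lap, h1, conv, Finset.sum_smul]
  rw [integral_finsetSum]
  intro j _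
  exact integrable_kernel_smul (contDiff_kderiv (contDiff_kderiv hk j) j).continuous
    (hasCompactSupport_kderiv (hasCompactSupport_kderiv hc j) j) hu x

end

section
variable {F : Type*} [NormedAddCommGroup F] [InnerProductSpace ℝ F] [CompleteSpace F]
variable {k : Vec → ℝ} {u w : Torus → F}

lemma integrable_kernel_left {φ : Torus → ℝ} (hk : Integrable k) (hφ : Integrable φ torusMeasure) :
    Integrable (fun p : Torus × Vec => k p.2 * φ p.1) (torusMeasure.prod volume) := by
  simpa [mul_comm] using hφ.mul_prod hk

lemma integrable_kernel_right {φ : Torus → ℝ} (hk : Integrable k)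
    (hφ : Integrable φ torusMeasure) :
    Integrable (fun p : Torus × Vec => k p.2 * φ (p.1 + proj p.2)) (torusMeasure.prod volume) :=
  measurePreserving_shear.integrable_comp_of_integrable (integrable_kernel_left hk hφ)

omit [InnerProductSpace ℝ F] [CompleteSpace F] in
lemma aestronglyMeasurable_right (hu : AEStronglyMeasurable u torusMeasure) :
    AEStronglyMeasurable (fun p : Torus × Vec => u (p.1 + proj p.2))
      (torusMeasure.prod volume) :=
  (hu.comp_quasiMeasurePreserving Measure.quasiMeasurePreserving_fst).comp_measurePreserving
    measurePreserving_shear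

omit [InnerProductSpace ℝ F] [CompleteSpace F] in
lemma aestronglyMeasurable_left (hu : AEStronglyMeasurable u torusMeasure) :
    AEStronglyMeasurable (fun p : Torus × Vec => u p.1) (torusMeasure.prod volume) :=
  hu.comp_quasiMeasurePreserving Measure.quasiMeasurePreserving_fst

lemma aestronglyMeasurable_kernel (hk : AEStronglyMeasurable k) :
    AEStronglyMeasurable (fun p : Torus × Vec => k p.2) (torusMeasure.prod volume) :=
  hk.comp_quasiMeasurePreserving Measure.quasiMeasurePreserving_snd

omit [CompleteSpace F] in
lemma integrable_kernel_inner (hk : Integrable k) (hu : MemLp u 2 torusMeasure)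
    (hw : MemLp w 2 torusMeasure) :
    Integrable (fun p : Torus × Vec => k p.2 * inner ℝ (w p.1) (u (p.1 + proj p.2)))
      (torusMeasure.prod volume) := by
  refine ((integrable_kernel_left hk.norm hw.integrable_norm_pow').add
    (integrable_kernel_right hk.norm hu.integrable_norm_pow')).mono
    ((aestronglyMeasurable_kernel hk.1).mul
      ((aestronglyMeasurable_left hw.1).inner (aestronglyMeasurable_right hu.1))) ?_
  filter_upwards with p
  simp only [norm_mul, Pi.add_apply]
  have h1 := norm_inner_le_norm (𝕜 := ℝ) (w p.1) (u (p.1 + proj p.2))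
  have h2 := two_mul_le_add_sq ‖w p.1‖ ‖u (p.1 + proj p.2)‖
  have h3 := norm_nonneg (w p.1)
  have h4 := norm_nonneg (u (p.1 + proj p.2))
  rw [← mul_add]
  refine le_trans ?_ (le_abs_self _)
  gcongr
  rw [Real.norm_eq_abs] at h1
  norm_num
  nlinarith [mul_nonneg h3 h4]

/-- `∫ w(x) · u(x + h) dx`. -/
def corr (w u : Torus → F) (h : Vec) : ℝ := ∫ x, inner ℝ (w x) (u (x + proj h)) ∂torusMeasure

omit [CompleteSpace F] in
lemma corr_neg (w u : Torus → F) (h : Vec) : corr w u (-h) = corr u w h := by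
  unfold corr
  rw [← (measurePreserving_add_right torusMeasure (proj h)).integral_comp
    (MeasurableEquiv.addRight (proj h)).measurableEmbedding]
  congr 1; ext x
  rw [add_assoc, ← proj_add, real_inner_comm]; simp

/-- Fubini moves the kernel outside, so questions about regularized pairings become questions about
`corr w u` as a function of the separation. -/
lemma integral_inner_conv (hk : Continuous k) (hc : HasCompactSupport k)
    (hu : MemLp u 2 torusMeasure) (hw : MemLp w 2 torusMeasure) :
    ∫ x, inner ℝ (w x) (conv k u x) ∂torusMeasure = ∫ h, k h * corr w u h := by
  have h1 := integrable_kernel_inner (hk.integrable_of_hasCompactSupport hc) hu hw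
  have hu1 := hu.integrable one_le_two
  calc _ = ∫ x, (∫ h, k h * inner ℝ (w x) (u (x + proj h))) ∂torusMeasure := by
        congr 1; ext x
        simp only [conv]
        rw [← integral_inner (integrable_kernel_smul hk hc hu1 x)]
        simp [inner_smul_right]
    _ = _ := by
        rw [integral_integral_swap h1]
        simp [corr, integral_const_mul]

end

lemma memLp_of_continuous {F : Type*} [NormedAddCommGroup F] {φ : Torus → F} (hφ : Continuous φ)
    (p : ℝ≥0∞) : MemLp φ p torusMeasure :=
  hφ.memLp_of_hasCompactSupport (HasCompactSupport.of_compactSpace φ)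

lemma memLp_coord {p : ℝ≥0∞} {u : Torus → Vec} (hu : MemLp u p torusMeasure) (j : Fin 3) :
    MemLp (fun x => u x j) p torusMeasure :=
  (EuclideanSpace.proj (𝕜 := ℝ) j).comp_memLp' hu

lemma fderiv_eq_sum_kderiv (k : Vec → ℝ) (h w : Vec) :
    fderiv ℝ k h w = ∑ j, kderiv j k h * w j := by
  have : w = ∑ j, w j • (EuclideanSpace.single j 1 : Vec) := by
    ext i; simp [Finset.sum_apply, Pi.single_apply]
  conv_lhs => rw [this]
  simp [kderiv, mul_comm]

variable {k : Vec → ℝ}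

/-- The correlation with a gradient kernel of a divergence-free field vanishes. -/
theorem integral_fderiv_kernel_eq_zero (hk : ContDiff ℝ (⊤ : ℕ∞) k) (hc : HasCompactSupport k)
    {u : L2} (hu : WeaklyDivFree u) (x : Torus) : ∫ h, fderiv ℝ k h (u (x + proj h)) = 0 := by
  have hu2 : ∀ j, MemLp (fun x => u x j) 2 torusMeasure := fun j => memLp_coord (Lp.memLp u) j
  have hu1 : ∀ j, Integrable (fun x => u x j) torusMeasure := fun j =>
    (hu2 j).integrable one_le_two
  have hkd := fun j => contDiff_kderiv hk j
  have hcd := fun j => hasCompactSupport_kderiv hc j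
  set d : Torus → ℝ := fun x => ∑ j, conv (kderiv j k) (fun x => u x j) x with hd
  have hdc : Continuous d := continuous_finsetSum _ fun j _ =>
    (smooth_conv (hkd j) (hcd j) (hu1 j)).continuous
  have hkn : ContDiff ℝ (⊤ : ℕ∞) fun h => k (-h) := hk.comp contDiff_neg
  have hcn : HasCompactSupport fun h => k (-h) := hc.comp_homeomorph (Homeomorph.neg Vec)
  have hneg : ∀ j h, kderiv j (fun h => k (-h)) h = -kderiv j k (-h) := by
    intro j h
    simp [kderiv, fderiv_reflect (hk.differentiable (by simp)) h]
  -- Duality: the adjoint of correlation with `k` is correlation with the reflected kernel. Moving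
  -- the operator off `u` turns `∫ d²` into the pairing of `u` with the gradient of a smooth
  -- function, where weak incompressibility applies.
  have key : ∫ x, d x * d x ∂torusMeasure = 0 := by
    have hdi := (memLp_of_continuous hdc 1).integrable le_rfl
    have hd2 := memLp_of_continuous hdc 2
    have h1 : ∀ j, ∫ x, conv (kderiv j k) (fun x => u x j) x * d x ∂torusMeasure
        = ∫ x, u x j * pderiv j (conv (fun h => k (-h)) d) x ∂torusMeasure := by
      intro j
      have e1 := integral_inner_conv (hkd j).continuous (hcd j) (hu2 j) hd2
      have e2 := integral_inner_conv (contDiff_kderiv hkn j).continuous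
        (hasCompactSupport_kderiv hcn j) hd2 (hu2 j)
      simp only [RCLike.inner_apply, conj_trivial] at e1 e2
      simp only [pderiv_conv hkn hcn hdi, mul_neg, integral_neg]
      rw [e1]
      simp_rw [mul_comm (u _ j)]
      rw [e2, ← integral_neg_eq_self, ← integral_neg]
      congr 1; ext h
      rw [hneg, corr_neg]; ring
    have h2 := hu _ (smooth_conv hkn hcn hdi)
    have hpc : ∀ j, Continuous fun x => pderiv j (conv (fun h => k (-h)) d) x := by
      intro j
      simp only [pderiv_conv hkn hcn hdi]
      exact (smooth_conv (contDiff_kderiv hkn j) (hasCompactSupport_kderiv hcn j)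
        hdi).continuous.neg
    rw [integral_finsetSum _ fun j _ => by
      exact (hu2 j).integrable_mul (memLp_of_continuous (hpc j) 2)] at h2
    calc _ = ∫ x, ∑ j, conv (kderiv j k) (fun x => u x j) x * d x ∂torusMeasure := by
          congr 1; ext x; rw [← Finset.sum_mul]
      _ = ∑ j, ∫ x, conv (kderiv j k) (fun x => u x j) x * d x ∂torusMeasure := by
          refine integral_finsetSum _ fun j _ => ?_
          exact (memLp_of_continuous (smooth_conv (hkd j) (hcd j) (hu1 j)).continuous 2).integrable_mul
            hd2
      _ = 0 := by simp_rw [h1]; exact h2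
  -- The polarization argument needs the cancellation at every base point; continuity of `d`
  -- upgrades the almost everywhere statement.
  have hd0 : d = 0 := by
    have h3 := (integral_eq_zero_iff_of_nonneg (fun x => mul_self_nonneg (d x))
      ((memLp_of_continuous (hdc.mul hdc) 1).integrable le_rfl)).1 key
    have h4 : (fun x => d x * d x) = 0 := (hdc.mul hdc).ae_eq_iff_eq torusMeasure continuous_zero |>.1 h3
    ext x
    exact mul_self_eq_zero.1 (congrFun h4 x)
  have h5 : ∫ h, fderiv ℝ k h (u (x + proj h)) = d x := by
    simp only [hd, conv, fderiv_eq_sum_kderiv]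
    rw [integral_finsetSum]
    · rfl
    · intro j _
      exact integrable_kernel_smul (hkd j).continuous (hcd j) (hu1 j) x
  rw [h5, hd0]; rfl

/-- Regularizing a divergence-free field by a kernel gives an admissible test field. -/
theorem solenoidalTest_conv (hk : ContDiff ℝ (⊤ : ℕ∞) k) (hc : HasCompactSupport k)
    {u : L2} (hu : WeaklyDivFree u) : SolenoidalTest (conv k u) := by
  have hu1 : Integrable u torusMeasure := (Lp.memLp u).integrable one_le_two
  refine ⟨smooth_conv hk hc hu1, fun x => ?_⟩
  have h1 : ∀ j, conv (kderiv j k) u x j = ∫ h, kderiv j k h * u (x + proj h) j := by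
    intro j
    have := (EuclideanSpace.proj (𝕜 := ℝ) j).integral_comp_comm (integrable_kernel_smul
      (contDiff_kderiv hk j).continuous (hasCompactSupport_kderiv hc j) hu1 x)
    simpa [conv] using this.symm
  have h2 := integral_fderiv_kernel_eq_zero hk hc hu x
  simp only [fderiv_eq_sum_kderiv] at h2
  rw [integral_finsetSum _ fun j _ => by
    exact integrable_kernel_smul (contDiff_kderiv hk j).continuous
      (hasCompactSupport_kderiv hc j) ((memLp_coord (Lp.memLp u) j).integrable one_le_two) x] at h2
  simp [pderiv_conv hk hc hu1, h1, h2]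

end Regularization

/-! ### Product rule for weakly continuous curves -/

section ProductRule

/-- A product rule for weakly continuous curves: if the increments of `F` are given by the
integral of `B r s + B r t` and `B r` is continuous, then the increment of `F` is twice the
integral of `B` along the diagonal. -/
theorem sub_eq_two_mul_integral_diag {F : ℝ → ℝ} {B : ℝ → ℝ → ℝ} {m : ℝ → ℝ} {T : ℝ}
    (hT : 0 ≤ T) (hm : IntervalIntegrable m volume 0 T)
    (hmeas : ∀ τ ∈ Icc 0 T, AEStronglyMeasurable (fun r => B r τ) (volume.restrict (Ioc 0 T)))
    (hbd : ∀ᵐ r ∂volume.restrict (Ioc 0 T), ∀ τ ∈ Icc 0 T, |B r τ| ≤ m r)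
    (hcont : ∀ᵐ r ∂volume.restrict (Ioc 0 T), ContinuousOn (B r) (Icc 0 T))
    (hF : ∀ s t, 0 ≤ s → s ≤ t → t ≤ T → F t - F s = ∫ r in s..t, (B r s + B r t)) :
    IntervalIntegrable (fun r => B r r) volume 0 T ∧
      F T - F 0 = 2 * ∫ r in 0..T, B r r := by
  rcases hT.eq_or_lt with rfl | hT
  · simp
  have hint : ∀ τ ∈ Icc 0 T, IntervalIntegrable (fun r => B r τ) volume 0 T := by
    intro τ hτ
    rw [intervalIntegrable_iff_integrableOn_Ioc_of_le hT.le] at hm ⊢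
    refine Integrable.mono' hm (hmeas τ hτ) ?_
    filter_upwards [hbd] with r hr using hr τ hτ
  -- Right and left endpoints of the cell containing `r` in the partition of `(0, T]` into `n + 1`
  -- equal half-open intervals `(a n i, a n (i + 1)]`.
  set hi : ℕ → ℝ → ℝ := fun n r => T * ⌈(n + 1) * r / T⌉₊ / (n + 1) with hhi
  set lo : ℕ → ℝ → ℝ := fun n r => hi n r - T / (n + 1) with hlo
  set a : ℕ → ℕ → ℝ := fun n i => T * i / (n + 1) with ha
  have han : ∀ n, a n (n + 1) = T := by
    intro n; simp only [ha]; push_cast; field_simp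
  have ha0 : ∀ n, a n 0 = 0 := by intro n; simp [ha]
  have hstep : ∀ n i, a n (i + 1) = a n i + T / (n + 1) := by
    intro n i; simp only [ha]; push_cast; field_simp
  have hmono : ∀ n, Monotone (a n) := fun n => monotone_nat_of_le_succ fun i => by
    rw [hstep]; have : 0 < T / (n + 1 : ℝ) := by positivity
    linarith
  have hmem : ∀ n i, i ≤ n + 1 → a n i ∈ Icc 0 T := fun n i hi' =>
    ⟨by rw [← ha0 n]; exact hmono n (Nat.zero_le i), by
      conv_rhs => rw [← han n]
      exact hmono n hi'⟩
  have hhi_eq : ∀ n i, ∀ r ∈ Ioc (a n i) (a n (i + 1)), hi n r = a n (i + 1) := by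
    intro n i r hr
    have : ⌈(n + 1) * r / T⌉₊ = i + 1 := by
      rw [Nat.ceil_eq_iff (by omega)]
      simp only [ha, mem_Ioc] at hr
      rw [div_lt_iff₀ (by positivity), le_div_iff₀ (by positivity)] at hr
      rw [lt_div_iff₀ hT, div_le_iff₀ hT]
      simp only [Nat.add_sub_cancel]
      push_cast at hr ⊢
      constructor <;> linarith [hr.1, hr.2]
    simp only [hhi, ha, this]
  have hlo_eq : ∀ n i, ∀ r ∈ Ioc (a n i) (a n (i + 1)), lo n r = a n i := by
    intro n i r hr
    simp only [hlo]
    rw [hhi_eq n i r hr, hstep]; ring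
  have hcover : ∀ n, ∀ r ∈ Ioc 0 T, ∃ i < n + 1, r ∈ Ioc (a n i) (a n (i + 1)) := by
    intro n r hr
    have hpos : 0 < ⌈(n + 1) * r / T⌉₊ := Nat.ceil_pos.2 (by have := hr.1; positivity)
    obtain ⟨i, hi'⟩ := Nat.exists_eq_succ_of_ne_zero hpos.ne'
    have h1 := (Nat.ceil_eq_iff (by omega)).1 hi'
    simp only [Nat.succ_eq_add_one, Nat.add_sub_cancel] at h1
    rw [lt_div_iff₀ hT, div_le_iff₀ hT] at h1
    refine ⟨i, ?_, ?_⟩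
    · have h2 : (i : ℝ) * T < (n + 1) * T := h1.1.trans_le (by have := hr.2; gcongr)
      have h3 := lt_of_mul_lt_mul_right h2 hT.le
      exact_mod_cast h3
    · simp only [ha, mem_Ioc]
      rw [div_lt_iff₀ (by positivity), le_div_iff₀ (by positivity)]
      constructor <;> linarith [h1.1, h1.2]
  have hpiece : ∀ n, ∀ i < n + 1, IntervalIntegrable (fun r => B r (lo n r) + B r (hi n r))
      volume (a n i) (a n (i + 1)) ∧ ∫ r in (a n i)..(a n (i + 1)), (B r (lo n r) + B r (hi n r))
        = F (a n (i + 1)) - F (a n i) := by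
    intro n i hin
    have m1 := hmem n i hin.le
    have m2 := hmem n (i + 1) hin
    have hle := hmono n i.le_succ
    have hsub : uIcc (a n i) (a n (i + 1)) ⊆ uIcc 0 T := by
      rw [uIcc_of_le hle, uIcc_of_le hT.le]; exact Icc_subset_Icc m1.1 m2.2
    have hcongr : EqOn (fun r => B r (a n i) + B r (a n (i + 1)))
        (fun r => B r (lo n r) + B r (hi n r)) (uIoc (a n i) (a n (i + 1))) := by
      intro r hr
      rw [uIoc_of_le hle] at hr
      simp only [hhi_eq n i r hr, hlo_eq n i r hr]
    refine ⟨(((hint _ m1).add (hint _ m2)).mono_set hsub).congr hcongr, ?_⟩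
    rw [hF _ _ m1.1 hle m2.2]
    refine intervalIntegral.integral_congr_ae (ae_of_all _ fun r hr => (hcongr hr).symm)
  -- The increments telescope, so the approximating integral has the same value for every `n`; only
  -- the integrand moves towards the diagonal.
  have htot : ∀ n, ∫ r in 0..T, (B r (lo n r) + B r (hi n r)) = F T - F 0 := by
    intro n
    have h1 := intervalIntegral.sum_integral_adjacent_intervals
      (fun i hin => (hpiece n i hin).1)
    rw [ha0, han] at h1
    rw [← h1, Finset.sum_congr rfl fun i hi' => (hpiece n i (Finset.mem_range.1 hi')).2,
      Finset.sum_range_sub (fun i => F (a n i)), ha0, han]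
  have hii : ∀ n, IntervalIntegrable (fun r => B r (lo n r) + B r (hi n r)) volume 0 T := by
    intro n
    have := IntervalIntegrable.trans_iterate (fun i hin => (hpiece n i hin).1)
    rwa [ha0, han] at this
  have hmem2 : ∀ n, ∀ r ∈ Ioc 0 T, lo n r ∈ Icc 0 T ∧ hi n r ∈ Icc 0 T ∧
      |hi n r - r| ≤ T / (n + 1) ∧ |lo n r - r| ≤ T / (n + 1) := by
    intro n r hr
    obtain ⟨i, hin, hri⟩ := hcover n r hr
    rw [hhi_eq n i r hri, hlo_eq n i r hri]
    refine ⟨hmem n i hin.le, hmem n (i + 1) hin, ?_, ?_⟩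
    · have := hstep n i
      rw [abs_le]; constructor <;> linarith [hri.1, hri.2]
    · have := hstep n i
      rw [abs_le]; constructor <;> linarith [hri.1, hri.2]
  have hT0 : Tendsto (fun n : ℕ => T / ((n : ℝ) + 1)) atTop (𝓝 0) := by
    have := (tendsto_one_div_add_atTop_nhds_zero_nat (𝕜 := ℝ)).const_mul T
    simpa [div_eq_mul_inv] using this
  have hlim : ∀ᵐ r ∂volume, r ∈ uIoc 0 T →
      Tendsto (fun n => B r (lo n r) + B r (hi n r)) atTop (𝓝 (2 * B r r)) := by
    filter_upwards [(ae_restrict_iff' measurableSet_Ioc).1 hcont] with r hr hrm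
    rw [uIoc_of_le hT.le] at hrm
    have hc := hr hrm r (Ioc_subset_Icc_self hrm)
    have t1 : Tendsto (fun n => lo n r) atTop (𝓝[Icc 0 T] r) :=
      tendsto_nhdsWithin_iff.2 ⟨tendsto_iff_dist_tendsto_zero.2 (squeeze_zero (fun _ => dist_nonneg)
        (fun n => (hmem2 n r hrm).2.2.2) hT0), Eventually.of_forall fun n => (hmem2 n r hrm).1⟩
    have t2 : Tendsto (fun n => hi n r) atTop (𝓝[Icc 0 T] r) :=
      tendsto_nhdsWithin_iff.2 ⟨tendsto_iff_dist_tendsto_zero.2 (squeeze_zero (fun _ => dist_nonneg)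
        (fun n => (hmem2 n r hrm).2.2.1) hT0), Eventually.of_forall fun n => (hmem2 n r hrm).2.1⟩
    rw [two_mul]
    exact (Tendsto.comp hc t1).add (Tendsto.comp hc t2)
  have hmeasn : ∀ n, AEStronglyMeasurable (fun r => B r (lo n r) + B r (hi n r))
      (volume.restrict (uIoc 0 T)) := fun n => by
    rw [uIoc_of_le hT.le]
    exact ((intervalIntegrable_iff_integrableOn_Ioc_of_le hT.le).1 (hii n)).1
  have hdct := intervalIntegral.tendsto_integral_filter_of_dominated_convergence (l := atTop)
    (F := fun n r => B r (lo n r) + B r (hi n r)) (fun r => 2 * m r)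
    (Eventually.of_forall hmeasn)
    (Eventually.of_forall fun n => by
      filter_upwards [(ae_restrict_iff' measurableSet_Ioc).1 hbd] with r hr hrm
      rw [uIoc_of_le hT.le] at hrm
      have h1 := hr hrm _ (hmem2 n r hrm).1
      have h2 := hr hrm _ (hmem2 n r hrm).2.1
      calc ‖B r (lo n r) + B r (hi n r)‖ ≤ |B r (lo n r)| + |B r (hi n r)| := abs_add_le _ _
        _ ≤ _ := by linarith)
    (hm.const_mul 2) hlim
  refine ⟨?_, ?_⟩
  · rw [intervalIntegrable_iff_integrableOn_Ioc_of_le hT.le] at hm ⊢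
    -- Joint measurability of `B` is not assumed. The diagonal is measurable as an almost everywhere
    -- limit of the step approximations.
    have hd : AEStronglyMeasurable (fun r => 2 * B r r) (volume.restrict (Ioc 0 T)) := by
      refine aestronglyMeasurable_of_tendsto_ae atTop (fun n => ?_)
        ((ae_restrict_iff' measurableSet_Ioc).2 (by rwa [uIoc_of_le hT.le] at hlim))
      rw [← uIoc_of_le hT.le]; exact hmeasn n
    have hd' := hd.const_mul (1 / 2 : ℝ)
    refine Integrable.mono' hm (hd'.congr (ae_of_all _ fun r => by ring)) ?_
    filter_upwards [hbd, ae_restrict_mem measurableSet_Ioc] with r hr hrm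
      using hr r (Ioc_subset_Icc_self hrm)
  · rw [← intervalIntegral.integral_const_mul]
    refine tendsto_nhds_unique ?_ hdct
    simp only [htot]
    exact tendsto_const_nhds

end ProductRule

/-! ### Regularization as an operator on `L²`; the convective trilinear form -/

section RegularizationOperator

lemma L2.integrable (u : L2) : Integrable u torusMeasure := (Lp.memLp u).integrable one_le_two

lemma integral_norm_mul_norm_le (a b : L2) :
    Integrable (fun x => ‖a x‖ * ‖b x‖) torusMeasure ∧
    ∫ x, ‖a x‖ * ‖b x‖ ∂torusMeasure ≤ ‖a‖ * ‖b‖ := by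
  have ha := (Lp.memLp a).norm
  have hb := (Lp.memLp b).norm
  refine ⟨ha.integrable_mul hb, ?_⟩
  have h1 := real_inner_le_norm (hb.toLp _) (ha.toLp _)
  rw [Lp.norm_toLp, Lp.norm_toLp, eLpNorm_norm, eLpNorm_norm, ← Lp.norm_def, ← Lp.norm_def,
    L2.inner_def] at h1
  rw [mul_comm ‖a‖]
  refine le_trans (le_of_eq (integral_congr_ae ?_)) h1
  filter_upwards [ha.coeFn_toLp, hb.coeFn_toLp] with x hx hy
  rw [hx, hy]; simp

lemma integral_norm_le (u : L2) : ∫ x, ‖u x‖ ∂torusMeasure ≤ ‖u‖ := by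
  have h1 : MemLp (fun _ : Torus => (EuclideanSpace.single 0 1 : Vec)) 2 torusMeasure :=
    memLp_const _
  have h := (integral_norm_mul_norm_le u (h1.toLp _)).2
  have h2 : ‖h1.toLp _‖ = 1 := by
    rw [Lp.norm_toLp, eLpNorm_const _ (by simp) (IsProbabilityMeasure.ne_zero _)]
    simp
  rw [h2, mul_one] at h
  refine le_trans (le_of_eq (integral_congr_ae ?_)) h
  filter_upwards [h1.coeFn_toLp] with x hx
  rw [hx]; simp

section Conv
variable {k : Vec → ℝ}

/-- Elements of `L2` are classes modulo null sets, while `conv` is evaluated at every point; the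
integral in `h` does not see the representative. -/
lemma conv_congr {F : Type*} [NormedAddCommGroup F] [NormedSpace ℝ F] {u w : Torus → F}
    (h : u =ᵐ[torusMeasure] w) (x : Torus) : conv k u x = conv k w x := by
  refine integral_congr_ae ?_
  filter_upwards [(quasiMeasurePreserving_add_proj x).ae h] with z hz
  rw [hz]

lemma conv_add (hk : Continuous k) (hc : HasCompactSupport k) (u w : L2) (x : Torus) :
    conv k (u + w : L2) x = conv k u x + conv k w x := by
  rw [conv_congr (Lp.coeFn_add u w)]
  simp only [conv, Pi.add_apply, smul_add]
  exact integral_add (integrable_kernel_smul hk hc u.integrable x)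
    (integrable_kernel_smul hk hc w.integrable x)

lemma conv_smul (c : ℝ) (u : L2) (x : Torus) :
    conv k (c • u : L2) x = c • conv k u x := by
  rw [conv_congr (Lp.coeFn_smul c u)]
  simp only [conv, Pi.smul_apply]
  rw [← integral_smul]
  simp_rw [smul_comm c]

lemma exists_norm_conv_le_norm (hk : Continuous k) (hc : HasCompactSupport k) : ∃ C : ℝ, 0 ≤ C ∧
    ∀ (u : L2) x, ‖conv k u x‖ ≤ C * ‖u‖ := by
  obtain ⟨C, hC0, hC⟩ := exists_norm_conv_le (F := Vec) hk hc
  refine ⟨C, hC0, fun u x => ?_⟩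
  calc _ ≤ ∫ h : Vec, ‖k h • u (x + proj h)‖ := norm_integral_le_integral_norm _
    _ ≤ C * ∫ z, ‖u z‖ ∂torusMeasure := hC u u.integrable x
    _ ≤ _ := by gcongr; exact integral_norm_le u

variable (hk : ContDiff ℝ (⊤ : ℕ∞) k) (hc : HasCompactSupport k)

lemma memLp_conv (hk : ContDiff ℝ (⊤ : ℕ∞) k) (hc : HasCompactSupport k) (u : L2) (p : ℝ≥0∞) :
    MemLp (conv k u) p torusMeasure :=
  memLp_of_continuous (smooth_conv hk hc u.integrable).continuous p

/-- Regularization by a kernel, as an operator on `L²`. -/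
def convL (k : Vec → ℝ) (hk : ContDiff ℝ (⊤ : ℕ∞) k) (hc : HasCompactSupport k) : L2 →L[ℝ] L2 :=
  LinearMap.mkContinuous
    { toFun := fun u => (memLp_conv hk hc u 2).toLp _
      map_add' := fun u w => by
        rw [← MemLp.toLp_add]
        congr 1; ext1 x
        exact conv_add hk.continuous hc u w x
      map_smul' := fun c u => by
        rw [RingHom.id_apply, ← MemLp.toLp_const_smul]
        congr 1; ext1 x
        exact conv_smul c u x }
    (exists_norm_conv_le_norm hk.continuous hc).choose
    (fun u => by
      obtain ⟨h0, h1⟩ := (exists_norm_conv_le_norm hk.continuous hc).choose_spec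
      refine (Lp.norm_le_of_ae_bound (p := 2) (μ := torusMeasure)
        (C := (exists_norm_conv_le_norm hk.continuous hc).choose * ‖u‖) (by positivity) ?_).trans ?_
      · filter_upwards [(memLp_conv hk hc u 2).coeFn_toLp] with x hx
        simp only [LinearMap.coe_mk, AddHom.coe_mk]
        rw [hx]; exact h1 u x
      · simp [measureUnivNNReal])

lemma coeFn_convL (u : L2) : convL k hk hc u =ᵐ[torusMeasure] conv k u :=
  (memLp_conv hk hc u 2).coeFn_toLp

lemma pair_conv (w u : L2) : pair w (conv k u) = inner ℝ w (convL k hk hc u) := by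
  rw [L2.inner_def]
  refine integral_congr_ae ?_
  filter_upwards [coeFn_convL hk hc u] with x hx
  rw [hx]

lemma inner_convL (w u : L2) : inner ℝ w (convL k hk hc u) = ∫ h, k h * corr w u h := by
  rw [← pair_conv hk hc]
  exact integral_inner_conv hk.continuous hc (Lp.memLp u) (Lp.memLp w)

/-- Evenness of the kernel makes the regularization self-adjoint, which is what the product rule
requires of the quadratic form. -/
lemma inner_convL_comm (he : ∀ h, k (-h) = k h) (w u : L2) :
    inner ℝ w (convL k hk hc u) = inner ℝ u (convL k hk hc w) := by
  rw [inner_convL, inner_convL, ← integral_neg_eq_self]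
  congr 1; ext h
  rw [he, corr_neg]

end Conv

section Convection

lemma integrable_convection (u : L2) {ψ : Torus → Vec}
    (hψ : ∀ i j, Continuous fun x => pderiv j ψ x i) (i j : Fin 3) :
    Integrable (fun x => u x i * u x j * pderiv j ψ x i) torusMeasure := by
  have h1 : Integrable (fun x => u x i * u x j) torusMeasure :=
    (memLp_coord (Lp.memLp u) i).integrable_mul (memLp_coord (Lp.memLp u) j)
  obtain ⟨M, hM⟩ := (HasCompactSupport.of_compactSpace _).exists_bound_of_continuous (hψ i j)
  exact h1.mul_bdd (hψ i j).aestronglyMeasurable (ae_of_all _ hM)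

/-- Factor `u ⊗ u - w ⊗ w` through `u - w` and apply Cauchy–Schwarz; the constant 9 counts the index
pairs. With `w = 0` this is the growth bound, and in general it yields continuity on `L²`, hence
measurability in time. -/
lemma abs_convection_sub_le (u w : L2) {ψ : Torus → Vec}
    (hψ : ∀ i j, Continuous fun x => pderiv j ψ x i) {M : ℝ} (hM0 : 0 ≤ M)
    (hM : ∀ i j x, |pderiv j ψ x i| ≤ M) :
    |convection u ψ - convection w ψ| ≤ 9 * M * (‖u - w‖ * (‖u‖ + ‖w‖)) := by
  have hi : ∀ u : L2, Integrable (fun x => ∑ i, ∑ j, u x i * u x j * pderiv j ψ x i)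
      torusMeasure := fun u => integrable_finsetSum _ fun i _ => integrable_finsetSum _ fun j _ =>
        integrable_convection u hψ i j
  obtain ⟨i1, l1⟩ := integral_norm_mul_norm_le (u - w) u
  obtain ⟨i2, l2⟩ := integral_norm_mul_norm_le (u - w) w
  unfold convection
  rw [← integral_sub (hi u) (hi w), ← Real.norm_eq_abs]
  calc _ ≤ ∫ x, 9 * M * (‖(u - w) x‖ * ‖u x‖ + ‖(u - w) x‖ * ‖w x‖) ∂torusMeasure := by
        refine norm_integral_le_of_norm_le ((i1.add i2).const_mul _) ?_
        filter_upwards [Lp.coeFn_sub u w] with x hx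
        have hb : ∀ i j, |u x i * u x j - w x i * w x j|
            ≤ ‖(u - w) x‖ * ‖u x‖ + ‖(u - w) x‖ * ‖w x‖ := by
          intro i j
          have e : u x i * u x j - w x i * w x j
              = (u x - w x) i * u x j + (u x - w x) j * w x i := by
            simp; ring
          rw [e, hx]
          refine (abs_add_le _ _).trans ?_
          rw [abs_mul, abs_mul]
          have := fun (z : Vec) i => PiLp.norm_apply_le z i
          simp only [Real.norm_eq_abs] at this
          gcongr <;> apply this
        rw [← Finset.sum_sub_distrib, Real.norm_eq_abs]
        calc _ ≤ ∑ i : Fin 3, ∑ j : Fin 3,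
              (‖(u - w) x‖ * ‖u x‖ + ‖(u - w) x‖ * ‖w x‖) * M := by
              refine (Finset.abs_sum_le_sum_abs _ _).trans (Finset.sum_le_sum fun i _ => ?_)
              rw [← Finset.sum_sub_distrib]
              refine (Finset.abs_sum_le_sum_abs _ _).trans (Finset.sum_le_sum fun j _ => ?_)
              rw [← sub_mul, abs_mul]
              exact mul_le_mul (hb i j) (hM i j x) (abs_nonneg _) (by positivity)
          _ = _ := by simp; ring
    _ ≤ _ := by
        rw [integral_const_mul, integral_add i1 i2, mul_add ‖u - w‖]
        gcongr

lemma convection_zero (ψ : Torus → Vec) : convection 0 ψ = 0 := by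
  unfold convection
  rw [← integral_zero Torus ℝ]
  refine integral_congr_ae ?_
  filter_upwards [Lp.coeFn_zero Vec 2 torusMeasure] with x hx
  simp

lemma abs_convection_le (u : L2) {ψ : Torus → Vec}
    (hψ : ∀ i j, Continuous fun x => pderiv j ψ x i) {M : ℝ} (hM0 : 0 ≤ M)
    (hM : ∀ i j x, |pderiv j ψ x i| ≤ M) : |convection u ψ| ≤ 9 * M * (‖u‖ * ‖u‖) := by
  simpa [convection_zero] using abs_convection_sub_le u 0 hψ hM0 hM

lemma continuous_convection {ψ : Torus → Vec}
    (hψ : ∀ i j, Continuous fun x => pderiv j ψ x i) : Continuous fun u : L2 => convection u ψ := by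
  have : ∃ M : ℝ, 0 ≤ M ∧ ∀ i j x, |pderiv j ψ x i| ≤ M := by
    have h1 := fun i j => (HasCompactSupport.of_compactSpace _).exists_bound_of_continuous (hψ i j)
    choose M hM using h1
    refine ⟨∑ i, ∑ j, |M i j|, by positivity, fun i j x => (hM i j x).trans ?_⟩
    refine (le_abs_self _).trans ?_
    refine (Finset.single_le_sum (f := fun j => |M i j|) (fun j _ => abs_nonneg _)
      (Finset.mem_univ j)).trans ?_
    exact Finset.single_le_sum (f := fun i => ∑ j, |M i j|) (fun j _ => by positivity)
      (Finset.mem_univ i)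
  obtain ⟨M, hM0, hM⟩ := this
  refine continuous_iff_continuousAt.2 fun w => tendsto_iff_dist_tendsto_zero.2 ?_
  refine squeeze_zero (fun _ => dist_nonneg)
    (fun u => abs_convection_sub_le u w hψ hM0 hM) ?_
  have : Continuous fun u : L2 => 9 * M * (‖u - w‖ * (‖u‖ + ‖w‖)) := by fun_prop
  simpa using this.tendsto w

variable {k : Vec → ℝ} (hk : ContDiff ℝ (⊤ : ℕ∞) k) (hc : HasCompactSupport k)
include hk hc

lemma continuous_pderiv_conv (w : L2) (i j : Fin 3) :
    Continuous fun x => pderiv j (conv k w) x i := by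
  simp only [pderiv_conv hk hc w.integrable]
  have := (smooth_conv (contDiff_kderiv hk j) (hasCompactSupport_kderiv hc j)
    w.integrable).continuous
  fun_prop

lemma exists_pderiv_conv_le : ∃ C : ℝ, 0 ≤ C ∧ ∀ (w : L2) i j x,
    |pderiv j (conv k w) x i| ≤ C * ‖w‖ := by
  choose C hC0 hC using fun j => exists_norm_conv_le_norm (contDiff_kderiv hk j).continuous
    (hasCompactSupport_kderiv hc j)
  refine ⟨∑ j, C j, Finset.sum_nonneg fun j _ => hC0 j, fun w i j x => ?_⟩
  rw [pderiv_conv hk hc w.integrable]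
  calc _ ≤ ‖conv (kderiv j k) w x‖ := by
        rw [← norm_neg]; exact PiLp.norm_apply_le (-conv (kderiv j k) w x) i
    _ ≤ C j * ‖w‖ := hC j w x
    _ ≤ _ := by
        gcongr
        exact Finset.single_le_sum (fun j _ => hC0 j) (Finset.mem_univ j)

/-- For fixed `u`, the trilinear term is a bounded functional of the regularized field. -/
lemma exists_clm_convection (u : L2) : ∃ φ : L2 →L[ℝ] ℝ, ∀ w, φ w = convection u (conv k w) := by
  obtain ⟨C, hC0, hC⟩ := exists_pderiv_conv_le hk hc
  have hint := fun w : L2 => integrable_convection u (continuous_pderiv_conv hk hc w)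
  refine ⟨LinearMap.mkContinuous
    { toFun := fun w => convection u (conv k w)
      map_add' := fun a b => ?_
      map_smul' := fun c a => ?_ } (9 * C * (‖u‖ * ‖u‖)) fun w => ?_, fun w => rfl⟩
  · unfold convection
    rw [← integral_add]
    · congr 1; ext x
      simp only [pderiv_conv hk hc (L2.integrable _), conv_add (contDiff_kderiv hk _).continuous
        (hasCompactSupport_kderiv hc _), ← Finset.sum_add_distrib]
      simp [mul_add, add_comm]
    · exact integrable_finsetSum _ fun i _ => integrable_finsetSum _ fun j _ => hint a i j
    · exact integrable_finsetSum _ fun i _ => integrable_finsetSum _ fun j _ => hint b i j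
  · unfold convection
    rw [RingHom.id_apply, ← integral_smul]
    congr 1; ext x
    simp only [pderiv_conv hk hc (L2.integrable _), conv_smul, smul_eq_mul, Finset.mul_sum]
    refine Finset.sum_congr rfl fun i _ => Finset.sum_congr rfl fun j _ => ?_
    simp; ring
  · have := abs_convection_le u (continuous_pderiv_conv hk hc w) (by positivity) (hC w)
    refine this.trans (le_of_eq (by ring))

end Convection

end RegularizationOperator

/-! ### Energy balance of the regularized solution -/

section EnergyBalance

variable {ν : ℝ} {vin : L2} {f v : ℝ → L2}

lemma gradEnergy_nonneg (v : ℝ → L2) (t : ℝ) : 0 ≤ gradEnergy v t := ENNReal.toReal_nonneg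

lemma restrict_Ioc_le_timeMeasure {t : ℝ} (ht : t ≤ 1) :
    volume.restrict (Ioc (0 : ℝ) t) ≤ timeMeasure := by
  rw [show timeMeasure = volume.restrict (Ioc (0 : ℝ) 1) from
    Measure.restrict_congr_set Ioo_ae_eq_Ioc]
  exact Measure.restrict_mono (Ioc_subset_Ioc_right ht) le_rfl

lemma IsLerayHopf.norm_ae_le (h : IsLerayHopf ν vin f v) :
    ∃ M : ℝ, 0 ≤ M ∧ ∀ᵐ r ∂timeMeasure, ‖v r‖ ≤ M := by
  refine ⟨(eLpNorm v ∞ timeMeasure).toReal, ENNReal.toReal_nonneg, ?_⟩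
  have := ae_le_eLpNormEssSup (f := v) (μ := timeMeasure)
  filter_upwards [this] with r hr
  rw [← eLpNorm_exponent_top] at hr
  rw [← toReal_enorm]
  exact ENNReal.toReal_mono h.linfty_L2.2.ne hr

lemma IsLerayHopf.integrable_force (h : IsLerayHopf ν vin f v) : Integrable f timeMeasure :=
  memLp_one_iff_integrable.1 h.force_L1L2

lemma IsLerayHopf.integrable_inner (h : IsLerayHopf ν vin f v) :
    Integrable (fun r => inner ℝ (f r) (v r)) timeMeasure := by
  obtain ⟨M, hM0, hM⟩ := h.norm_ae_le
  refine (h.integrable_force.norm.mul_const M).mono'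
    (h.force_L1L2.1.inner h.linfty_L2.1) ?_
  filter_upwards [hM] with r hr
  exact (norm_inner_le_norm _ _).trans (by gcongr)

lemma intervalIntegrable_of_timeMeasure {E : Type*} [NormedAddCommGroup E] {φ : ℝ → E}
    (hφ : Integrable φ timeMeasure) {s t : ℝ} (hs : s ∈ Icc (0 : ℝ) 1) (ht : t ∈ Icc (0 : ℝ) 1) :
    IntervalIntegrable φ volume s t := by
  have h1 : IntervalIntegrable φ volume 0 1 :=
    (intervalIntegrable_iff_integrableOn_Ioo_of_le zero_le_one).2 hφ
  refine h1.mono_set ?_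
  rw [uIcc_of_le zero_le_one]
  exact uIcc_subset_Icc hs ht

/-- A Leray--Hopf solution is bounded in `L²` at all times. -/
lemma IsLerayHopf.exists_norm_le (h : IsLerayHopf ν vin f v) (hν : 0 < ν) :
    ∃ M : ℝ, 0 ≤ M ∧ ∀ r ∈ Icc (0 : ℝ) 1, ‖v r‖ ≤ M := by
  set I : ℝ := ∫ r, ‖inner ℝ (f r) (v r)‖ ∂timeMeasure
  have hI : 0 ≤ I := integral_nonneg fun _ => norm_nonneg _
  -- The extra `1` avoids a square root, since `‖vin‖ ^ 2 + 2 * I ≤ (‖vin‖ + (1 + 2 * I)) ^ 2`. The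
  -- bound is wanted at every time, not almost every, because test fields are built from `v τ` at
  -- prescribed times.
  refine ⟨‖vin‖ + (1 + 2 * I), by positivity, fun r hr => ?_⟩
  rcases hr.1.eq_or_lt with rfl | h0
  · rw [h.initial]; linarith
  have h1 := h.energy_inequality r ⟨h0, hr.2⟩
  have h2 : ∫ r in (0 : ℝ)..r, inner ℝ (f r) (v r) ≤ I := by
    rw [intervalIntegral.integral_of_le hr.1]
    refine (Real.le_norm_self _).trans ((norm_integral_le_integral_norm _).trans ?_)
    exact integral_mono_measure (restrict_Ioc_le_timeMeasure hr.2)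
      (ae_of_all _ fun _ => norm_nonneg _) h.integrable_inner.norm
  have h3 : 0 ≤ 2 * ν * gradEnergy v r := by have := gradEnergy_nonneg v r; positivity
  refine abs_le_of_sq_le_sq' ?_ (by positivity) |>.2
  nlinarith [norm_nonneg vin]

/-- Riesz representation turns weak continuity into continuity along every bounded functional. -/
lemma IsLerayHopf.continuousOn_clm (h : IsLerayHopf ν vin f v) (φ : L2 →L[ℝ] ℝ) :
    ContinuousOn (fun t => φ (v t)) (Icc 0 1) := by
  have := h.weak_continuous ((InnerProductSpace.toDual ℝ L2).symm φ)
  refine this.congr fun t _ => ?_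
  change _ = inner ℝ (v t) ((InnerProductSpace.toDual ℝ L2).symm φ)
  rw [real_inner_comm]; simp

variable {k : Vec → ℝ}

lemma contDiff_laplacian_kernel (hk : ContDiff ℝ (⊤ : ℕ∞) k) :
    ContDiff ℝ (⊤ : ℕ∞) fun h => ∑ j, kderiv j (kderiv j k) h :=
  ContDiff.sum fun j _ => contDiff_kderiv (contDiff_kderiv hk j) j

lemma hasCompactSupport_laplacian_kernel (hc : HasCompactSupport k) :
    HasCompactSupport fun h => ∑ j, kderiv j (kderiv j k) h := by
  simp only [Fin.sum_univ_three]
  exact ((hasCompactSupport_kderiv (hasCompactSupport_kderiv hc 0) 0).add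
    (hasCompactSupport_kderiv (hasCompactSupport_kderiv hc 1) 1)).add
    (hasCompactSupport_kderiv (hasCompactSupport_kderiv hc 2) 2)

/-- The balance of the energy `⟨v, k * v⟩` of the regularized solution. -/
theorem IsLerayHopf.energy_balance (h : IsLerayHopf ν vin f v) (hν : 0 < ν)
    (hk : ContDiff ℝ (⊤ : ℕ∞) k) (hc : HasCompactSupport k) (he : ∀ h, k (-h) = k h) :
    Integrable (fun r => convection (v r) (conv k (v r))) timeMeasure ∧
    ∀ t ∈ Icc (0 : ℝ) 1,
    inner ℝ (v t) (convL k hk hc (v t)) - inner ℝ (v 0) (convL k hk hc (v 0)) =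
      2 * (ν * (∫ r in 0..t, inner ℝ (v r) (convL _ (contDiff_laplacian_kernel hk)
          (hasCompactSupport_laplacian_kernel hc) (v r)))
        + (∫ r in 0..t, convection (v r) (conv k (v r)))
        + ∫ r in 0..t, inner ℝ (f r) (convL k hk hc (v r))) := by
  obtain ⟨M, hM0, hM⟩ := h.exists_norm_le hν
  set A := convL k hk hc with hA
  set L := convL _ (contDiff_laplacian_kernel hk) (hasCompactSupport_laplacian_kernel hc) with hL
  obtain ⟨C, hC0, hC⟩ := exists_pderiv_conv_le hk hc
  have hcp := fun w : L2 => continuous_pderiv_conv hk hc w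
  -- The rate of change at time `r` tested against the regularized field frozen at time `τ`.
  -- Freezing `τ` keeps the test field independent of time, as the weak formulation demands.
  set B : ℝ → ℝ → ℝ := fun r τ => ν * inner ℝ (v r) (L (v τ)) + convection (v r) (conv k (v τ))
    + inner ℝ (f r) (A (v τ)) with hB
  set m : ℝ → ℝ := fun r => ν * (M * (‖L‖ * M)) + 9 * (C * M) * (M * M) + ‖f r‖ * (‖A‖ * M) with hm
  have hvm := h.linfty_L2.1
  have hfm := h.force_L1L2.1
  have hmi : Integrable m timeMeasure := by
    refine Integrable.add (integrable_const _) (h.integrable_force.norm.mul_const _)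
  have hae : ∀ᵐ r ∂timeMeasure, r ∈ Icc (0 : ℝ) 1 := by
    filter_upwards [ae_restrict_mem measurableSet_Ioo] with r hr using Ioo_subset_Icc_self hr
  have p1 : ∀ r ∈ Icc (0 : ℝ) 1, ∀ τ ∈ Icc (0 : ℝ) 1, ∀ T : L2 →L[ℝ] L2,
      |inner ℝ (v r) (T (v τ))| ≤ M * (‖T‖ * M) := by
    intro r hr τ hτ T
    refine (abs_real_inner_le_norm _ _).trans ?_
    gcongr
    · exact hM r hr
    · exact (T.le_opNorm _).trans (by gcongr; exact hM τ hτ)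
  have p2 : ∀ r ∈ Icc (0 : ℝ) 1, ∀ τ ∈ Icc (0 : ℝ) 1,
      |convection (v r) (conv k (v τ))| ≤ 9 * (C * M) * (M * M) := by
    intro r hr τ hτ
    have := hM r hr
    refine (abs_convection_le (v r) (hcp (v τ)) (by positivity) (hC (v τ))).trans ?_
    gcongr
    exact hM τ hτ
  have p3 : ∀ r, ∀ τ ∈ Icc (0 : ℝ) 1, |inner ℝ (f r) (A (v τ))| ≤ ‖f r‖ * (‖A‖ * M) := by
    intro r τ hτ
    refine (abs_real_inner_le_norm _ _).trans ?_
    gcongr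
    exact (A.le_opNorm _).trans (by gcongr; exact hM τ hτ)
  have hBb : ∀ r ∈ Icc (0 : ℝ) 1, ∀ τ ∈ Icc (0 : ℝ) 1, |B r τ| ≤ m r := by
    intro r hr τ hτ
    simp only [hB, hm]
    refine (abs_add_le _ _).trans (add_le_add ((abs_add_le _ _).trans (add_le_add ?_
      (p2 r hr τ hτ))) (p3 r τ hτ))
    rw [abs_mul, abs_of_pos hν]
    gcongr
    exact p1 r hr τ hτ L
  have mL : ∀ T : L2 →L[ℝ] L2, ∀ w : L2,
      AEStronglyMeasurable (fun r => inner ℝ (v r) (T w)) timeMeasure := fun T w =>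
    hvm.inner aestronglyMeasurable_const
  have mC : ∀ w : L2, AEStronglyMeasurable (fun r => convection (v r) (conv k w)) timeMeasure :=
    fun w => (continuous_convection (hcp w)).comp_aestronglyMeasurable hvm
  have mF : ∀ w : L2, AEStronglyMeasurable (fun r => inner ℝ (f r) (A w)) timeMeasure := fun w =>
    hfm.inner aestronglyMeasurable_const
  have hBm : ∀ τ, AEStronglyMeasurable (fun r => B r τ) timeMeasure := fun τ =>
    (((mL L _).const_mul ν).add (mC _)).add (mF _)
  -- For fixed `r` every term is a bounded linear functional of `v τ`, so weak continuity in `τ`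
  -- suffices.
  have hBc : ∀ r, ContinuousOn (B r) (Icc 0 1) := by
    intro r
    obtain ⟨φ, hφ⟩ := exists_clm_convection hk hc (v r)
    have c1 := h.continuousOn_clm ((innerSL ℝ (v r)).comp L)
    have c2 := h.continuousOn_clm φ
    have c3 := h.continuousOn_clm ((innerSL ℝ (f r)).comp A)
    simp only [hφ] at c2
    exact ((continuousOn_const.mul c1).add c2).add c3
  have hBint : ∀ τ ∈ Icc (0 : ℝ) 1, Integrable (fun r => B r τ) timeMeasure := fun τ hτ =>
    hmi.mono' (hBm τ) (by filter_upwards [hae] with r hr using hBb r hr τ hτ)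
  have hinc : ∀ s ∈ Icc (0 : ℝ) 1, ∀ t ∈ Icc (0 : ℝ) 1, ∀ τ ∈ Icc (0 : ℝ) 1,
      inner ℝ (v t) (A (v τ)) - inner ℝ (v s) (A (v τ)) = ∫ r in s..t, B r τ := by
    have h0 : ∀ t ∈ Icc (0 : ℝ) 1, ∀ τ ∈ Icc (0 : ℝ) 1,
        inner ℝ (v t) (A (v τ)) - inner ℝ (v 0) (A (v τ)) = ∫ r in 0..t, B r τ := by
      intro t ht τ hτ
      have := h.weak_form t ht _ (solenoidalTest_conv hk hc (h.divFree τ hτ))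
      have hl : lap (conv k (v τ)) = conv (fun h => ∑ j, kderiv j (kderiv j k) h) (v τ) :=
        funext fun x => lap_conv hk hc (v τ).integrable x
      simp only [hl, pair_conv hk hc, pair_conv (contDiff_laplacian_kernel hk)
        (hasCompactSupport_laplacian_kernel hc)] at this
      rw [← hA, ← hL] at this
      rw [this]
      have z0 : (0 : ℝ) ∈ Icc (0 : ℝ) 1 := by simp
      have i1 : Integrable (fun r => inner ℝ (v r) (L (v τ))) timeMeasure :=
        (integrable_const (M * (‖L‖ * M))).mono' (mL L _)
          (by filter_upwards [hae] with r hr using p1 r hr τ hτ L)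
      have i2 : Integrable (fun r => convection (v r) (conv k (v τ))) timeMeasure :=
        (integrable_const _).mono' (mC _) (by filter_upwards [hae] with r hr using p2 r hr τ hτ)
      have i3 : Integrable (fun r => inner ℝ (f r) (A (v τ))) timeMeasure :=
        (h.integrable_force.norm.mul_const _).mono' (mF _) (ae_of_all _ fun r => p3 r τ hτ)
      have j1 := intervalIntegrable_of_timeMeasure i1 z0 ht
      have j2 := intervalIntegrable_of_timeMeasure i2 z0 ht
      have j3 := intervalIntegrable_of_timeMeasure i3 z0 ht
      rw [intervalIntegral.integral_add ((j1.const_mul ν).add j2) j3,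
        intervalIntegral.integral_add (j1.const_mul ν) j2, intervalIntegral.integral_const_mul]
    intro s hs t ht τ hτ
    have z0 : (0 : ℝ) ∈ Icc (0 : ℝ) 1 := by simp
    rw [← intervalIntegral.integral_interval_sub_left
      (intervalIntegrable_of_timeMeasure (hBint τ hτ) z0 ht)
      (intervalIntegrable_of_timeMeasure (hBint τ hτ) z0 hs), ← h0 t ht τ hτ, ← h0 s hs τ hτ]
    ring
  have main : ∀ t ∈ Icc (0 : ℝ) 1, IntervalIntegrable (fun r => B r r) volume 0 t ∧
      inner ℝ (v t) (A (v t)) - inner ℝ (v 0) (A (v 0)) = 2 * ∫ r in 0..t, B r r := by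
    intro t ht
    have hle := restrict_Ioc_le_timeMeasure ht.2
    have hsub : Icc 0 t ⊆ Icc (0 : ℝ) 1 := Icc_subset_Icc_right ht.2
    refine sub_eq_two_mul_integral_diag (F := fun t => inner ℝ (v t) (A (v t))) (m := m) ht.1
      (intervalIntegrable_of_timeMeasure hmi (by simp) ht) (fun τ _ => (hBm τ).mono_measure hle)
      ?_ (ae_of_all _ fun r => (hBc r).mono hsub) ?_
    · filter_upwards [ae_mono hle hae] with r hr τ hτ using hBb r hr τ (hsub hτ)
    · intro s t' hs hst ht'
      have ms : s ∈ Icc (0 : ℝ) 1 := ⟨hs, hst.trans (ht'.trans ht.2)⟩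
      have mt : t' ∈ Icc (0 : ℝ) 1 := ⟨hs.trans hst, ht'.trans ht.2⟩
      rw [intervalIntegral.integral_add (intervalIntegrable_of_timeMeasure (hBint s ms) ms mt)
        (intervalIntegrable_of_timeMeasure (hBint t' mt) ms mt), ← hinc s ms t' mt s ms,
        ← hinc s ms t' mt t' mt]
      -- The mixed terms `⟨v t', A (v s)⟩` and `⟨v s, A (v t')⟩` cancel by symmetry, leaving the
      -- increment of the quadratic form.
      have := inner_convL_comm hk hc he (v t') (v s)
      rw [← hA] at this
      rw [this]; ring
  have one : (1 : ℝ) ∈ Icc (0 : ℝ) 1 := by simp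
  have zero : (0 : ℝ) ∈ Icc (0 : ℝ) 1 := by simp
  have i0 : Integrable (fun r => B r r) timeMeasure :=
    (intervalIntegrable_iff_integrableOn_Ioo_of_le zero_le_one).1 (main 1 one).1
  have i1 : Integrable (fun r => inner ℝ (v r) (L (v r))) timeMeasure :=
    (integrable_const (M * (‖L‖ * M))).mono'
      (hvm.inner (L.continuous.comp_aestronglyMeasurable hvm))
      (by filter_upwards [hae] with r hr using p1 r hr r hr L)
  have i3 : Integrable (fun r => inner ℝ (f r) (A (v r))) timeMeasure :=
    (h.integrable_force.norm.mul_const _).mono'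
      (hfm.inner (A.continuous.comp_aestronglyMeasurable hvm))
      (by filter_upwards [hae] with r hr using p3 r r hr)
  -- Obtained by subtraction: the product rule already gives integrability of the whole diagonal,
  -- and the two linear terms are integrable directly.
  have i2 : Integrable (fun r => convection (v r) (conv k (v r))) timeMeasure := by
    refine ((i0.sub (i1.const_mul ν)).sub i3).congr (ae_of_all _ fun r => ?_)
    simp only [hB, Pi.sub_apply]; ring
  refine ⟨i2, fun t ht => ?_⟩
  rw [(main t ht).2]
  have j1 := intervalIntegrable_of_timeMeasure i1 zero ht
  have j2 := intervalIntegrable_of_timeMeasure i2 zero ht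
  have j3 := intervalIntegrable_of_timeMeasure i3 zero ht
  simp only [hB]
  rw [intervalIntegral.integral_add ((j1.const_mul ν).add j2) j3,
    intervalIntegral.integral_add (j1.const_mul ν) j2, intervalIntegral.integral_const_mul]

end EnergyBalance

/-! ### Kármán–Howarth–Monin identities for the energy flux -/

section Flux

section Trilinear

/-- The measure of the space of pairs `(x, h)` of a point and a separation. -/
abbrev pairMeasure : Measure (Torus × Vec) := torusMeasure.prod volume

lemma integral_exchange {φ : Torus × Vec → ℝ} (hφ : AEStronglyMeasurable φ pairMeasure) :
    ∫ p, φ (p.1 + proj p.2, -p.2) ∂pairMeasure = ∫ p, φ p ∂pairMeasure := by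
  have h := measurePreserving_exchange
  have := integral_map h.measurable.aemeasurable (f := φ) (by rw [h.map_eq]; exact hφ)
  rw [h.map_eq] at this
  exact this.symm

variable {D : Vec → Vec → Vec → Vec → ℝ} {κ : Vec → ℝ}

/-- The product of three norms is at most the cube of their maximum, hence at most the sum of the
cubes. So `L³` fields and an integrable weight `κ` are enough, wherever the three slots are
evaluated. -/
lemma integrable_trilinear (hD : Continuous fun z : Vec × Vec × Vec × Vec => D z.1 z.2.1 z.2.2.1 z.2.2.2)
    (hb : ∀ h p q w, |D h p q w| ≤ κ h * (‖p‖ * ‖q‖ * ‖w‖)) (hκ0 : ∀ h, 0 ≤ κ h)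
    {a b c : Torus × Vec → Vec}
    (ham : AEStronglyMeasurable a pairMeasure) (hbm : AEStronglyMeasurable b pairMeasure)
    (hcm : AEStronglyMeasurable c pairMeasure)
    (ha : Integrable (fun p => κ p.2 * ‖a p‖ ^ 3) pairMeasure)
    (hb' : Integrable (fun p => κ p.2 * ‖b p‖ ^ 3) pairMeasure)
    (hc : Integrable (fun p => κ p.2 * ‖c p‖ ^ 3) pairMeasure) :
    Integrable (fun p => D p.2 (a p) (b p) (c p)) pairMeasure := by
  refine ((ha.add hb').add hc).mono' (hD.comp_aestronglyMeasurable
    (continuous_snd.aestronglyMeasurable.prodMk (ham.prodMk (hbm.prodMk hcm)))) ?_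
  filter_upwards with p
  refine (hb _ _ _ _).trans ?_
  simp only [Pi.add_apply, ← mul_add]
  refine mul_le_mul_of_nonneg_left ?_ (hκ0 _)
  have hx := norm_nonneg (a p)
  have hy := norm_nonneg (b p)
  have hz := norm_nonneg (c p)
  generalize ‖a p‖ = x at *
  generalize ‖b p‖ = y at *
  generalize ‖c p‖ = z at *
  have h1 : x * y * z ≤ (max x (max y z)) ^ 3 := by
    rw [pow_three, ← mul_assoc]
    have e1 : x ≤ max x (max y z) := le_max_left _ _
    have e2 : y ≤ max x (max y z) := (le_max_left _ _).trans (le_max_right _ _)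
    have e3 : z ≤ max x (max y z) := (le_max_right _ _).trans (le_max_right _ _)
    gcongr
  have h2 : (max x (max y z)) ^ 3 ≤ x ^ 3 + y ^ 3 + z ^ 3 := by
    have := pow_nonneg hx 3
    have := pow_nonneg hy 3
    have := pow_nonneg hz 3
    rcases max_choice x (max y z) with e | e <;> rw [e]
    · linarith
    · rcases max_choice y z with e | e <;> rw [e] <;> linarith
  exact h1.trans h2

/-- The polarization identity behind the Kármán--Howarth relation. -/
theorem integral_trilinear_increment {u : Torus → Vec} (hu : MemLp u 3 torusMeasure)
    (hD : Continuous fun z : Vec × Vec × Vec × Vec => D z.1 z.2.1 z.2.2.1 z.2.2.2)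
    (hb : ∀ h p q w, |D h p q w| ≤ κ h * (‖p‖ * ‖q‖ * ‖w‖)) (hκ0 : ∀ h, 0 ≤ κ h)
    (hκ : Integrable κ)
    (hodd : ∀ h p q w, D (-h) p q w = -D h p q w) (hsymm : ∀ h p q w, D h p q w = D h w q p)
    (hs1 : ∀ h p p' q w, D h (p - p') q w = D h p q w - D h p' q w)
    (hs2 : ∀ h p q q' w, D h p (q - q') w = D h p q w - D h p q' w)
    (hdiv : ∀ x, ∫ h, D h (u x) (u (x + proj h)) (u x) = 0) :
    ∫ p : Torus × Vec, D p.2 (u (p.1 + proj p.2) - u p.1) (u (p.1 + proj p.2) - u p.1)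
      (u (p.1 + proj p.2) - u p.1) ∂pairMeasure
    = 4 * ∫ x, (∫ h, D h (u x) (u x) (u (x + proj h))) ∂torusMeasure := by
  have hs3 : ∀ h p q w w', D h p q (w - w') = D h p q w - D h p q w' := fun h p q w w' => by
    rw [hsymm, hs1, hsymm h w, hsymm h w']
  have hu3 : Integrable (fun x => ‖u x‖ ^ 3) torusMeasure := by
    simpa using hu.integrable_norm_pow (by norm_num)
  have mU : AEStronglyMeasurable (fun p : Torus × Vec => u p.1) pairMeasure :=
    aestronglyMeasurable_left hu.1
  have mV : AEStronglyMeasurable (fun p : Torus × Vec => u (p.1 + proj p.2)) pairMeasure :=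
    aestronglyMeasurable_right hu.1
  have iU := integrable_kernel_left hκ hu3
  have iV := integrable_kernel_right hκ hu3
  have hI := fun {a b c : Torus × Vec → Vec} ham hbm hcm ha hb' hc =>
    integrable_trilinear (a := a) (b := b) (c := c) hD hb hκ0 ham hbm hcm ha hb' hc
  have iVUV := hI mV mU mV iV iU iV
  have iVUU := hI mV mU mU iV iU iU
  have iUUV := hI mU mU mV iU iU iV
  have iUUU := hI mU mU mU iU iU iU
  have iUVU := hI mU mV mU iU iV iU
  have iVVV := hI mV mV mV iV iV iV
  have iVVU := hI mV mV mU iV iV iU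
  have iUVV := hI mU mV mV iU iV iV
  have eV : ∀ (x : Torus) (h : Vec), x + proj h + proj (-h) = x := by
    intro x h; rw [add_assoc, ← proj_add]; simp
  -- Write `U = u(x)`, `V = u(x + h)`. Of the terms in the expansion, `UVU` vanishes by
  -- incompressibility, `VUV` is its image under the exchange of points, and `UUU` vanishes because
  -- `D` is odd in `h`.
  have z1 : ∫ p : Torus × Vec, D p.2 (u p.1) (u (p.1 + proj p.2)) (u p.1) ∂pairMeasure = 0 := by
    rw [integral_prod _ iUVU]; simp [hdiv]
  have z2 : ∫ p : Torus × Vec, D p.2 (u (p.1 + proj p.2)) (u p.1) (u (p.1 + proj p.2))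
      ∂pairMeasure = 0 := by
    have := integral_exchange iUVU.1
    simp only [eV, hodd, integral_neg] at this
    rw [z1] at this
    linarith
  have z3 : ∫ p : Torus × Vec, D p.2 (u p.1) (u p.1) (u p.1) ∂pairMeasure = 0 := by
    rw [integral_prod _ iUUU]
    have : ∀ x, ∫ h, D h (u x) (u x) (u x) = 0 := by
      intro x
      have := integral_neg_eq_self (fun h => D h (u x) (u x) (u x)) volume
      simp only [hodd, integral_neg] at this
      linarith
    simp [this]
  have iA : Integrable (fun p : Torus × Vec => D p.2 (u (p.1 + proj p.2) - u p.1) (u p.1)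
      (u (p.1 + proj p.2) - u p.1)) pairMeasure := by
    simp only [hs1, hs3]
    exact (iVUV.sub iVUU).sub (iUUV.sub iUUU)
  have iB : Integrable (fun p : Torus × Vec => D p.2 (u (p.1 + proj p.2) - u p.1)
      (u (p.1 + proj p.2)) (u (p.1 + proj p.2) - u p.1)) pairMeasure := by
    simp only [hs1, hs3]
    exact (iVVV.sub iVVU).sub (iUVV.sub iUVU)
  -- Exchanging the points sends `V - U` to its negative, twice, and `D` to its negative, once.
  -- Therefore only the form with `U` in the middle slot has to be expanded.
  have eAB : ∫ p : Torus × Vec, D p.2 (u (p.1 + proj p.2) - u p.1) (u (p.1 + proj p.2))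
      (u (p.1 + proj p.2) - u p.1) ∂pairMeasure = -∫ p : Torus × Vec,
        D p.2 (u (p.1 + proj p.2) - u p.1) (u p.1) (u (p.1 + proj p.2) - u p.1) ∂pairMeasure := by
    have := integral_exchange iA.1
    rw [← this, ← integral_neg]
    congr 1; ext p
    simp only [eV, hodd, hs1, hs3]
    ring
  have eA : ∫ p : Torus × Vec, D p.2 (u (p.1 + proj p.2) - u p.1) (u p.1)
      (u (p.1 + proj p.2) - u p.1) ∂pairMeasure
      = -(2 * ∫ p : Torus × Vec, D p.2 (u p.1) (u p.1) (u (p.1 + proj p.2)) ∂pairMeasure) := by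
    simp only [hs1, hs3]
    rw [integral_sub (by exact iVUV.sub iVUU) (by exact iUUV.sub iUUU), integral_sub iVUV iVUU,
      integral_sub iUUV iUUU, z2, z3]
    simp only [hsymm _ (u (_ + _)) _ _]
    ring
  calc _ = ∫ p : Torus × Vec, (D p.2 (u (p.1 + proj p.2) - u p.1) (u (p.1 + proj p.2))
        (u (p.1 + proj p.2) - u p.1) - D p.2 (u (p.1 + proj p.2) - u p.1) (u p.1)
        (u (p.1 + proj p.2) - u p.1)) ∂pairMeasure := by simp only [hs2]
    _ = 4 * ∫ p : Torus × Vec, D p.2 (u p.1) (u p.1) (u (p.1 + proj p.2)) ∂pairMeasure := by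
        rw [integral_sub iB iA, eAB, eA]; ring
    _ = _ := by rw [integral_prod _ iUUV]

end Trilinear

section Radial

/-- The radial kernel `h ↦ a(|h|²)`. -/
def radial (a : ℝ → ℝ) (h : Vec) : ℝ := a (‖h‖ ^ 2)

variable {a : ℝ → ℝ} {R : ℝ}

lemma radial_neg (a : ℝ → ℝ) (h : Vec) : radial a (-h) = radial a h := by simp [radial]

lemma deriv_eq_zero_of_gt (h0 : ∀ s, R < s → a s = 0) (s : ℝ) (hs : R < s) : deriv a s = 0 := by
  have : a =ᶠ[𝓝 s] fun _ => 0 := by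
    filter_upwards [lt_mem_nhds hs] with z hz using h0 z hz
  rw [this.deriv_eq]; simp

lemma contDiff_deriv (ha : ContDiff ℝ (⊤ : ℕ∞) a) : ContDiff ℝ (⊤ : ℕ∞) (deriv a) :=
  (contDiff_infty_iff_deriv.1 ha).2

lemma contDiff_radial (ha : ContDiff ℝ (⊤ : ℕ∞) a) : ContDiff ℝ (⊤ : ℕ∞) (radial a) :=
  ha.comp (contDiff_norm_sq ℝ)

lemma hasCompactSupport_radial_mul (h0 : ∀ s, R < s → a s = 0) (φ : Vec → ℝ) :
    HasCompactSupport fun h => radial a h * φ h := by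
  refine HasCompactSupport.intro (isCompact_closedBall (0 : Vec) (R + 1)) fun h hh => ?_
  have h1 : R + 1 < ‖h‖ := by simpa using hh
  have h2 : R < ‖h‖ ^ 2 := by nlinarith [sq_nonneg (‖h‖ - 1), norm_nonneg h]
  simp [radial, h0 _ h2]

lemma hasCompactSupport_radial (h0 : ∀ s, R < s → a s = 0) : HasCompactSupport (radial a) := by
  simpa using hasCompactSupport_radial_mul h0 (fun _ => 1)

lemma hasFDerivAt_radial (ha : Differentiable ℝ a) (h : Vec) :
    HasFDerivAt (radial a) ((2 * deriv a (‖h‖ ^ 2)) • innerSL ℝ h) h := by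
  have h1 := (ha (‖h‖ ^ 2)).hasDerivAt.comp_hasFDerivAt h (hasStrictFDerivAt_norm_sq h).hasFDerivAt
  refine h1.congr_fderiv ?_
  ext w; simp; ring

lemma fderiv_radial (ha : Differentiable ℝ a) (h w : Vec) :
    fderiv ℝ (radial a) h w = 2 * deriv a (‖h‖ ^ 2) * inner ℝ h w := by
  rw [(hasFDerivAt_radial ha h).fderiv]; simp

end Radial

section Flux
variable {a : ℝ → ℝ} {R : ℝ} {u : L2}

/-- The third order increment `∫ |δ_h u|² δ_h u · h dx`. -/
def incrZero (u : L2) (h : Vec) : ℝ :=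
  ∫ x, ‖increment u h x‖ ^ 2 * inner ℝ (increment u h x) h ∂torusMeasure

/-- The third order increment `∫ (δ_h u · h)³ dx`. -/
def incrPar (u : L2) (h : Vec) : ℝ := ∫ x, inner ℝ (increment u h x) h ^ 3 ∂torusMeasure

lemma aestronglyMeasurable_increment (u : L2) :
    AEStronglyMeasurable (fun p : Torus × Vec => increment u p.2 p.1) pairMeasure :=
  (aestronglyMeasurable_right (Lp.aestronglyMeasurable u)).sub
    (aestronglyMeasurable_left (Lp.aestronglyMeasurable u))

lemma integrable_norm_cube {u : Torus → Vec} (hu : MemLp u 3 torusMeasure) :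
    Integrable (fun x => ‖u x‖ ^ 3) torusMeasure := by
  simpa using hu.integrable_norm_pow (by norm_num)

lemma norm_increment_cube_le (u : L2) (h : Vec) (x : Torus) :
    ‖increment u h x‖ ^ 3 ≤ 4 * (‖u x‖ ^ 3 + ‖u (x + proj h)‖ ^ 3) := by
  have h1 : ‖increment u h x‖ ≤ ‖u (x + proj h)‖ + ‖u x‖ := norm_sub_le _ _
  have h2 : ‖increment u h x‖ ^ 3 ≤ (‖u (x + proj h)‖ + ‖u x‖) ^ 3 := by gcongr
  refine h2.trans ?_
  have hx := norm_nonneg (u x)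
  have hy := norm_nonneg (u (x + proj h))
  generalize ‖u x‖ = s at *
  generalize ‖u (x + proj h)‖ = t at *
  nlinarith [mul_nonneg (add_nonneg hx hy) (sq_nonneg (s - t))]

lemma integrable_cube_increment (hu : MemLp u 3 torusMeasure) {κ : Vec → ℝ} (hκ : Integrable κ) :
    Integrable (fun p : Torus × Vec => κ p.2 * ‖increment u p.2 p.1‖ ^ 3) pairMeasure := by
  have h3 := integrable_norm_cube hu
  refine (((integrable_kernel_left hκ.norm h3).add (integrable_kernel_right hκ.norm h3)).const_mul
    4).mono' ((aestronglyMeasurable_kernel hκ.1).mul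
      ((aestronglyMeasurable_increment u).norm.pow 3)) ?_
  filter_upwards with p
  have := norm_increment_cube_le u p.2 p.1
  rw [norm_mul, Real.norm_of_nonneg (by positivity : 0 ≤ ‖increment u p.2 p.1‖ ^ 3)]
  calc _ ≤ ‖κ p.2‖ * (4 * (‖u p.1‖ ^ 3 + ‖u (p.1 + proj p.2)‖ ^ 3)) := by gcongr
    _ = _ := by simp only [Pi.add_apply]; ring

lemma convection_conv {k : Vec → ℝ} (hk : ContDiff ℝ (⊤ : ℕ∞) k) (hc : HasCompactSupport k)
    (u w : L2) : convection u (conv k w)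
      = -∫ x, (∫ h, fderiv ℝ k h (u x) * inner ℝ (u x) (w (x + proj h))) ∂torusMeasure := by
  unfold convection
  rw [← integral_neg]
  congr 1; ext x
  have hi := fun j => integrable_kernel_smul (contDiff_kderiv hk j).continuous
    (hasCompactSupport_kderiv hc j) w.integrable x
  have h1 : ∀ i j, conv (kderiv j k) w x i = ∫ h, kderiv j k h * w (x + proj h) i := by
    intro i j
    have := (EuclideanSpace.proj (𝕜 := ℝ) i).integral_comp_comm (hi j)
    simpa [conv] using this.symm
  have hi2 : ∀ i j, Integrable (fun h => kderiv j k h * w (x + proj h) i) := fun i j => by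
    simpa using (EuclideanSpace.proj (𝕜 := ℝ) i).integrable_comp (hi j)
  simp only [pderiv_conv hk hc w.integrable, PiLp.neg_apply, h1, ← integral_const_mul,
    mul_neg, Finset.sum_neg_distrib]
  rw [Finset.sum_congr rfl fun i _ => (integral_finsetSum _ fun j _ =>
    (hi2 i j).const_mul (u x i * u x j)).symm, ← integral_finsetSum _ fun i _ =>
      integrable_finsetSum _ fun j _ => (hi2 i j).const_mul (u x i * u x j)]
  congr 2; ext h
  rw [fderiv_eq_sum_kderiv, PiLp.inner_apply, Finset.sum_mul_sum, Finset.sum_comm]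
  refine Finset.sum_congr rfl fun i _ => Finset.sum_congr rfl fun j _ => ?_
  simp; ring

lemma integrable_fderiv_kernel {k : Vec → ℝ} (hk : ContDiff ℝ (⊤ : ℕ∞) k)
    (hc : HasCompactSupport k) (u : L2) (x : Torus) :
    Integrable fun h => fderiv ℝ k h (u (x + proj h)) := by
  simp only [fderiv_eq_sum_kderiv]
  refine integrable_finsetSum _ fun j _ => ?_
  exact integrable_kernel_smul (contDiff_kderiv hk j).continuous
    (hasCompactSupport_kderiv hc j) ((memLp_coord (Lp.memLp u) j).integrable one_le_two) x

variable (ha : ContDiff ℝ (⊤ : ℕ∞) a) (h0 : ∀ s, R < s → a s = 0)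
  (hu3 : MemLp u 3 torusMeasure) (hdiv : WeaklyDivFree u)
include ha h0 hu3 hdiv

/-- The flux through the scales of a radial kernel, in terms of `|δu|² δu`. -/
theorem convection_radial_eq_incrZero :
    convection u (conv (radial a) u)
      = -(1 / 2) * ∫ h, radial (deriv a) h * incrZero u h := by
  have ha' := contDiff_deriv ha
  have h0' := deriv_eq_zero_of_gt h0
  have hd := ha.differentiable (by simp)
  have hc' := (contDiff_radial ha').continuous
  set κ : Vec → ℝ := fun h => 2 * |radial (deriv a) h * ‖h‖| with hκ
  have hκi : Integrable κ := by
    refine (Integrable.abs (Continuous.integrable_of_hasCompactSupport ?_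
      (hasCompactSupport_radial_mul h0' _))).const_mul 2
    fun_prop
  -- With this form the middle slot meets the gradient of the kernel, so the incompressibility
  -- hypothesis is the vanishing of a gradient correlation, times `|u(x)|²`. The `UUV` term is the
  -- integrand of the convective flux up to sign.
  have key := integral_trilinear_increment (D := fun h p q w =>
      2 * radial (deriv a) h * inner ℝ h q * inner ℝ p w) (κ := κ) hu3
    (by fun_prop) ?_ (fun h => by positivity) hκi ?_ ?_ ?_ ?_ ?_
  · rw [convection_conv (contDiff_radial ha) (hasCompactSupport_radial h0)]
    simp only [fderiv_radial hd]
    have e1 : ∫ h, radial (deriv a) h * incrZero u h = ∫ p : Torus × Vec, radial (deriv a) p.2 *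
        (‖increment u p.2 p.1‖ ^ 2 * inner ℝ (increment u p.2 p.1) p.2) ∂pairMeasure := by
      rw [integral_prod_symm]
      · simp [incrZero, integral_const_mul]
      · have hκ2 : Integrable (fun h => |radial (deriv a) h * ‖h‖|) := by
          simpa [hκ] using hκi.const_mul (1 / 2)
        refine (integrable_cube_increment hu3 hκ2).mono'
          ((aestronglyMeasurable_kernel hc'.aestronglyMeasurable).mul
          (((aestronglyMeasurable_increment u).norm.pow 2).mul
            ((aestronglyMeasurable_increment u).inner
              continuous_snd.aestronglyMeasurable))) ?_
        filter_upwards with p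
        rw [norm_mul, norm_mul, abs_mul, abs_norm, Real.norm_of_nonneg (sq_nonneg _),
          Real.norm_eq_abs, mul_assoc]
        refine mul_le_mul_of_nonneg_left ?_ (abs_nonneg _)
        calc _ ≤ ‖increment u p.2 p.1‖ ^ 2 * (‖increment u p.2 p.1‖ * ‖p.2‖) := by
              gcongr; exact norm_inner_le_norm _ _
          _ = _ := by ring
    have e2 : ∫ p : Torus × Vec, radial (deriv a) p.2 *
        (‖increment u p.2 p.1‖ ^ 2 * inner ℝ (increment u p.2 p.1) p.2) ∂pairMeasure
        = (1 / 2) * ∫ p : Torus × Vec, 2 * radial (deriv a) p.2 *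
          inner ℝ p.2 (u (p.1 + proj p.2) - u p.1) *
          inner ℝ (u (p.1 + proj p.2) - u p.1) (u (p.1 + proj p.2) - u p.1) ∂pairMeasure := by
      rw [← integral_const_mul]
      congr 1; ext p
      rw [real_inner_self_eq_norm_sq, real_inner_comm p.2]
      simp only [increment]; ring
    rw [e1, e2, key]
    simp only [radial]
    ring
  · intro h p q w
    simp only [hκ, abs_mul, abs_norm]
    calc _ ≤ |2| * |radial (deriv a) h| * (‖h‖ * ‖q‖) * (‖p‖ * ‖w‖) := by
          gcongr <;> exact abs_real_inner_le_norm _ _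
      _ = _ := by simp; ring
  · intro h p q w; simp [radial_neg]
  · intro h p q w; rw [real_inner_comm p w]
  · intro h p p' q w; rw [inner_sub_left]; ring
  · intro h p q q' w; rw [inner_sub_right]; ring
  · intro x
    have := integral_fderiv_kernel_eq_zero (contDiff_radial ha) (hasCompactSupport_radial h0)
      hdiv x
    simp only [fderiv_radial hd] at this
    simp only [radial]
    rw [integral_mul_const, this, zero_mul]

/-- The flux through the scales of a radial kernel, in terms of longitudinal increments. -/
theorem convection_radial_eq_incrPar :
    convection u (conv (radial a) u)
      = 1 / 3 * ∫ h, radial (deriv (deriv a)) h * incrPar u h := by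
  have ha' := contDiff_deriv ha
  have h0' := deriv_eq_zero_of_gt h0
  have ha'' := contDiff_deriv ha'
  have h0'' := deriv_eq_zero_of_gt h0'
  have hd := ha.differentiable (by simp)
  have hd' := ha'.differentiable (by simp)
  have hc' := (contDiff_radial ha').continuous
  have hc'' := (contDiff_radial ha'').continuous
  set κ' : Vec → ℝ := fun h => |radial (deriv (deriv a)) h * ‖h‖ ^ 3| with hκ'
  set κ : Vec → ℝ := fun h => 4 * |radial (deriv a) h * ‖h‖| + 2 * κ' h with hκ
  have hκi' : Integrable κ' := by
    refine (Integrable.abs (Continuous.integrable_of_hasCompactSupport ?_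
      (hasCompactSupport_radial_mul h0'' _)))
    fun_prop
  have hκi : Integrable κ := by
    refine ((Integrable.abs (Continuous.integrable_of_hasCompactSupport ?_
      (hasCompactSupport_radial_mul h0' _))).const_mul 4).add (hκi'.const_mul 2)
    fun_prop
  -- The form of the previous theorem corrected so that on the diagonal `p = q = w` all `a'` terms
  -- cancel and only `-2 a'' (h · p)³` survives, while the result stays symmetric in the outer slots
  -- and compatible with incompressibility.
  set D : Vec → Vec → Vec → Vec → ℝ := fun h p q w =>
    2 * radial (deriv a) h * inner ℝ h q * inner ℝ p w
      - 2 * radial (deriv (deriv a)) h * inner ℝ h p * inner ℝ h q * inner ℝ h w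
      - radial (deriv a) h * (inner ℝ p q * inner ℝ h w + inner ℝ h p * inner ℝ q w) with hD
  have hquad : ∀ c p q : Vec, HasFDerivAt (fun h : Vec => radial (deriv a) h *
      (inner ℝ h p * inner ℝ h q)) (radial (deriv a) c • (inner ℝ c p • innerSL ℝ q
        + inner ℝ c q • innerSL ℝ p) + (inner ℝ c p * inner ℝ c q) •
          ((2 * deriv (deriv a) (‖c‖ ^ 2)) • innerSL ℝ c)) c := by
    intro c p q
    have e1 : HasFDerivAt (fun h : Vec => inner ℝ h p) (innerSL ℝ p) c := by
      simp_rw [fun h : Vec => real_inner_comm p h]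
      exact (innerSL ℝ p).hasFDerivAt
    have e2 : HasFDerivAt (fun h : Vec => inner ℝ h q) (innerSL ℝ q) c := by
      simp_rw [fun h : Vec => real_inner_comm q h]
      exact (innerSL ℝ q).hasFDerivAt
    exact (hasFDerivAt_radial hd' c).mul (e1.mul e2)
  have hsm : ∀ p q : Vec, ContDiff ℝ (⊤ : ℕ∞) fun h : Vec => radial (deriv a) h *
      (inner ℝ h p * inner ℝ h q) := fun p q =>
    (contDiff_radial ha').mul ((contDiff_id.inner ℝ contDiff_const).mul
      (contDiff_id.inner ℝ contDiff_const))
  have hsupp : ∀ p q : Vec, HasCompactSupport fun h : Vec => radial (deriv a) h *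
      (inner ℝ h p * inner ℝ h q) := fun p q => hasCompactSupport_radial_mul h0' _
  have hra := hasFDerivAt_radial hd
  -- Gradients of the kernels `c a(|h|²) - a'(|h|²) (h · p)(h · q)` correlate to zero with `u`.
  -- Taking `p = q = u(x)`, the value `c = |u(x)|²` gives the hypothesis of the polarization
  -- identity, and `c = -|u(x)|²/2` is used to evaluate the `UUV` term.
  have hdiv1 : ∀ c : ℝ, ∀ p q : Vec, ∀ x, Integrable (fun h => 2 * c * radial (deriv a) h *
      inner ℝ h (u (x + proj h)) - radial (deriv a) h * (inner ℝ h p * inner ℝ q (u (x + proj h))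
        + inner ℝ h q * inner ℝ p (u (x + proj h))) - 2 * radial (deriv (deriv a)) h *
          (inner ℝ h p * inner ℝ h q) * inner ℝ h (u (x + proj h))) ∧
      ∫ h, (2 * c * radial (deriv a) h *
      inner ℝ h (u (x + proj h)) - radial (deriv a) h * (inner ℝ h p * inner ℝ q (u (x + proj h))
        + inner ℝ h q * inner ℝ p (u (x + proj h))) - 2 * radial (deriv (deriv a)) h *
          (inner ℝ h p * inner ℝ h q) * inner ℝ h (u (x + proj h))) = 0 := by
    intro c p q x
    have h1 : ContDiff ℝ (⊤ : ℕ∞) (fun h => c * radial a h - radial (deriv a) h *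
      (inner ℝ h p * inner ℝ h q)) := (contDiff_const.mul (contDiff_radial ha)).sub (hsm p q)
    have h2 : HasCompactSupport (fun h => c * radial a h - radial (deriv a) h *
      (inner ℝ h p * inner ℝ h q)) :=
      ((hasCompactSupport_radial h0).mul_left (f := fun _ => c)).sub (hsupp p q)
    have h3 := integral_fderiv_kernel_eq_zero h1 h2 hdiv x
    have h4 := integrable_fderiv_kernel h1 h2 u x
    have h5 : ∀ h w, fderiv ℝ (fun h => c * radial a h - radial (deriv a) h *
      (inner ℝ h p * inner ℝ h q)) h w = 2 * c * radial (deriv a) h *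
      inner ℝ h w - radial (deriv a) h * (inner ℝ h p * inner ℝ q w
        + inner ℝ h q * inner ℝ p w) - 2 * radial (deriv (deriv a)) h *
          (inner ℝ h p * inner ℝ h q) * inner ℝ h w := by
      intro h w
      rw [HasFDerivAt.fderiv (((hra h).const_mul c).fun_sub (hquad h p q))]
      simp [radial]; ring
    simp only [h5] at h3 h4
    exact ⟨h4, h3⟩
  have key := integral_trilinear_increment (D := D) (κ := κ) hu3 (by fun_prop) ?_
    (fun h => by positivity) hκi ?_ ?_ ?_ ?_ ?_
  -- Modulo a vanishing gradient correlation, the corrected form equals `3/2` times the integrand `2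
  -- a' (h · u)(u · u(x + h))` of the flux. With the factor 4 of the polarization and the 2 of the
  -- diagonal value, this yields the constant `1/3`.
  · have e0 : ∀ x, ∫ h, D h (u x) (u x) (u (x + proj h)) = 3 / 2 *
        ∫ h, 2 * deriv a (‖h‖ ^ 2) * inner ℝ h (u x) * inner ℝ (u x) (u (x + proj h)) := by
      intro x
      obtain ⟨i1, z1⟩ := hdiv1 (-(1 / 2) * inner ℝ (u x) (u x)) (u x) (u x) x
      have i2 : Integrable fun h => 2 * deriv a (‖h‖ ^ 2) * inner ℝ h (u x) *
          inner ℝ (u x) (u (x + proj h)) := by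
        have := integrable_kernel_smul (k := fun h => radial (deriv a) h * inner ℝ h (u x))
          (by fun_prop) (hasCompactSupport_radial_mul h0' _) u.integrable x
        refine (((innerSL ℝ (u x)).integrable_comp this).const_mul 2).congr
          (ae_of_all _ fun h => ?_)
        simp [radial]; ring
      rw [← integral_const_mul, ← add_zero (∫ h, _ * _), ← z1, ← integral_add (i2.const_mul _) i1]
      congr 1; ext h
      simp only [hD, radial]; ring
    simp only [e0] at key
    rw [integral_const_mul] at key
    rw [convection_conv (contDiff_radial ha) (hasCompactSupport_radial h0)]
    simp only [fderiv_radial hd]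
    have e1 : ∫ h, radial (deriv (deriv a)) h * incrPar u h = ∫ p : Torus × Vec,
        radial (deriv (deriv a)) p.2 * inner ℝ (increment u p.2 p.1) p.2 ^ 3 ∂pairMeasure := by
      rw [integral_prod_symm]
      · simp [incrPar, integral_const_mul]
      · refine (integrable_cube_increment hu3 hκi').mono'
          ((aestronglyMeasurable_kernel hc''.aestronglyMeasurable).mul
          (((aestronglyMeasurable_increment u).inner
              continuous_snd.aestronglyMeasurable).pow 3)) ?_
        filter_upwards with p
        simp only [hκ']
        rw [norm_mul, norm_pow, abs_mul, Real.norm_eq_abs, abs_of_nonneg (by positivity :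
          0 ≤ ‖p.2‖ ^ 3), mul_assoc, mul_comm (‖p.2‖ ^ 3), ← mul_pow]
        gcongr
        exact norm_inner_le_norm _ _
    have e2 : ∫ p : Torus × Vec, D p.2 (u (p.1 + proj p.2) - u p.1) (u (p.1 + proj p.2) - u p.1)
        (u (p.1 + proj p.2) - u p.1) ∂pairMeasure = -2 * ∫ p : Torus × Vec,
        radial (deriv (deriv a)) p.2 * inner ℝ (increment u p.2 p.1) p.2 ^ 3 ∂pairMeasure := by
      rw [← integral_const_mul]
      congr 1; ext p
      simp only [hD, increment, real_inner_comm p.2]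
      ring
    rw [e2, ← e1] at key
    linarith
  · intro h p q w
    have b1 : |2 * radial (deriv a) h * inner ℝ h q * inner ℝ p w|
        ≤ 2 * |radial (deriv a) h * ‖h‖| * (‖p‖ * ‖q‖ * ‖w‖) := by
      simp only [abs_mul, abs_norm]
      calc _ ≤ |2| * |radial (deriv a) h| * (‖h‖ * ‖q‖) * (‖p‖ * ‖w‖) := by
            gcongr <;> exact abs_real_inner_le_norm _ _
        _ = _ := by simp; ring
    have b2 : |2 * radial (deriv (deriv a)) h * inner ℝ h p * inner ℝ h q * inner ℝ h w|
        ≤ 2 * κ' h * (‖p‖ * ‖q‖ * ‖w‖) := by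
      simp only [hκ', abs_mul, abs_pow, abs_norm]
      calc _ ≤ |2| * |radial (deriv (deriv a)) h| * (‖h‖ * ‖p‖) * (‖h‖ * ‖q‖) * (‖h‖ * ‖w‖) := by
            gcongr <;> exact abs_real_inner_le_norm _ _
        _ = _ := by simp; ring
    have b3 : |radial (deriv a) h * (inner ℝ p q * inner ℝ h w + inner ℝ h p * inner ℝ q w)|
        ≤ 2 * |radial (deriv a) h * ‖h‖| * (‖p‖ * ‖q‖ * ‖w‖) := by
      simp only [abs_mul, abs_norm]
      calc _ ≤ |radial (deriv a) h| * ((‖p‖ * ‖q‖) * (‖h‖ * ‖w‖) + (‖h‖ * ‖p‖) * (‖q‖ * ‖w‖)) := by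
            gcongr
            refine (abs_add_le _ _).trans ?_
            rw [abs_mul, abs_mul]
            gcongr <;> exact abs_real_inner_le_norm _ _
        _ = _ := by ring
    calc _ ≤ _ := (abs_sub _ _).trans (add_le_add ((abs_sub _ _).trans (add_le_add b1 b2)) b3)
      _ = _ := by simp only [hκ]; ring
  · intro h p q w
    simp only [hD, radial_neg, inner_neg_left]; ring
  · intro h p q w
    simp only [hD, real_inner_comm p w, real_inner_comm p q, real_inner_comm q w]; ring
  · intro h p p' q w; simp only [hD, inner_sub_left, inner_sub_right]; ring
  · intro h p q q' w; simp only [hD, inner_sub_left, inner_sub_right]; ring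
  · intro x
    rw [← (hdiv1 (inner ℝ (u x) (u x)) (u x) (u x) x).2]
    congr 1; ext h
    simp only [hD, real_inner_comm (u x) (u (x + proj h))]; ring

end Flux

end Flux

/-! ### Polar coordinates and continuity of spherical increments -/

section Sphere

/-- Integration in polar coordinates. -/
lemma integral_polar {G : Vec → ℝ} (hG : Integrable G) :
    ∫ h, G h = ∫ r in Ioi (0 : ℝ), r ^ 2 * ∫ n : Metric.sphere (0 : Vec) 1, G (r • (n : Vec))
      ∂sphereMeasure := by
  set μ : Measure Vec := volume
  have hmp := μ.measurePreserving_homeomorphUnitSphereProd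
  have hemb := Homeomorph.measurableEmbedding (homeomorphUnitSphereProd Vec)
  set Γ : Metric.sphere (0 : Vec) 1 × Ioi (0 : ℝ) → ℝ := fun p => G (p.2.1 • p.1.1) with hΓ
  have hΓe : ∀ x : ({(0 : Vec)}ᶜ : Set Vec), Γ (homeomorphUnitSphereProd Vec x) = G x := by
    intro x
    have := congrArg Subtype.val ((homeomorphUnitSphereProd Vec).symm_apply_apply x)
    simp only [homeomorphUnitSphereProd_symm_apply_coe] at this
    simp only [hΓ, this]
  have hint : Integrable Γ (μ.toSphere.prod (.volumeIoiPow (Module.finrank ℝ Vec - 1))) := by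
    rw [← hmp.integrable_comp_emb hemb]
    have h1 : IntegrableOn G {(0 : Vec)}ᶜ := hG.integrableOn
    rw [integrableOn_iff_comap_subtypeVal (by measurability)] at h1
    refine h1.congr (ae_of_all _ fun x => (hΓe x).symm)
  calc ∫ h, G h = ∫ x : ({(0 : Vec)}ᶜ : Set Vec), G x ∂(μ.comap (↑)) := by
        rw [integral_subtype_comap (measurableSet_singleton _).compl, restrict_compl_singleton]
    _ = ∫ p, Γ p ∂(μ.toSphere.prod (.volumeIoiPow (Module.finrank ℝ Vec - 1))) := by
        rw [← hmp.integral_comp hemb]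
        simp only [hΓe]
    _ = ∫ r, (∫ n, Γ (n, r) ∂μ.toSphere) ∂(.volumeIoiPow (Module.finrank ℝ Vec - 1)) :=
        integral_prod_symm _ hint
    _ = _ := by
        simp only [Measure.volumeIoiPow, ENNReal.ofReal, finrank_euclideanSpace, Fintype.card_fin]
        rw [integral_withDensity_eq_integral_smul, integral_subtype_comap measurableSet_Ioi
          fun r : ℝ => Real.toNNReal (r ^ (3 - 1)) • ∫ n : Metric.sphere (0 : Vec) 1,
            G (r • (n : Vec)) ∂sphereMeasure]
        · refine setIntegral_congr_fun measurableSet_Ioi fun r hr => ?_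
          simp only [NNReal.smul_def, Real.coe_toNNReal _ (pow_nonneg (le_of_lt hr) _)]
          rfl
        · exact (measurable_subtype_coe.pow_const _).real_toNNReal

lemma sphereMeasure_univ : sphereMeasure.real univ = 4 * Real.pi := by
  rw [Measure.toSphere_real_apply_univ, Measure.real, EuclideanSpace.volume_ball_fin_three]
  simp only [finrank_euclideanSpace, Fintype.card_fin]
  rw [ENNReal.toReal_mul, ENNReal.toReal_ofReal (by positivity)]
  simp
  ring

lemma integral_radial {φ : ℝ → ℝ} (hφ : Integrable fun h : Vec => φ (‖h‖)) :
    ∫ h : Vec, φ ‖h‖ = 4 * Real.pi * ∫ r in Ioi (0 : ℝ), r ^ 2 * φ r := by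
  rw [integral_polar hφ, ← integral_const_mul]
  refine setIntegral_congr_fun measurableSet_Ioi fun r hr => ?_
  have : ∀ n : Metric.sphere (0 : Vec) 1, ‖r • (n : Vec)‖ = r := fun n => by
    rw [norm_smul, Real.norm_of_nonneg (le_of_lt hr)]; simp
  simp only [this, integral_const, sphereMeasure_univ, smul_eq_mul]
  ring

/-- The integral of a function over the sphere of radius `r`. -/
def sphereInt (Ψ : Vec → ℝ) (r : ℝ) : ℝ :=
  ∫ n : Metric.sphere (0 : Vec) 1, Ψ (r • (n : Vec)) ∂sphereMeasure

lemma continuous_sphereInt {Ψ : Vec → ℝ} (hΨ : Continuous Ψ) : Continuous (sphereInt Ψ) := by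
  unfold sphereInt
  have := continuous_parametric_integral_of_continuous (μ := sphereMeasure)
    (f := fun (r : ℝ) (n : Metric.sphere (0 : Vec) 1) => Ψ (r • (n : Vec)))
    (by simp only [Function.uncurry_def]; fun_prop) isCompact_univ
  simpa using this

lemma integral_radial_mul {b : ℝ → ℝ} {R : ℝ} (hb : Continuous b) (h0 : ∀ s, R < s → b s = 0)
    {Ψ : Vec → ℝ} (hΨ : Continuous Ψ) :
    ∫ h, radial b h * Ψ h = ∫ r in Ioi (0 : ℝ), r ^ 2 * (b (r ^ 2) * sphereInt Ψ r) := by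
  have hc : Continuous (radial b) := hb.comp (by fun_prop)
  rw [integral_polar (G := fun h => radial b h * Ψ h) ((hc.mul hΨ).integrable_of_hasCompactSupport
    (hasCompactSupport_radial_mul h0 _))]
  refine setIntegral_congr_fun measurableSet_Ioi fun r hr => ?_
  have : ∀ n : Metric.sphere (0 : Vec) 1, ‖r • (n : Vec)‖ = r := fun n => by
    rw [norm_smul, Real.norm_of_nonneg (le_of_lt hr)]; simp
  simp only [radial, this, integral_const_mul, sphereInt]

section Increments
variable {u : L2} (hu : MemLp u 3 torusMeasure)

lemma Spar_eq (u : L2) {ℓ : ℝ} (hℓ : 0 < ℓ) :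
    Spar u ℓ = 1 / (4 * Real.pi) * (sphereInt (incrPar u) ℓ / ℓ ^ 3) := by
  unfold Spar sphereInt incrPar
  rw [← integral_div]
  congr 2; ext n
  rw [← integral_div]
  congr 1; ext x
  rw [inner_smul_right]
  field_simp

lemma Szero_eq (u : L2) {ℓ : ℝ} (hℓ : 0 < ℓ) :
    Szero u ℓ = 1 / (4 * Real.pi) * (sphereInt (incrZero u) ℓ / ℓ) := by
  unfold Szero sphereInt incrZero
  rw [← integral_div]
  congr 2; ext n
  rw [← integral_div]
  congr 1; ext x
  rw [inner_smul_right]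
  field_simp

include hu

lemma memLp_translate (h : Vec) : MemLp (fun x => u (x + proj h)) 3 torusMeasure :=
  hu.comp_measurePreserving (measurePreserving_add_right torusMeasure (proj h))

lemma memLp_increment (h : Vec) : MemLp (increment u h) 3 torusMeasure :=
  (memLp_translate hu h).sub hu

lemma integral_increment_cube_le (h : Vec) :
    ∫ x, ‖increment u h x‖ ^ 3 ∂torusMeasure ≤ 8 * ∫ x, ‖u x‖ ^ 3 ∂torusMeasure := by
  have h1 := integrable_norm_cube hu
  have h2 := integrable_norm_cube (memLp_translate hu h)
  calc _ ≤ ∫ x, 4 * (‖u x‖ ^ 3 + ‖u (x + proj h)‖ ^ 3) ∂torusMeasure :=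
        integral_mono (integrable_norm_cube (memLp_increment hu h)) ((h1.add h2).const_mul 4)
          fun x => norm_increment_cube_le u h x
    _ = _ := by
        rw [integral_const_mul, integral_add h1 h2,
          (measurePreserving_add_right torusMeasure (proj h)).integral_comp
            (MeasurableEquiv.addRight (proj h)).measurableEmbedding (fun x => ‖u x‖ ^ 3)]
        ring

/-- Translations are continuous in `L³`. -/
lemma tendsto_integral_translate_sub (h₀ : Vec) :
    Tendsto (fun h => ∫ x, ‖u (x + proj h) - u (x + proj h₀)‖ ^ 3 ∂torusMeasure) (𝓝 h₀) (𝓝 0) := by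
  have : Fact ((1 : ℝ≥0∞) ≤ 3) := ⟨by norm_num⟩
  set U : Lp Vec 3 torusMeasure := hu.toLp u
  set g : Vec → C(Torus, Torus) := fun h => ⟨fun x => x + proj h, by fun_prop⟩
  have hg : Continuous g := by
    refine ContinuousMap.continuous_of_continuous_uncurry _ ?_
    simp only [Function.uncurry_def, g, ContinuousMap.coe_mk]
    fun_prop
  have hgm : ∀ h, MeasurePreserving (g h) torusMeasure torusMeasure := fun h =>
    measurePreserving_add_right torusMeasure (proj h)
  have hcont := (continuous_const (y := U)).compMeasurePreservingLp hg hgm (by simp)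
  have h1 : Tendsto (fun h => ‖Lp.compMeasurePreserving (g h) (hgm h) U
      - Lp.compMeasurePreserving (g h₀) (hgm h₀) U‖ ^ 3) (𝓝 h₀) (𝓝 0) := by
    have := (((hcont.tendsto h₀).sub_const
      (Lp.compMeasurePreserving (g h₀) (hgm h₀) U)).norm.pow 3)
    simpa using this
  refine h1.congr fun h => ?_
  have e1 : ∀ h, Lp.compMeasurePreserving (g h) (hgm h) U =ᵐ[torusMeasure]
      fun x => u (x + proj h) := by
    intro h
    refine (Lp.coeFn_compMeasurePreserving U (hgm h)).trans ?_
    exact (hgm h).quasiMeasurePreserving.ae hu.coeFn_toLp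
  rw [Lp.norm_def, eLpNorm_congr_ae (Lp.coeFn_sub _ _),
    eLpNorm_congr_ae ((e1 h).sub (e1 h₀)), ← Real.rpow_natCast, ENNReal.toReal_rpow,
    eLpNorm_eq_lintegral_rpow_enorm_toReal (by norm_num) (by norm_num), ← ENNReal.rpow_mul]
  simp only [ENNReal.toReal_ofNat, Nat.cast_ofNat]
  rw [show (1 / 3 : ℝ) * 3 = 1 by norm_num, ENNReal.rpow_one, integral_eq_lintegral_of_nonneg_ae
    (f := fun x => ‖u (x + proj h) - u (x + proj h₀)‖ ^ 3)
    (ae_of_all _ fun x => by positivity) (integrable_norm_cube ((memLp_translate hu h).sub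
      (memLp_translate hu h₀))).1]
  congr 1
  refine lintegral_congr fun x => ?_
  rw [← ofReal_norm, ENNReal.ofReal_rpow_of_nonneg (norm_nonneg _) (by norm_num)]
  congr 1
  exact_mod_cast Real.rpow_natCast _ 3

/-- A cubic expression in the increment depends continuously on the separation. -/
lemma continuous_integral_cubic {Q : Vec → Vec → ℝ}
    (hQ : Continuous fun z : Vec × Vec => Q z.1 z.2) {N : ℕ}
    (hb : ∀ w h, |Q w h| ≤ ‖h‖ ^ N * ‖w‖ ^ 3)
    (hl : ∀ w z h, |Q w h - Q z h| ≤ ‖h‖ ^ N * (3 * (‖w - z‖ * (‖w‖ + ‖z‖) ^ 2))) :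
    Continuous fun h => ∫ x, Q (increment u h x) h ∂torusMeasure := by
  have hm : ∀ h, AEStronglyMeasurable (increment u h) torusMeasure := fun h =>
    (memLp_increment hu h).1
  have i3 := fun h => integrable_norm_cube (memLp_increment hu h)
  set I : ℝ := ∫ x, ‖u x‖ ^ 3 ∂torusMeasure with hI
  have hI0 : 0 ≤ I := integral_nonneg fun x => by positivity
  have hQi : ∀ h h', Integrable (fun x => Q (increment u h x) h') torusMeasure := fun h h' =>
    ((i3 h).const_mul (‖h'‖ ^ N)).mono' (hQ.comp_aestronglyMeasurable
      ((hm h).prodMk aestronglyMeasurable_const)) (ae_of_all _ fun x => hb _ _)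
  refine continuous_iff_continuousAt.2 fun h₀ => ?_
  have c1 : Tendsto (fun h => ∫ x, Q (increment u h₀ x) h ∂torusMeasure) (𝓝 h₀)
      (𝓝 (∫ x, Q (increment u h₀ x) h₀ ∂torusMeasure)) := by
    refine tendsto_integral_filter_of_dominated_convergence
      (fun x => (‖h₀‖ + 1) ^ N * ‖increment u h₀ x‖ ^ 3) (Eventually.of_forall fun h =>
        (hQi h₀ h).1) ?_ ((i3 h₀).const_mul _) (ae_of_all _ fun x => ?_)
    · filter_upwards [Metric.ball_mem_nhds h₀ one_pos] with h hh
      refine ae_of_all _ fun x => (hb _ _).trans ?_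
      gcongr
      have := norm_sub_norm_le h h₀
      rw [Metric.mem_ball, dist_eq_norm] at hh
      linarith
    · exact (hQ.comp (by fun_prop : Continuous fun h : Vec => (increment u h₀ x, h))).tendsto h₀
  have c2 : Tendsto (fun h => ∫ x, (Q (increment u h x) h - Q (increment u h₀ x) h)
      ∂torusMeasure) (𝓝 h₀) (𝓝 0) := by
    have key : ∀ ε : ℝ, 0 < ε → ∀ h, |∫ x, (Q (increment u h x) h - Q (increment u h₀ x) h)
        ∂torusMeasure| ≤ ‖h‖ ^ N * (3 * (ε * (64 * I) + ε⁻¹ ^ 2 *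
          ∫ x, ‖u (x + proj h) - u (x + proj h₀)‖ ^ 3 ∂torusMeasure)) := by
      intro ε hε h
      have id := integrable_norm_cube ((memLp_translate hu h).sub (memLp_translate hu h₀))
      simp only [Pi.sub_apply] at id
      calc _ ≤ ∫ x, ‖h‖ ^ N * (3 * (ε * (4 * (‖increment u h x‖ ^ 3 + ‖increment u h₀ x‖ ^ 3))
            + ε⁻¹ ^ 2 * ‖u (x + proj h) - u (x + proj h₀)‖ ^ 3)) ∂torusMeasure := by
            rw [← Real.norm_eq_abs]
            refine norm_integral_le_of_norm_le (((((((i3 h).add (i3 h₀)).const_mul 4).const_mul ε).add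
              (id.const_mul _)).const_mul 3).const_mul _) (ae_of_all _ fun x => ?_)
            refine (hl _ _ _).trans ?_
            gcongr
            have e : increment u h x - increment u h₀ x = u (x + proj h) - u (x + proj h₀) := by
              simp [increment]
            rw [e]
            have hs := norm_nonneg (increment u h x)
            have ht := norm_nonneg (increment u h₀ x)
            have hd := norm_nonneg (u (x + proj h) - u (x + proj h₀))
            generalize ‖increment u h x‖ = s at *
            generalize ‖increment u h₀ x‖ = t at *
            generalize ‖u (x + proj h) - u (x + proj h₀)‖ = d at *
            have h1 : (s + t) ^ 3 ≤ 4 * (s ^ 3 + t ^ 3) := by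
              nlinarith [mul_nonneg (add_nonneg hs ht) (sq_nonneg (s - t))]
            -- Comparing `d` with `ε (s + t)` gives `d (s + t)² ≤ ε (s + t)³ + ε⁻² d³`: the first
            -- part is small uniformly near `h₀`, the second tends to zero by continuity of
            -- translations in `L³`.
            rcases le_total d (ε * (s + t)) with hle | hle
            · calc d * (s + t) ^ 2 ≤ ε * (s + t) * (s + t) ^ 2 := by gcongr
                _ = ε * (s + t) ^ 3 := by ring
                _ ≤ ε * (4 * (s ^ 3 + t ^ 3)) := by gcongr
                _ ≤ _ := by
                  have : 0 ≤ ε⁻¹ ^ 2 * d ^ 3 := by positivity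
                  linarith
            · have h2 : s + t ≤ ε⁻¹ * d := by
                rw [inv_mul_eq_div, le_div_iff₀ hε]; linarith
              calc d * (s + t) ^ 2 ≤ d * (ε⁻¹ * d) ^ 2 := by gcongr
                _ = ε⁻¹ ^ 2 * d ^ 3 := by ring
                _ ≤ _ := by
                  have : 0 ≤ ε * (4 * (s ^ 3 + t ^ 3)) := by positivity
                  linarith
        _ = ‖h‖ ^ N * (3 * (ε * (4 * (∫ x, ‖increment u h x‖ ^ 3 ∂torusMeasure
              + ∫ x, ‖increment u h₀ x‖ ^ 3 ∂torusMeasure)) + ε⁻¹ ^ 2 *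
              ∫ x, ‖u (x + proj h) - u (x + proj h₀)‖ ^ 3 ∂torusMeasure)) := by
            rw [integral_const_mul, integral_const_mul, integral_add, integral_const_mul,
              integral_const_mul, integral_add (i3 h) (i3 h₀), integral_const_mul]
            · exact (((i3 h).add (i3 h₀)).const_mul 4).const_mul ε
            · exact id.const_mul _
        -- Each increment contributes at most `8 * I`, whence `64 = 4 * (8 + 8)`.
        _ ≤ _ := by
            have l1 := integral_increment_cube_le hu h
            have l2 := integral_increment_cube_le hu h₀
            gcongr ‖h‖ ^ N * (3 * (ε * ?_ + _))
            linarith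
    rw [Metric.tendsto_nhds]
    intro η hη
    set C : ℝ := (‖h₀‖ + 1) ^ N with hC
    have hC0 : 0 < C := by positivity
    set ε : ℝ := η / (2 * (C * (3 * (64 * I)) + 1)) with hε
    have hε0 : 0 < ε := by positivity
    have t1 : Tendsto (fun h => C * (3 * (ε * (64 * I) + ε⁻¹ ^ 2 *
        ∫ x, ‖u (x + proj h) - u (x + proj h₀)‖ ^ 3 ∂torusMeasure))) (𝓝 h₀)
        (𝓝 (C * (3 * (ε * (64 * I) + ε⁻¹ ^ 2 * 0)))) :=
      ((((tendsto_integral_translate_sub hu h₀).const_mul _).const_add _).const_mul _).const_mul _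
    have hlt : C * (3 * (ε * (64 * I) + ε⁻¹ ^ 2 * 0)) < η := by
      have : C * (3 * (ε * (64 * I) + ε⁻¹ ^ 2 * 0)) = η * (C * (3 * (64 * I)) /
        (2 * (C * (3 * (64 * I)) + 1))) := by rw [hε]; ring
      rw [this]
      have : C * (3 * (64 * I)) / (2 * (C * (3 * (64 * I)) + 1)) < 1 := by
        rw [div_lt_one (by positivity)]
        have : 0 ≤ C * (3 * (64 * I)) := by positivity
        linarith
      nlinarith
    filter_upwards [t1.eventually_lt_const hlt, Metric.ball_mem_nhds h₀ one_pos] with h h1 hh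
    rw [Real.dist_eq, sub_zero]
    refine ((key ε hε0 h).trans ?_).trans_lt h1
    have : ‖h‖ ≤ ‖h₀‖ + 1 := by
      have := norm_sub_norm_le h h₀
      rw [Metric.mem_ball, dist_eq_norm] at hh
      linarith
    rw [hC]
    have : 0 ≤ ∫ x, ‖u (x + proj h) - u (x + proj h₀)‖ ^ 3 ∂torusMeasure :=
      integral_nonneg fun x => by positivity
    gcongr
  have := c2.add c1
  rw [zero_add] at this
  refine this.congr fun h => ?_
  rw [← integral_add (by exact (hQi h h).sub (hQi h₀ h)) (hQi h₀ h)]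
  simp

lemma continuous_incrZero : Continuous (incrZero u) := by
  refine continuous_integral_cubic hu (Q := fun w h => ‖w‖ ^ 2 * inner ℝ w h) (N := 1)
    (by fun_prop) (fun w h => ?_) fun w z h => ?_
  · rw [abs_mul, abs_of_nonneg (sq_nonneg _)]
    calc _ ≤ ‖w‖ ^ 2 * (‖w‖ * ‖h‖) := by gcongr; exact abs_real_inner_le_norm _ _
      _ = _ := by ring
  · have e : ‖w‖ ^ 2 * inner ℝ w h - ‖z‖ ^ 2 * inner ℝ z h
        = ‖w‖ ^ 2 * inner ℝ (w - z) h + (‖w‖ - ‖z‖) * (‖w‖ + ‖z‖) * inner ℝ z h := by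
      rw [inner_sub_left]; ring
    rw [e]
    refine (abs_add_le _ _).trans ?_
    simp only [abs_mul, abs_of_nonneg (sq_nonneg ‖w‖), abs_of_nonneg
      (add_nonneg (norm_nonneg w) (norm_nonneg z))]
    calc _ ≤ (‖w‖ + ‖z‖) ^ 2 * (‖w - z‖ * ‖h‖) + ‖w - z‖ * (‖w‖ + ‖z‖) * ((‖w‖ + ‖z‖) * ‖h‖) := by
          gcongr
          · have := norm_nonneg z; linarith
          · exact abs_real_inner_le_norm _ _
          · exact abs_norm_sub_norm_le _ _
          · refine (abs_real_inner_le_norm _ _).trans ?_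
            gcongr
            have := norm_nonneg w; linarith
      _ = ‖h‖ ^ 1 * (2 * (‖w - z‖ * (‖w‖ + ‖z‖) ^ 2)) := by ring
      _ ≤ _ := by gcongr; norm_num

lemma continuous_incrPar : Continuous (incrPar u) := by
  refine continuous_integral_cubic hu (Q := fun w h => inner ℝ w h ^ 3) (N := 3)
    (by fun_prop) (fun w h => ?_) fun w z h => ?_
  · rw [abs_pow, ← mul_pow, mul_comm]
    gcongr; exact abs_real_inner_le_norm _ _
  · have e : inner ℝ w h ^ 3 - inner ℝ z h ^ 3 = inner ℝ (w - z) h *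
        (inner ℝ w h ^ 2 + inner ℝ w h * inner ℝ z h + inner ℝ z h ^ 2) := by
      rw [inner_sub_left]; ring
    have b1 : |inner ℝ w h| ≤ (‖w‖ + ‖z‖) * ‖h‖ := by
      refine (abs_real_inner_le_norm _ _).trans ?_
      gcongr
      have := norm_nonneg z; linarith
    have b2 : |inner ℝ z h| ≤ (‖w‖ + ‖z‖) * ‖h‖ := by
      refine (abs_real_inner_le_norm _ _).trans ?_
      gcongr
      have := norm_nonneg w; linarith
    rw [e, abs_mul]
    calc _ ≤ ‖w - z‖ * ‖h‖ * (((‖w‖ + ‖z‖) * ‖h‖) ^ 2 + ((‖w‖ + ‖z‖) * ‖h‖) * ((‖w‖ + ‖z‖) * ‖h‖)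
          + ((‖w‖ + ‖z‖) * ‖h‖) ^ 2) := by
          gcongr
          · exact abs_real_inner_le_norm _ _
          · refine (abs_add_le _ _).trans (add_le_add ((abs_add_le _ _).trans (add_le_add ?_ ?_)) ?_)
            · rw [abs_pow]; gcongr
            · rw [abs_mul]; gcongr
            · rw [abs_pow]; gcongr
      _ = _ := by ring

end Increments

end Sphere

/-! ### Moments and Fourier decay of radial profiles -/

section RadialProfile

section Profile
variable {a : ℝ → ℝ} {R : ℝ}

/-- The tail integral from `s` to `R`: integrating from the right preserves vanishing beyond `R` as
well as nonnegativity. It builds the kernels from bumps, once for the 4/3 law and twice for the 4/5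
law, and also supplies plane integrals in the Fourier bound. -/
lemma exists_antiderivative {β : ℝ → ℝ} (hβ : ContDiff ℝ (⊤ : ℕ∞) β) (h0 : ∀ s, R < s → β s = 0)
    (hpos : ∀ s, 0 ≤ β s) : ∃ a : ℝ → ℝ, ContDiff ℝ (⊤ : ℕ∞) a ∧ (∀ s, HasDerivAt a (-β s) s) ∧
      (∀ s, R < s → a s = 0) ∧ ∀ s, 0 ≤ a s := by
  have hd : ∀ s, HasDerivAt (fun s => ∫ x in s..R, β x) (-β s) s := fun s =>
    intervalIntegral.integral_hasDerivAt_left (hβ.continuous.intervalIntegrable _ _)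
      (hβ.continuous.stronglyMeasurableAtFilter _ _) hβ.continuous.continuousAt
  have hz : ∀ s, R < s → ∫ x in s..R, β x = 0 := fun s hs => by
    rw [intervalIntegral.integral_symm, intervalIntegral.integral_of_le hs.le,
      setIntegral_eq_zero_of_forall_eq_zero fun x hx => h0 x hx.1, neg_zero]
  refine ⟨fun s => ∫ x in s..R, β x, ?_, hd, hz, fun s => ?_⟩
  · rw [contDiff_infty_iff_deriv]
    refine ⟨fun s => (hd s).differentiableAt, ?_⟩
    rw [funext fun s => (hd s).deriv]
    exact hβ.neg
  · rcases le_or_gt s R with h | h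
    · exact intervalIntegral.integral_nonneg h fun x _ => hpos x
    · exact (hz s h).ge

lemma integrable_pow_mul_profile (ha : Continuous a) (h0 : ∀ s, R < s → a s = 0) (n : ℕ) :
    Integrable fun r : ℝ => r ^ n * a (r ^ 2) := by
  refine Continuous.integrable_of_hasCompactSupport (by fun_prop) ?_
  refine HasCompactSupport.intro (isCompact_closedBall (0 : ℝ) (R + 1)) fun r hr => ?_
  have h1 : R + 1 < |r| := by simpa using hr
  have h2 : R < r ^ 2 := by
    rw [← sq_abs]
    nlinarith [sq_nonneg (|r| - 1), abs_nonneg r]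
  simp [h0 _ h2]

/-- Integration by parts with `r ^ (n + 1) * a (r ^ 2)`, which vanishes at both ends. It reduces
masses and line integrals of kernels to moments of the underlying bump. -/
lemma integral_pow_mul_profile (ha : ContDiff ℝ (⊤ : ℕ∞) a) (h0 : ∀ s, R < s → a s = 0) (n : ℕ) :
    ∫ r in Ioi (0 : ℝ), r ^ n * a (r ^ 2)
      = 2 / (n + 1) * ∫ r in Ioi (0 : ℝ), r ^ (n + 2) * -deriv a (r ^ 2) := by
  have hd := ha.differentiable (by simp)
  have i1 := (integrable_pow_mul_profile ha.continuous h0 n).integrableOn (s := Ioi 0)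
  have i2 := (integrable_pow_mul_profile (contDiff_deriv ha).continuous
    (deriv_eq_zero_of_gt h0) (n + 2)).integrableOn (s := Ioi 0)
  have hG : ∀ r : ℝ, HasDerivAt (fun r => r ^ (n + 1) * a (r ^ 2))
      ((n + 1) * (r ^ n * a (r ^ 2)) + 2 * (r ^ (n + 2) * deriv a (r ^ 2))) r := by
    intro r
    have e1 := (hd (r ^ 2)).hasDerivAt.comp r (hasDerivAt_pow 2 r)
    refine ((hasDerivAt_pow (n + 1) r).mul e1).congr_deriv ?_
    push_cast
    simp only [Function.comp_apply]
    ring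
  have hlim : Tendsto (fun r : ℝ => r ^ (n + 1) * a (r ^ 2)) atTop (𝓝 0) := by
    refine tendsto_const_nhds.congr' ?_
    filter_upwards [eventually_gt_atTop (max R 1)] with r hr
    have : R < r ^ 2 := by
      have h1 := (le_max_left R 1).trans_lt hr
      have h2 := (le_max_right R 1).trans_lt hr
      nlinarith
    simp [h0 _ this]
  have key := integral_Ioi_of_hasDerivAt_of_tendsto' (fun r _ => hG r)
    ((i1.const_mul _).add (i2.const_mul _)) hlim
  rw [integral_add (i1.const_mul _) (i2.const_mul _), integral_const_mul, integral_const_mul] at key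
  simp only [mul_neg, integral_neg]
  have hn : (n + 1 : ℝ) ≠ 0 := by positivity
  simp at key
  field_simp
  linarith

lemma integral_radial_profile (ha : Continuous a) (h0 : ∀ s, R < s → a s = 0) :
    ∫ h, radial a h = 4 * Real.pi * ∫ r in Ioi (0 : ℝ), r ^ 2 * a (r ^ 2) := by
  refine integral_radial (φ := fun r => a (r ^ 2)) ?_
  exact Continuous.integrable_of_hasCompactSupport (by fun_prop) (hasCompactSupport_radial h0)

/-- The integral of a radial profile over the planes at distance `|s|` from the origin. -/
lemma integral_plane {A : ℝ → ℝ} (ha : Continuous a) (h0 : ∀ s, R < s → a s = 0)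
    (hA : ∀ s, HasDerivAt A (-a s) s) (hA0 : ∀ s, R < s → A s = 0) (c : ℝ) :
    ∫ z : EuclideanSpace ℝ (Fin 2), a (c ^ 2 + ‖z‖ ^ 2) = Real.pi * A (c ^ 2) := by
  rw [integral_fun_norm_addHaar volume (fun r : ℝ => a (c ^ 2 + r ^ 2))]
  simp only [finrank_euclideanSpace, Fintype.card_fin, Measure.real, EuclideanSpace.volume_ball_fin_two]
  have hG : ∀ r : ℝ, HasDerivAt (fun r => -(1 / 2) * A (c ^ 2 + r ^ 2))
      (r ^ (2 - 1) • a (c ^ 2 + r ^ 2)) r := by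
    intro r
    have e1 := (hA (c ^ 2 + r ^ 2)).comp r ((hasDerivAt_pow 2 r).const_add (c ^ 2))
    refine (e1.const_mul (-(1 / 2))).congr_deriv ?_
    simp; ring
  have hlim : Tendsto (fun r : ℝ => -(1 / 2) * A (c ^ 2 + r ^ 2)) atTop (𝓝 0) := by
    refine tendsto_const_nhds.congr' ?_
    filter_upwards [eventually_gt_atTop (max R 1)] with r hr
    have : R < c ^ 2 + r ^ 2 := by
      have h1 := (le_max_left R 1).trans_lt hr
      have h2 := (le_max_right R 1).trans_lt hr
      nlinarith [sq_nonneg c]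
    simp [hA0 _ this]
  have hi := integrable_pow_mul_profile (a := fun s => a (c ^ 2 + s)) (R := R) (by fun_prop)
    (fun s hs => h0 _ (by nlinarith [sq_nonneg c])) 1
  rw [integral_Ioi_of_hasDerivAt_of_tendsto' (fun r _ => hG r) hi.integrableOn hlim]
  simp [ENNReal.toReal_ofReal Real.pi_pos.le]
  ring

lemma exists_isometry_inner (ξ : Vec) : ∃ T : Vec ≃ₗᵢ[ℝ] Vec, ∀ h, inner ℝ ξ h = ‖ξ‖ * T h 0 := by
  set e : Vec := ‖ξ‖ • EuclideanSpace.single 0 1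
  have hn : ‖ξ‖ = ‖e‖ := by simp [e, norm_smul]
  -- Reflection in the hyperplane orthogonal to `ξ - ‖ξ‖ e₀` exchanges the two vectors of equal
  -- length.
  refine ⟨(Submodule.span ℝ {ξ - e})ᗮ.reflection, fun h => ?_⟩
  have h1 := Submodule.reflection_sub hn
  rw [← LinearIsometryEquiv.inner_map_map ((Submodule.span ℝ {ξ - e})ᗮ.reflection) ξ h, h1]
  simp only [e, inner_smul_left, EuclideanSpace.inner_single_left]
  simp

/-- The Fourier transform of a radial profile as a one dimensional cosine transform. -/
lemma integral_radial_cos {A : ℝ → ℝ} (ha : Continuous a) (h0 : ∀ s, R < s → a s = 0)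
    (hA : ∀ s, HasDerivAt A (-a s) s) (hA0 : ∀ s, R < s → A s = 0) (ξ : Vec) :
    ∫ h, radial a h * Real.cos (inner ℝ ξ h)
      = Real.pi * ∫ s : ℝ, A (s ^ 2) * Real.cos (‖ξ‖ * s) := by
  obtain ⟨T, hT⟩ := exists_isometry_inner ξ
  have e1 : ∫ h, radial a h * Real.cos (inner ℝ ξ h)
      = ∫ h : Vec, radial a h * Real.cos (‖ξ‖ * h 0) := by
    have := T.measurePreserving.integral_comp T.toHomeomorph.measurableEmbedding
      (fun h => radial a h * Real.cos (‖ξ‖ * h 0))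
    rw [← this]
    congr 1; ext h
    simp [radial, hT]
  have hint : Integrable fun h : Vec => radial a h * Real.cos (‖ξ‖ * h 0) := by
    have : Continuous (radial a) := ha.comp (by fun_prop)
    exact Continuous.integrable_of_hasCompactSupport (by fun_prop) (hasCompactSupport_radial_mul h0 _)
  set Φ : ℝ × (Fin 2 → ℝ) → ℝ := fun p => a (p.1 ^ 2 + (p.2 0 ^ 2 + p.2 1 ^ 2)) *
    Real.cos (‖ξ‖ * p.1) with hΦ
  have hmp := (volume_preserving_piFinSuccAbove (fun _ : Fin 3 => ℝ) 0).comp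
    (EuclideanSpace.volume_preserving_symm_measurableEquiv_toLp (Fin 3))
  have hemb : MeasurableEmbedding ((MeasurableEquiv.piFinSuccAbove (fun _ : Fin 3 => ℝ) 0) ∘
      (MeasurableEquiv.toLp 2 (Fin 3 → ℝ)).symm) :=
    (MeasurableEquiv.measurableEmbedding _).comp (MeasurableEquiv.measurableEmbedding _)
  have hcomp : ∀ h : Vec, Φ (((MeasurableEquiv.piFinSuccAbove (fun _ : Fin 3 => ℝ) 0) ∘
      (MeasurableEquiv.toLp 2 (Fin 3 → ℝ)).symm) h) = radial a h * Real.cos (‖ξ‖ * h 0) := by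
    intro h
    simp [hΦ, radial, EuclideanSpace.norm_sq_eq, Fin.sum_univ_three, add_assoc, Fin.tail]
  have hΦi : Integrable Φ (volume.prod volume) := by
    have := (hmp.integrable_comp_emb hemb (g := Φ)).1 (hint.congr (ae_of_all _ fun h => (hcomp h).symm))
    exact this
  rw [e1, ← integral_const_mul]
  calc _ = ∫ p, Φ p := by
        rw [← hmp.integral_comp hemb]
        simp only [hcomp]
    _ = ∫ s : ℝ, ∫ z : Fin 2 → ℝ, Φ (s, z) := integral_prod _ hΦi
    _ = _ := by
        congr 1; ext s
        simp only [hΦ]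
        rw [integral_mul_const, ← mul_assoc, ← integral_plane ha h0 hA hA0 s,
          ← (EuclideanSpace.volume_preserving_symm_measurableEquiv_toLp (Fin 2)).integral_comp
            (MeasurableEquiv.measurableEmbedding _)]
        simp [EuclideanSpace.norm_sq_eq, Fin.sum_univ_two]

/-- The Fourier transform of a nonnegative decreasing profile decays quadratically. -/
theorem norm_sq_mul_abs_integral_radial_cos_le (ha : ContDiff ℝ (⊤ : ℕ∞) a)
    (h0 : ∀ s, R < s → a s = 0) (hpos : ∀ s, 0 ≤ a s) (hanti : ∀ s, deriv a s ≤ 0) (ξ : Vec) :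
    ‖ξ‖ ^ 2 * |∫ h, radial a h * Real.cos (inner ℝ ξ h)|
      ≤ 8 * Real.pi * ∫ r in Ioi (0 : ℝ), a (r ^ 2) := by
  obtain ⟨A, hAs, hA, hA0, -⟩ := exists_antiderivative ha h0 hpos
  rw [integral_radial_cos ha.continuous h0 hA hA0]
  set L := ‖ξ‖
  have ha' := contDiff_deriv ha
  have h0' := deriv_eq_zero_of_gt h0
  have hd := ha.differentiable (by simp)
  -- Up to the factor `π`, this is the integral of the kernel over the plane at height `s`.
  -- Quadratic decay of its cosine transform comes from integrating by parts twice, so only the `L¹`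
  -- norm of `p''` matters.
  set p : ℝ → ℝ := fun s => A (s ^ 2)
  set p' : ℝ → ℝ := fun s => -2 * (s ^ 1 * a (s ^ 2))
  set p'' : ℝ → ℝ := fun s => -2 * (s ^ 0 * a (s ^ 2)) - 4 * (s ^ 2 * deriv a (s ^ 2))
  have ip : Integrable p := by simpa using! integrable_pow_mul_profile hAs.continuous hA0 0
  have ip' : Integrable p' := (integrable_pow_mul_profile ha.continuous h0 1).const_mul _
  have i0 := integrable_pow_mul_profile ha.continuous h0 0
  have i2 := integrable_pow_mul_profile ha'.continuous h0' 2
  have ip'' : Integrable p'' := (i0.const_mul _).sub (i2.const_mul _)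
  have dp : ∀ s, HasDerivAt p (p' s) s := fun s => by
    refine ((hA (s ^ 2)).comp s (hasDerivAt_pow 2 s)).congr_deriv ?_
    simp [p']; ring
  have dp' : ∀ s, HasDerivAt p' (p'' s) s := fun s => by
    have e1 := (hd (s ^ 2)).hasDerivAt.comp s (hasDerivAt_pow 2 s)
    refine (((hasDerivAt_pow 1 s).mul e1).const_mul (-2)).congr_deriv ?_
    simp [p'']; ring
  have dc : ∀ s, HasDerivAt (fun s => Real.cos (L * s)) (-(L * Real.sin (L * s))) s := fun s => by
    refine ((hasDerivAt_id s).const_mul L).cos.congr_deriv ?_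
    simp; ring
  have ds : ∀ s, HasDerivAt (fun s => Real.sin (L * s)) (L * Real.cos (L * s)) s := fun s => by
    refine ((hasDerivAt_id s).const_mul L).sin.congr_deriv ?_
    simp; ring
  have bdd : ∀ {φ g : ℝ → ℝ}, Integrable φ → Continuous g → (∀ s, |g s| ≤ 1) →
      Integrable fun s => φ s * g s := fun hφ hg hb =>
    hφ.mul_bdd hg.aestronglyMeasurable (ae_of_all _ hb)
  have hcc : Continuous fun s => Real.cos (L * s) := by fun_prop
  have hsc : Continuous fun s => Real.sin (L * s) := by fun_prop
  have q1 : ∫ s, p s * (L * Real.cos (L * s)) = -∫ s, p' s * Real.sin (L * s) := by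
    refine integral_mul_deriv_eq_deriv_mul_of_integrable (fun s _ => dp s) (fun s _ => ds s) ?_ ?_ ?_
    · refine ((bdd ip hcc fun s => Real.abs_cos_le_one _).const_mul L).congr (ae_of_all _ fun s => ?_)
      simp; ring
    · exact bdd ip' hsc fun s => Real.abs_sin_le_one _
    · exact bdd ip hsc fun s => Real.abs_sin_le_one _
  have q2 : ∫ s, p' s * (-(L * Real.sin (L * s))) = -∫ s, p'' s * Real.cos (L * s) := by
    refine integral_mul_deriv_eq_deriv_mul_of_integrable (fun s _ => dp' s) (fun s _ => dc s) ?_ ?_ ?_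
    · refine ((bdd ip' hsc fun s => Real.abs_sin_le_one _).const_mul (-L)).congr
        (ae_of_all _ fun s => ?_)
      simp; ring
    · exact bdd ip'' hcc fun s => Real.abs_cos_le_one _
    · exact bdd ip' hcc fun s => Real.abs_cos_le_one _
  have q3 : L ^ 2 * ∫ s, p s * Real.cos (L * s) = -∫ s, p'' s * Real.cos (L * s) := by
    have r1 : ∫ s, p s * (L * Real.cos (L * s)) = L * ∫ s, p s * Real.cos (L * s) := by
      rw [← integral_const_mul]; congr 1; ext s; ring
    have r2 : ∫ s, p' s * (-(L * Real.sin (L * s))) = -L * ∫ s, p' s * Real.sin (L * s) := by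
      rw [← integral_const_mul]; congr 1; ext s; ring
    rw [r1] at q1
    rw [r2] at q2
    rw [← q2, sq, mul_assoc, q1]; ring
  -- The signs of `a` and `a'` give `|p''| ≤ 2 a + 4 s² (-a')`, and `∫ s² (-a'(s²))` is half of `∫
  -- a(s²)`. Over both half lines the constant is `2 * (2 + 2) = 8`; no derivative of the bump
  -- enters, so the bound survives its concentration.
  have bound : |∫ s, p'' s * Real.cos (L * s)| ≤ 8 * ∫ r in Ioi (0 : ℝ), a (r ^ 2) := by
    calc _ ≤ ∫ s, (2 * (s ^ 0 * a (s ^ 2)) + 4 * (s ^ 2 * -deriv a (s ^ 2))) := by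
          rw [← Real.norm_eq_abs]
          refine norm_integral_le_of_norm_le ((i0.const_mul _).add
            ((i2.neg.const_mul 4).congr (ae_of_all _ fun s => by simp))) (ae_of_all _ fun s => ?_)
          rw [norm_mul]
          refine (mul_le_of_le_one_right (norm_nonneg _) (Real.abs_cos_le_one _)).trans ?_
          have u1 := hpos (s ^ 2)
          have u2 := mul_nonneg (sq_nonneg s) (neg_nonneg.2 (hanti (s ^ 2)))
          rw [Real.norm_eq_abs, abs_le]
          simp only [p'', pow_zero, one_mul]
          constructor <;> nlinarith
      _ = 2 * ∫ r in Ioi (0 : ℝ), (2 * (r ^ 0 * a (r ^ 2)) + 4 * (r ^ 2 * -deriv a (r ^ 2))) := by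
          rw [← integral_comp_abs (f := fun r => 2 * (r ^ 0 * a (r ^ 2))
            + 4 * (r ^ 2 * -deriv a (r ^ 2)))]
          simp
      _ = _ := by
          have := integral_pow_mul_profile ha h0 0
          rw [integral_add (i0.integrableOn.const_mul _) ((i2.neg.integrableOn.const_mul 4).congr
            (ae_of_all _ fun s => by simp)), integral_const_mul, integral_const_mul, this]
          simp at this
          simp [this]
          ring
  rw [abs_mul, abs_of_pos Real.pi_pos]
  calc _ = Real.pi * |L ^ 2 * ∫ s, p s * Real.cos (L * s)| := by
        rw [abs_mul, abs_of_nonneg (sq_nonneg L)]; ring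
    _ ≤ Real.pi * (8 * ∫ r in Ioi (0 : ℝ), a (r ^ 2)) := by
        rw [q3, abs_neg]; gcongr
    _ = _ := by ring

end Profile

end RadialProfile

/-! ### Kernels whose flux concentrates at a single scale -/

section StructureProfile

/-- A nonnegative smooth bump concentrated just above `ℓ²`. -/
structure IsBumpAbove (ℓ : ℝ) (β : ℝ → ℝ) : Prop where
  smooth : ContDiff ℝ (⊤ : ℕ∞) β
  nonneg : ∀ s, 0 ≤ β s
  left : ∀ s, s ≤ ℓ ^ 2 → β s = 0
  right : ∀ s, 4 * ℓ ^ 2 < s → β s = 0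
  nontrivial : ∃ s, 0 < s ∧ β s ≠ 0

lemma exists_bumps {ℓ : ℝ} (hℓ : 0 < ℓ) : ∃ β : ℕ → ℝ → ℝ, (∀ n, IsBumpAbove ℓ (β n)) ∧
    ∀ b, ℓ ^ 2 < b → ∀ᶠ n in atTop, ∀ s, b < s → β n s = 0 := by
  set η : ℕ → ℝ := fun n => ℓ ^ 2 / (n + 1)
  have hη : ∀ n, 0 < η n := fun n => by positivity
  have hη1 : ∀ n, η n ≤ ℓ ^ 2 := fun n => div_le_self (by positivity) (by simp)
  have hηt : Tendsto η atTop (𝓝 0) := by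
    simpa [η, div_eq_mul_inv] using tendsto_one_div_add_atTop_nhds_zero_nat.const_mul (ℓ ^ 2)
  -- Centre `ℓ² + 2η` and outer radius `η` place the bump between `ℓ² + η` and `ℓ² + 3η`. Since `η ≤
  -- ℓ²`, this lies strictly above `ℓ²` and within `4ℓ²`.
  set f : ∀ n, ContDiffBump (ℓ ^ 2 + 2 * η n) := fun n => ⟨η n / 2, η n, half_pos (hη n), half_lt_self (hη n)⟩
  have hout : ∀ n s, η n ≤ |s - (ℓ ^ 2 + 2 * η n)| → f n s = 0 := fun n s hs =>
    (f n).zero_of_le_dist hs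
  refine ⟨fun n => f n, fun n => ⟨(f n).contDiff, fun s => (f n).nonneg, fun s hs => hout n s ?_,
    fun s hs => hout n s ?_, ℓ ^ 2 + 2 * η n, by have := hη n; positivity, ?_⟩, fun b hb => ?_⟩
  · rw [abs_of_nonpos (by linarith [hη n])]; linarith [hη n]
  · exact (by linarith [hη1 n] : η n ≤ s - (ℓ ^ 2 + 2 * η n)).trans (le_abs_self _)
  · have := (f n).one_of_mem_closedBall (Metric.mem_closedBall_self (f n).rIn_pos.le)
    simp [this]
  · have : ∀ᶠ n in atTop, η n < (b - ℓ ^ 2) / 3 :=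
      hηt.eventually_lt_const (by linarith)
    filter_upwards [this] with n hn s hs
    refine hout n s ((by linarith : η n ≤ s - (ℓ ^ 2 + 2 * η n)).trans (le_abs_self _))

namespace IsBumpAbove
variable {ℓ : ℝ} {β : ℝ → ℝ} (h : IsBumpAbove ℓ β)
include h

lemma moment_pos (m : ℕ) : 0 < ∫ r in Ioi (0 : ℝ), r ^ m * β (r ^ 2) := by
  have hc : Continuous fun r : ℝ => r ^ m * β (r ^ 2) := by
    have := h.smooth.continuous; fun_prop
  obtain ⟨s, hs, hβ⟩ := h.nontrivial
  rw [setIntegral_pos_iff_support_of_nonneg_ae]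
  · refine (IsOpen.inter (isOpen_ne_fun hc continuous_const) isOpen_Ioi).measure_pos _
      ⟨√s, ?_, Real.sqrt_pos.2 hs⟩
    simp [Real.sq_sqrt hs.le, hβ, (Real.sqrt_pos.2 hs).ne']
  · filter_upwards [ae_restrict_mem measurableSet_Ioi] with r hr
    exact mul_nonneg (pow_nonneg (le_of_lt hr) _) (h.nonneg _)
  · exact (integrable_pow_mul_profile h.smooth.continuous h.right m).integrableOn

lemma moment_le (m : ℕ) :
    ℓ ^ 2 * ∫ r in Ioi (0 : ℝ), r ^ m * β (r ^ 2) ≤ ∫ r in Ioi (0 : ℝ), r ^ (m + 2) * β (r ^ 2) := by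
  rw [← integral_const_mul]
  refine setIntegral_mono_on ((integrable_pow_mul_profile h.smooth.continuous h.right m).integrableOn.const_mul _)
    (integrable_pow_mul_profile h.smooth.continuous h.right _).integrableOn measurableSet_Ioi
    fun r hr => ?_
  rcases le_or_gt (r ^ 2) (ℓ ^ 2) with h1 | h1
  · simp [h.left _ h1]
  · have := mul_nonneg (pow_nonneg (le_of_lt hr) m) (h.nonneg (r ^ 2))
    rw [pow_add]
    nlinarith

/-- Serves twice: with `c = N ℓ / z ℓ` and `b` close to `ℓ` it gives convergence of the flux, and
with `c = 0`, `b = 2 * ℓ` it gives the bound uniform in the profile. -/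
lemma abs_integral_sub_le (hℓ : 0 < ℓ) {N z : ℝ → ℝ} (hN : Continuous N) (hz : Continuous z) {c δ b : ℝ}
    (hb : ∀ s, b ^ 2 < s → β s = 0) (hb0 : 0 < b)
    (hle : ∀ r, ℓ < r → r ≤ b → |N r - c * z r| ≤ δ * z r) :
    |(∫ r in Ioi (0 : ℝ), r ^ 2 * (β (r ^ 2) * N r)) - c * ∫ r in Ioi (0 : ℝ), r ^ 2 * (β (r ^ 2) * z r)|
      ≤ δ * ∫ r in Ioi (0 : ℝ), r ^ 2 * (β (r ^ 2) * z r) := by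
  have hβ := h.smooth.continuous
  have hi : ∀ g : ℝ → ℝ, Continuous g → Integrable fun r : ℝ => r ^ 2 * (β (r ^ 2) * g r) := by
    intro g hg
    refine Continuous.integrable_of_hasCompactSupport (by fun_prop) ?_
    refine HasCompactSupport.intro (isCompact_closedBall (0 : ℝ) b) fun r hr => ?_
    have h1 : b < |r| := by simpa using hr
    have h2 : b ^ 2 < r ^ 2 := by rw [← sq_abs r]; gcongr
    simp [hb _ h2]
  have iN := (hi N hN).integrableOn (s := Ioi 0)
  have iz := (hi z hz).integrableOn (s := Ioi 0)
  rw [← integral_const_mul, ← integral_const_mul, ← integral_sub iN (iz.const_mul c), ← Real.norm_eq_abs]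
  refine norm_integral_le_of_norm_le (iz.const_mul δ) ?_
  filter_upwards [ae_restrict_mem measurableSet_Ioi] with r hr
  have hr : 0 < r := hr
  by_cases h0 : β (r ^ 2) = 0
  · simp [h0]
  · have h1 : ℓ < r := by
      by_contra hcon
      exact h0 (h.left _ (by gcongr; exact not_lt.1 hcon))
    have h2 : r ≤ b := by
      by_contra hcon
      exact h0 (hb _ (by gcongr; exact not_le.1 hcon))
    have := mul_le_mul_of_nonneg_left (hle r h1 h2) (mul_nonneg (sq_nonneg r) (h.nonneg (r ^ 2)))
    rw [Real.norm_eq_abs]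
    calc _ = (r ^ 2 * β (r ^ 2)) * |N r - c * z r| := by
          conv_rhs => rw [← abs_of_nonneg (mul_nonneg (sq_nonneg r) (h.nonneg (r ^ 2))), ← abs_mul]
          congr 1; ring
      _ ≤ _ := this
      _ = _ := by ring

end IsBumpAbove

/-- Because `Z n` integrates the same bump against `z`, the ratio is a weighted average of `N r / z
r` over radii just above `ℓ`. Continuity at `ℓ` then isolates the single scale. -/
lemma tendsto_bump_ratio {ℓ : ℝ} (hℓ : 0 < ℓ) {β : ℕ → ℝ → ℝ} (hβ : ∀ n, IsBumpAbove ℓ (β n))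
    (hβt : ∀ b, ℓ ^ 2 < b → ∀ᶠ n in atTop, ∀ s, b < s → β n s = 0)
    {N z : ℝ → ℝ} (hN : Continuous N) (hz : Continuous z) (hzℓ : ∀ r, 0 < r → 0 < z r)
    {Z : ℕ → ℝ} (hZ : ∀ n, Z n = ∫ r in Ioi (0 : ℝ), r ^ 2 * (β n (r ^ 2) * z r)) (hZ0 : ∀ n, 0 < Z n) :
    Tendsto (fun n => (∫ r in Ioi (0 : ℝ), r ^ 2 * (β n (r ^ 2) * N r)) / Z n) atTop (𝓝 (N ℓ / z ℓ)) := by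
  rw [Metric.tendsto_nhds]
  intro δ hδ
  have hct : ContinuousAt (fun r => N r / z r) ℓ := hN.continuousAt.div hz.continuousAt (hzℓ ℓ hℓ).ne'
  obtain ⟨ρ, hρ, hρ'⟩ := Metric.continuousAt_iff.1 hct (δ / 2) (half_pos hδ)
  have hb : ℓ ^ 2 < (ℓ + ρ / 2) ^ 2 := by gcongr; linarith
  filter_upwards [hβt _ hb] with n hn
  have := (hβ n).abs_integral_sub_le hℓ hN hz (c := N ℓ / z ℓ) (δ := δ / 2) hn (by positivity)
    fun r h1 h2 => by
      have h3 : |r - ℓ| < ρ := by rw [abs_of_pos (by linarith)]; linarith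
      have h4 := (hρ' h3).le
      have h5 := hzℓ r (hℓ.trans h1)
      rw [Real.dist_eq] at h4
      calc |N r - N ℓ / z ℓ * z r| = |(N r / z r - N ℓ / z ℓ) * z r| := by
            congr 1; field_simp
        _ ≤ _ := by rw [abs_mul, abs_of_pos h5]; gcongr
  rw [← hZ] at this
  rw [Real.dist_eq, div_sub' (hZ0 n).ne', abs_div, abs_of_pos (hZ0 n), div_lt_iff₀ (hZ0 n)]
  rw [mul_comm (Z n)]
  refine this.trans_lt ?_
  have := hZ0 n
  nlinarith

lemma abs_sphereInt_le {Ψ : Vec → ℝ} {C r : ℝ} (h : ∀ n : Metric.sphere (0 : Vec) 1, |Ψ (r • (n : Vec))| ≤ C) :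
    |sphereInt Ψ r| ≤ C * (4 * Real.pi) := by
  rw [← sphereMeasure_univ]
  exact norm_integral_le_of_norm_le_const (f := fun n : Metric.sphere (0 : Vec) 1 => Ψ (r • (n : Vec)))
    (ae_of_all _ h)

lemma abs_incrZero_le {u : L2} (hu : MemLp u 3 torusMeasure) (h : Vec) :
    |incrZero u h| ≤ 8 * ‖h‖ * ∫ x, ‖u x‖ ^ 3 ∂torusMeasure := by
  have h1 := integrable_norm_cube (memLp_increment hu h)
  calc |incrZero u h| ≤ ∫ x, ‖h‖ * ‖increment u h x‖ ^ 3 ∂torusMeasure := by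
        rw [← Real.norm_eq_abs]
        refine norm_integral_le_of_norm_le (h1.const_mul _) (ae_of_all _ fun x => ?_)
        rw [norm_mul, Real.norm_of_nonneg (sq_nonneg _)]
        calc _ ≤ ‖increment u h x‖ ^ 2 * (‖increment u h x‖ * ‖h‖) := by
              gcongr; exact norm_inner_le_norm _ _
          _ = _ := by ring
    _ ≤ _ := by
        rw [integral_const_mul]
        have := mul_le_mul_of_nonneg_left (integral_increment_cube_le hu h) (norm_nonneg h)
        linarith

lemma abs_incrPar_le {u : L2} (hu : MemLp u 3 torusMeasure) (h : Vec) :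
    |incrPar u h| ≤ 8 * ‖h‖ ^ 3 * ∫ x, ‖u x‖ ^ 3 ∂torusMeasure := by
  have h1 := integrable_norm_cube (memLp_increment hu h)
  calc |incrPar u h| ≤ ∫ x, ‖h‖ ^ 3 * ‖increment u h x‖ ^ 3 ∂torusMeasure := by
        rw [← Real.norm_eq_abs]
        refine norm_integral_le_of_norm_le (h1.const_mul _) (ae_of_all _ fun x => ?_)
        rw [norm_pow, ← mul_pow, mul_comm ‖h‖]
        gcongr; exact norm_inner_le_norm _ _
    _ ≤ _ := by
        rw [integral_const_mul]
        have := mul_le_mul_of_nonneg_left (integral_increment_cube_le hu h) (by positivity : 0 ≤ ‖h‖ ^ 3)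
        linarith

/-- Profiles of kernels whose energy flux approximates the structure function `S` at scale `ℓ`. -/
structure IsStructureProfile (S : L2 → ℝ → ℝ) (c ℓ : ℝ) (a : ℕ → ℝ → ℝ) : Prop where
  smooth : ∀ n, ContDiff ℝ (⊤ : ℕ∞) (a n)
  nonneg : ∀ n s, 0 ≤ a n s
  deriv_nonpos : ∀ n s, deriv (a n) s ≤ 0
  eq_zero : ∀ n s, 4 * ℓ ^ 2 < s → a n s = 0
  mass_pos : ∀ n, 0 < ∫ h, radial (a n) h
  line_le : ∀ n, 8 * Real.pi * ∫ r in Ioi (0 : ℝ), a n (r ^ 2) ≤ 10 / ℓ ^ 2 * ∫ h, radial (a n) h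
  flux_le : ∀ u : L2, MemLp u 3 torusMeasure → WeaklyDivFree u → ∀ n,
    |convection u (conv (radial (a n)) u) / ∫ h, radial (a n) h|
      ≤ 10 / ℓ * ∫ x, ‖u x‖ ^ 3 ∂torusMeasure
  flux_tendsto : ∀ u : L2, MemLp u 3 torusMeasure → WeaklyDivFree u →
    Tendsto (fun n => convection u (conv (radial (a n)) u) / ∫ h, radial (a n) h) atTop
      (𝓝 (c * (S u ℓ / ℓ)))

lemma norm_smul_sphere {r : ℝ} (hr : 0 < r) (n : Metric.sphere (0 : Vec) 1) : ‖r • (n : Vec)‖ = r := by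
  rw [norm_smul, Real.norm_of_nonneg hr.le]; simp

/-- With `a' = -β`, the kernel tends up to a factor to the indicator of the ball of radius `ℓ`. Flux
and mass become integrals against the same bump, and the constant is `(1/2 · 4πℓ) / (8πℓ²/3) = (3/4)
/ ℓ`. -/
theorem exists_structureProfile_zero {ℓ : ℝ} (hℓ : 0 < ℓ) :
    ∃ a, IsStructureProfile Szero (3 / 4) ℓ a := by
  obtain ⟨β, hβ, hβt⟩ := exists_bumps hℓ
  choose a ha had ha0 hap using fun n =>
    exists_antiderivative (hβ n).smooth (hβ n).right (hβ n).nonneg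
  have hd : ∀ n, deriv (a n) = fun s => -β n s := fun n => funext fun s => (had n s).deriv
  have hZ' : ∀ n, ∫ h, radial (a n) h = 8 * Real.pi / 3 * ∫ r in Ioi (0 : ℝ), r ^ 4 * β n (r ^ 2) := by
    intro n
    rw [integral_radial_profile (ha n).continuous (ha0 n), integral_pow_mul_profile (ha n) (ha0 n), hd]
    simp only [neg_neg]
    push_cast; ring
  have hZ : ∀ n, ∫ h, radial (a n) h
      = ∫ r in Ioi (0 : ℝ), r ^ 2 * (β n (r ^ 2) * (8 * Real.pi / 3 * r ^ 2)) := by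
    intro n
    rw [hZ', ← integral_const_mul]; congr 1; ext r; ring
  have hZ0 : ∀ n, 0 < ∫ h, radial (a n) h := fun n => by
    rw [hZ']; have := (hβ n).moment_pos 4; positivity
  have hflux : ∀ u : L2, MemLp u 3 torusMeasure → WeaklyDivFree u → ∀ n,
      convection u (conv (radial (a n)) u)
        = ∫ r in Ioi (0 : ℝ), r ^ 2 * (β n (r ^ 2) * (1 / 2 * sphereInt (incrZero u) r)) := by
    intro u hu hdiv n
    rw [convection_radial_eq_incrZero (ha n) (ha0 n) hu hdiv,
      integral_radial_mul (contDiff_deriv (ha n)).continuous (deriv_eq_zero_of_gt (ha0 n))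
        (continuous_incrZero hu), hd, ← integral_const_mul]
    congr 1; ext r; ring
  have hzc : Continuous fun r : ℝ => 8 * Real.pi / 3 * r ^ 2 := by fun_prop
  refine ⟨a, ha, hap, fun n s => ?_, ha0, hZ0, fun n => ?_, fun u hu hdiv n => ?_, fun u hu hdiv => ?_⟩
  · rw [hd]; exact neg_nonpos.2 ((hβ n).nonneg s)
  · have h1 := integral_pow_mul_profile (ha n) (ha0 n) 0
    have h2 := (hβ n).moment_le 2
    simp only [pow_zero, one_mul, hd, neg_neg, Nat.cast_zero, zero_add, div_one] at h1
    rw [h1, hZ', div_mul_eq_mul_div (10 : ℝ), le_div_iff₀ (pow_pos hℓ 2)]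
    have h3 := mul_le_mul_of_nonneg_left h2 Real.pi_pos.le
    have h4 := mul_pos Real.pi_pos ((hβ n).moment_pos 4)
    norm_num at h3 ⊢
    nlinarith
  · rw [abs_div, abs_of_pos (hZ0 n), div_le_iff₀ (hZ0 n), hflux u hu hdiv, hZ n]
    have := (hβ n).abs_integral_sub_le hℓ (N := fun r => 1 / 2 * sphereInt (incrZero u) r)
      ((continuous_sphereInt (continuous_incrZero hu)).const_mul _) hzc (c := 0) (b := 2 * ℓ)
      (δ := 10 / ℓ * ∫ x, ‖u x‖ ^ 3 ∂torusMeasure)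
      (fun s hs => (hβ n).right s (by nlinarith)) (by positivity) fun r h1 h2 => ?_
    · simpa using this
    have hr := hℓ.trans h1
    have h3 := abs_sphereInt_le (Ψ := incrZero u) (r := r) fun m => by
      simpa only [norm_smul_sphere hr] using abs_incrZero_le hu (r • (m : Vec))
    have hI : 0 ≤ ∫ x, ‖u x‖ ^ 3 ∂torusMeasure := by positivity
    rw [zero_mul, sub_zero, abs_mul]
    set I := ∫ x, ‖u x‖ ^ 3 ∂torusMeasure
    have h4 : r ≤ r ^ 2 / ℓ := by rw [le_div_iff₀ hℓ]; nlinarith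
    calc _ ≤ |1 / 2| * (8 * r * I * (4 * Real.pi)) := by gcongr
      _ ≤ (16 * Real.pi * I) * r := by norm_num; apply le_of_eq; ring
      _ ≤ (16 * Real.pi * I) * (r ^ 2 / ℓ) := by gcongr
      _ ≤ (80 / 3 * Real.pi * I) * (r ^ 2 / ℓ) := by gcongr; norm_num
      _ = _ := by ring
  · have := tendsto_bump_ratio hℓ hβ hβt (N := fun r => 1 / 2 * sphereInt (incrZero u) r)
      ((continuous_sphereInt (continuous_incrZero hu)).const_mul _) hzc
      (fun r hr => by positivity) hZ hZ0
    simp only [hflux u hu hdiv]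
    convert this using 2
    rw [Szero_eq u hℓ]
    have := Real.pi_pos.ne'
    field_simp
    ring

/-- With `a'' = β`, the kernel tends up to a factor to `(ℓ² - |h|²)₊`, and the constant is `(1/3 ·
4πℓ³) / (16πℓ⁴/15) = (5/4) / ℓ`. The 10 in `line_le` is dictated by this profile: `8π · 4/3` equals
`10 · 16π/15`, leaving only the comparison of the fourth and sixth moments. -/
theorem exists_structureProfile_par {ℓ : ℝ} (hℓ : 0 < ℓ) :
    ∃ a, IsStructureProfile Spar (5 / 4) ℓ a := by
  obtain ⟨β, hβ, hβt⟩ := exists_bumps hℓ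
  choose b hb hbd hb0 hbp using fun n =>
    exists_antiderivative (hβ n).smooth (hβ n).right (hβ n).nonneg
  choose a ha had ha0 hap using fun n => exists_antiderivative (hb n) (hb0 n) (hbp n)
  have hd' : ∀ n, deriv (b n) = fun s => -β n s := fun n => funext fun s => (hbd n s).deriv
  have hd : ∀ n, deriv (a n) = fun s => -b n s := fun n => funext fun s => (had n s).deriv
  have hdd : ∀ n, deriv (deriv (a n)) = β n := fun n => by
    rw [hd]; ext s; rw [deriv.fun_neg, hd']; simp
  have hZ' : ∀ n, ∫ h, radial (a n) h = 16 * Real.pi / 15 * ∫ r in Ioi (0 : ℝ), r ^ 6 * β n (r ^ 2) := by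
    intro n
    rw [integral_radial_profile (ha n).continuous (ha0 n), integral_pow_mul_profile (ha n) (ha0 n), hd]
    simp only [neg_neg]
    rw [integral_pow_mul_profile (hb n) (hb0 n), hd']
    simp only [neg_neg]
    push_cast; ring
  have hZ : ∀ n, ∫ h, radial (a n) h
      = ∫ r in Ioi (0 : ℝ), r ^ 2 * (β n (r ^ 2) * (16 * Real.pi / 15 * r ^ 4)) := by
    intro n
    rw [hZ', ← integral_const_mul]; congr 1; ext r; ring
  have hZ0 : ∀ n, 0 < ∫ h, radial (a n) h := fun n => by
    rw [hZ']; have := (hβ n).moment_pos 6; positivity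
  have hflux : ∀ u : L2, MemLp u 3 torusMeasure → WeaklyDivFree u → ∀ n,
      convection u (conv (radial (a n)) u)
        = ∫ r in Ioi (0 : ℝ), r ^ 2 * (β n (r ^ 2) * (1 / 3 * sphereInt (incrPar u) r)) := by
    intro u hu hdiv n
    rw [convection_radial_eq_incrPar (ha n) (ha0 n) hu hdiv, hdd,
      integral_radial_mul (hβ n).smooth.continuous (hβ n).right
        (continuous_incrPar hu), ← integral_const_mul]
    congr 1; ext r; ring
  have hzc : Continuous fun r : ℝ => 16 * Real.pi / 15 * r ^ 4 := by fun_prop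
  refine ⟨a, ha, hap, fun n s => ?_, ha0, hZ0, fun n => ?_, fun u hu hdiv n => ?_, fun u hu hdiv => ?_⟩
  · rw [hd]; exact neg_nonpos.2 (hbp n s)
  · have h1 := integral_pow_mul_profile (ha n) (ha0 n) 0
    have h1' := integral_pow_mul_profile (hb n) (hb0 n) 2
    have h2 := (hβ n).moment_le 4
    simp only [pow_zero, one_mul, hd, neg_neg, zero_add, Nat.cast_zero, div_one] at h1
    simp only [hd', neg_neg] at h1'
    rw [h1, h1', hZ', div_mul_eq_mul_div (10 : ℝ), le_div_iff₀ (pow_pos hℓ 2)]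
    have h3 := mul_le_mul_of_nonneg_left h2 Real.pi_pos.le
    norm_num at h3 ⊢
    nlinarith
  · rw [abs_div, abs_of_pos (hZ0 n), div_le_iff₀ (hZ0 n), hflux u hu hdiv, hZ n]
    have := (hβ n).abs_integral_sub_le hℓ (N := fun r => 1 / 3 * sphereInt (incrPar u) r)
      ((continuous_sphereInt (continuous_incrPar hu)).const_mul _) hzc (c := 0) (b := 2 * ℓ)
      (δ := 10 / ℓ * ∫ x, ‖u x‖ ^ 3 ∂torusMeasure)
      (fun s hs => (hβ n).right s (by nlinarith)) (by positivity) fun r h1 h2 => ?_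
    · simpa using this
    have hr := hℓ.trans h1
    have h3 := abs_sphereInt_le (Ψ := incrPar u) (r := r) fun m => by
      simpa only [norm_smul_sphere hr] using abs_incrPar_le hu (r • (m : Vec))
    have hI : 0 ≤ ∫ x, ‖u x‖ ^ 3 ∂torusMeasure := by positivity
    rw [zero_mul, sub_zero, abs_mul]
    set I := ∫ x, ‖u x‖ ^ 3 ∂torusMeasure
    have h4 : r ^ 3 ≤ r ^ 4 / ℓ := by
      rw [le_div_iff₀ hℓ, pow_succ r 3]; gcongr
    calc _ ≤ |1 / 3| * (8 * r ^ 3 * I * (4 * Real.pi)) := by gcongr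
      _ ≤ (32 / 3 * Real.pi * I) * r ^ 3 := by norm_num; apply le_of_eq; ring
      _ ≤ (32 / 3 * Real.pi * I) * (r ^ 4 / ℓ) := by gcongr
      _ = _ := by ring
  · have := tendsto_bump_ratio hℓ hβ hβt (N := fun r => 1 / 3 * sphereInt (incrPar u) r)
      ((continuous_sphereInt (continuous_incrPar hu)).const_mul _) hzc
      (fun r hr => by positivity) hZ hZ0
    simp only [hflux u hu hdiv]
    convert this using 2
    rw [Spar_eq u hℓ]
    have := Real.pi_pos.ne'
    field_simp
    ring

end StructureProfile

/-! ### Fourier representation of correlations and regularizations -/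

section Fourier

open scoped ComplexConjugate

open UnitAddTorus in
lemma hasSum_conj_mFourierCoeff_mul {f g : Torus → ℂ} (hf : MemLp f 2 torusMeasure)
    (hg : MemLp g 2 torusMeasure) :
    HasSum (fun k => conj (mFourierCoeff f k) * mFourierCoeff g k)
      (∫ x, conj (f x) * g x ∂torusMeasure) := by
  have hc : ∀ {f : Torus → ℂ} (hf : MemLp f 2 torusMeasure) (k),
      mFourierCoeff (hf.toLp f) k = mFourierCoeff f k := fun {f} hf k => by
    refine integral_congr_ae (μ := torusMeasure) ?_
    filter_upwards [hf.coeFn_toLp] with x hx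
    rw [hx]
  have h := hasSum_prod_mFourierCoeff (d := Fin 3) (hf.toLp f) (hg.toLp g)
  simp only [hc] at h
  convert! h using 1
  refine integral_congr_ae (μ := torusMeasure) ?_
  filter_upwards [hf.coeFn_toLp, hg.coeFn_toLp] with x h1 h2
  rw [h1, h2]

/-- The wave vector `2πk`. -/
def waveVec (k : Fin 3 → ℤ) : Vec := WithLp.toLp 2 fun j => 2 * Real.pi * k j

lemma norm_waveVec_sq (k : Fin 3 → ℤ) : ‖waveVec k‖ ^ 2 = (2 * Real.pi) ^ 2 * freqSq k := by
  simp [waveVec, EuclideanSpace.norm_sq_eq, freqSq, Finset.mul_sum, mul_pow]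

open UnitAddTorus in
lemma mFourier_proj (k : Fin 3 → ℤ) (h : Vec) :
    mFourier k (proj h) = Complex.exp ((inner ℝ (waveVec k) h : ℝ) * Complex.I) := by
  simp only [mFourier, proj, ContinuousMap.coe_mk, fourier_coe_apply, ← Complex.exp_sum]
  congr 1
  simp [waveVec, PiLp.inner_apply, Finset.sum_mul]
  congr 1; ext j; ring

open UnitAddTorus in
lemma mFourier_add_apply (k : Fin 3 → ℤ) (x y : Torus) :
    mFourier k (x + y) = mFourier k x * mFourier k y := by
  simp [mFourier, Finset.prod_mul_distrib, smul_add, AddCircle.toCircle_add]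

open UnitAddTorus in
lemma mFourierCoeff_translate (g : Torus → ℂ) (k : Fin 3 → ℤ) (y : Torus) :
    mFourierCoeff (fun x => g (x + y)) k = mFourier k y * mFourierCoeff g k := by
  have h := (measurePreserving_add_right torusMeasure y).integral_comp
    (MeasurableEquiv.addRight y).measurableEmbedding (fun x => mFourier (-k) x • g x)
  have e1 : mFourierCoeff g k = ∫ x, mFourier (-k) x • g x ∂torusMeasure := rfl
  have e2 : mFourierCoeff (fun x => g (x + y)) k
      = ∫ x, mFourier (-k) x • g (x + y) ∂torusMeasure := rfl
  rw [e1, e2, ← h, ← integral_const_mul]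
  congr 1; ext x
  have h1 : mFourier k y * mFourier (-k) y = 1 := by
    rw [← mFourier_add, add_neg_cancel, mFourier_zero]; rfl
  rw [mFourier_add_apply, smul_eq_mul, smul_eq_mul]
  linear_combination (-mFourier (-k) x * g (x + y)) * h1

lemma memLp_coord_complex {u : Torus → Vec} (hu : MemLp u 2 torusMeasure) (j : Fin 3) :
    MemLp (fun x => ((u x j : ℝ) : ℂ)) 2 torusMeasure :=
  (memLp_coord hu j).ofReal

lemma fourierSq_nonneg (u : L2) (k : Fin 3 → ℤ) : 0 ≤ fourierSq u k :=
  Finset.sum_nonneg fun _ _ => sq_nonneg _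

/-- Parseval for `u` and its translate, whose coefficients differ by the phase `exp(i ξ · h)`; the
correlation is real, so only the cosine remains. -/
theorem hasSum_corr (u : L2) (h : Vec) :
    HasSum (fun k => Real.cos (inner ℝ (waveVec k) h) * fourierSq u k) (corr u u h) := by
  have hmt : MemLp (fun x => u (x + proj h)) 2 torusMeasure :=
    (Lp.memLp u).comp_measurePreserving (measurePreserving_add_right torusMeasure (proj h))
  have key : ∀ j, HasSum (fun k => Real.cos (inner ℝ (waveVec k) h) *
      ‖UnitAddTorus.mFourierCoeff (fun x : Torus => ((u x j : ℝ) : ℂ)) k‖ ^ 2)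
      (∫ x, u x j * u (x + proj h) j ∂torusMeasure) := fun j => by
    have h1 := Complex.reCLM.hasSum (hasSum_conj_mFourierCoeff_mul (memLp_coord_complex (Lp.memLp u) j)
      (memLp_coord_complex hmt j))
    convert! h1 using 1
    · ext k
      rw [mFourierCoeff_translate (fun x => ((u x j : ℝ) : ℂ)), mFourier_proj,
        mul_left_comm, Complex.conj_mul', ← Complex.ofReal_pow, Complex.reCLM_apply,
        Complex.re_mul_ofReal, Complex.exp_ofReal_mul_I_re]
    · rw [show (fun x => conj ((u x j : ℝ) : ℂ) * ((u (x + proj h) j : ℝ) : ℂ))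
        = fun x => ((u x j * u (x + proj h) j : ℝ) : ℂ) by ext x; simp, integral_complex_ofReal]
      simp
  have h2 := hasSum_sum fun j (_ : j ∈ Finset.univ) => key j
  convert! h2 using 1
  · ext k; rw [fourierSq, Finset.mul_sum]
  · have hi : ∀ j ∈ Finset.univ, Integrable (fun x => u x j * u (x + proj h) j) torusMeasure :=
      fun j _ => (memLp_coord (Lp.memLp u) j).integrable_mul (memLp_coord hmt j)
    rw [← integral_finsetSum _ hi]
    unfold corr
    congr 1; ext x
    simp [PiLp.inner_apply, mul_comm]

lemma corr_zero (u : L2) : corr u u 0 = ‖u‖ ^ 2 := by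
  rw [← real_inner_self_eq_norm_sq, L2.inner_def]
  simp [corr]

theorem hasSum_fourierSq (u : L2) : HasSum (fourierSq u) (‖u‖ ^ 2) := by
  simpa [corr_zero] using hasSum_corr u 0

section Kernel
variable {κ : Vec → ℝ} (hk : ContDiff ℝ (⊤ : ℕ∞) κ) (hc : HasCompactSupport κ)
include hk hc

lemma integrable_kernel_mul_cos (ξ : Vec) : Integrable fun h => κ h * Real.cos (inner ℝ ξ h) := by
  have := hk.continuous
  exact Continuous.integrable_of_hasCompactSupport (by fun_prop) hc.mul_right

/-- The Fourier representation of the quadratic form of a regularization. -/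
theorem hasSum_inner_convL (u : L2) :
    HasSum (fun k => (∫ h, κ h * Real.cos (inner ℝ (waveVec k) h)) * fourierSq u k)
      (inner ℝ u (convL κ hk hc u)) := by
  rw [inner_convL]
  have hi : Integrable κ := hk.continuous.integrable_of_hasCompactSupport hc
  have h1 := hasSum_integral_of_summable_integral_norm (μ := (volume : Measure Vec))
    (F := fun k h => κ h * (Real.cos (inner ℝ (waveVec k) h) * fourierSq u k))
    (fun k => by simpa only [mul_assoc] using (integrable_kernel_mul_cos hk hc (waveVec k)).mul_const _) ?_
  · convert! h1 using 1
    · ext k; rw [← integral_mul_const]; simp only [mul_assoc]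
    · congr 1; ext h
      rw [tsum_mul_left, (hasSum_corr u h).tsum_eq]
  · refine Summable.of_nonneg_of_le (fun k => integral_nonneg fun h => norm_nonneg _) (fun k => ?_)
      ((hasSum_fourierSq u).summable.mul_left (∫ h, ‖κ h‖))
    rw [← integral_mul_const]
    refine integral_mono_of_nonneg (ae_of_all _ fun h => norm_nonneg _) (hi.norm.mul_const _)
      (ae_of_all _ fun h => ?_)
    have := fourierSq_nonneg u k
    simp only [norm_mul, Real.norm_of_nonneg this]
    have h1 := Real.abs_cos_le_one (inner ℝ (waveVec k) h)
    gcongr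
    exact mul_le_of_le_one_left this h1

lemma integral_kderiv_mul {g : Vec → ℝ} (hg : Differentiable ℝ g) (hgc : Continuous g) (j : Fin 3)
    (hg' : Continuous fun h => fderiv ℝ g h (EuclideanSpace.single j 1)) :
    ∫ h, kderiv j κ h * g h = -∫ h, κ h * fderiv ℝ g h (EuclideanSpace.single j 1) := by
  have h1 := hk.continuous
  have h2 := (contDiff_kderiv hk j).continuous
  have h3 := hasCompactSupport_kderiv hc j
  have := integral_mul_fderiv_eq_neg_fderiv_mul_of_integrable (μ := (volume : Measure Vec)) (f := κ) (g := g)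
    (v := EuclideanSpace.single j 1)
    (Continuous.integrable_of_hasCompactSupport (h2.mul hgc) h3.mul_right)
    (Continuous.integrable_of_hasCompactSupport (h1.mul hg') hc.mul_right)
    (Continuous.integrable_of_hasCompactSupport (h1.mul hgc) hc.mul_right)
    (fun x _ => hk.differentiable (by simp) x) fun x _ => hg x
  rw [this, neg_neg]; rfl

/-- Two integrations by parts in each coordinate: the Laplacian of the kernel has multiplier `-|ξ|²`
times that of the kernel. -/
lemma integral_laplacian_mul_cos (ξ : Vec) :
    ∫ h, (∑ j, kderiv j (kderiv j κ) h) * Real.cos (inner ℝ ξ h)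
      = -(‖ξ‖ ^ 2 * ∫ h, κ h * Real.cos (inner ℝ ξ h)) := by
  have hin : ∀ h, HasFDerivAt (fun h : Vec => (inner ℝ ξ h : ℝ)) (innerSL ℝ ξ) h := fun h =>
    (innerSL ℝ ξ).hasFDerivAt
  have hcos : ∀ h, HasFDerivAt (fun h : Vec => Real.cos (inner ℝ ξ h))
      (-Real.sin (inner ℝ ξ h) • innerSL ℝ ξ) h := fun h => (hin h).cos
  have hsin : ∀ h, HasFDerivAt (fun h : Vec => Real.sin (inner ℝ ξ h))
      (Real.cos (inner ℝ ξ h) • innerSL ℝ ξ) h := fun h => (hin h).sin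
  have hs : ∀ j, innerSL ℝ ξ (EuclideanSpace.single j 1) = ξ j := fun j => by
    simp [EuclideanSpace.inner_single_right]
  have e : ∀ j, ∫ h, kderiv j (kderiv j κ) h * Real.cos (inner ℝ ξ h)
      = -(ξ j ^ 2 * ∫ h, κ h * Real.cos (inner ℝ ξ h)) := fun j => by
    rw [integral_kderiv_mul (contDiff_kderiv hk j) (hasCompactSupport_kderiv hc j)
      (fun h => (hcos h).differentiableAt) (by fun_prop) j]
    · simp only [fun h => (hcos h).fderiv, _root_.smul_apply, hs, smul_eq_mul]
      have : ∫ h, kderiv j κ h * (-Real.sin (inner ℝ ξ h) * ξ j)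
          = -ξ j * ∫ h, kderiv j κ h * Real.sin (inner ℝ ξ h) := by
        rw [← integral_const_mul]; congr 1; ext h; ring
      rw [this, integral_kderiv_mul hk hc (fun h => (hsin h).differentiableAt) (by fun_prop) j]
      · simp only [fun h => (hsin h).fderiv, _root_.smul_apply, hs, smul_eq_mul]
        rw [← integral_neg, ← integral_const_mul, ← integral_neg, ← integral_const_mul, ← integral_neg]
        congr 1; ext h; ring
      · simp only [fun h => (hsin h).fderiv, _root_.smul_apply, hs, smul_eq_mul]
        fun_prop
    · simp only [fun h => (hcos h).fderiv, _root_.smul_apply, hs, smul_eq_mul]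
      fun_prop
  simp only [Finset.sum_mul]
  rw [integral_finsetSum _ fun j _ => integrable_kernel_mul_cos
    (contDiff_kderiv (contDiff_kderiv hk j) j)
    (hasCompactSupport_kderiv (hasCompactSupport_kderiv hc j) j) ξ]
  simp only [e, Finset.sum_neg_distrib, ← Finset.sum_mul, EuclideanSpace.norm_sq_eq, Real.norm_eq_abs,
    sq_abs]

end Kernel

end Fourier

/-! ### Roughness at scale `ℓ` and the mollification errors -/

section Roughness

/-- The Fourier multiplier measuring the oscillation at scale `ℓ`. -/
def roughSymbol (ℓ : ℝ) (k : Fin 3 → ℤ) : ℝ := min 4 ((2 * ℓ * ‖waveVec k‖) ^ 2)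

/-- An upper bound for the increments `‖u(· + h) - u‖²` with `|h| ≤ 2ℓ`. -/
def rough (u : L2) (ℓ : ℝ) : ℝ := ∑' k, roughSymbol ℓ k * fourierSq u k

lemma roughSymbol_nonneg (ℓ : ℝ) (k : Fin 3 → ℤ) : 0 ≤ roughSymbol ℓ k :=
  le_min (by norm_num) (sq_nonneg _)

lemma roughSymbol_le (ℓ : ℝ) (k : Fin 3 → ℤ) : roughSymbol ℓ k ≤ 4 := min_le_left _ _

lemma roughSymbol_mul_nonneg (u : L2) (ℓ : ℝ) (k : Fin 3 → ℤ) : 0 ≤ roughSymbol ℓ k * fourierSq u k :=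
  mul_nonneg (roughSymbol_nonneg ℓ k) (fourierSq_nonneg u k)

lemma roughSymbol_mul_le (u : L2) (ℓ : ℝ) (k : Fin 3 → ℤ) :
    roughSymbol ℓ k * fourierSq u k ≤ 4 * fourierSq u k :=
  mul_le_mul_of_nonneg_right (roughSymbol_le ℓ k) (fourierSq_nonneg u k)

lemma summable_rough (u : L2) (ℓ : ℝ) : Summable fun k => roughSymbol ℓ k * fourierSq u k :=
  Summable.of_nonneg_of_le (roughSymbol_mul_nonneg u ℓ) (roughSymbol_mul_le u ℓ)
    ((hasSum_fourierSq u).summable.mul_left 4)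

lemma rough_nonneg (u : L2) (ℓ : ℝ) : 0 ≤ rough u ℓ := tsum_nonneg (roughSymbol_mul_nonneg u ℓ)

lemma rough_le (u : L2) (ℓ : ℝ) : rough u ℓ ≤ 4 * ‖u‖ ^ 2 := by
  rw [← (hasSum_fourierSq u).tsum_eq, ← tsum_mul_left]
  exact (summable_rough u ℓ).tsum_le_tsum (roughSymbol_mul_le u ℓ)
    ((hasSum_fourierSq u).summable.mul_left 4)

/-- Dominated convergence over frequencies, with no rate. This is all that is available for the
initial datum, which is merely in `L²`, and it suffices because the datum does not vary with `ν`. -/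
lemma tendsto_rough (u : L2) : Tendsto (rough u) (𝓝[>] 0) (𝓝 0) := by
  have : Tendsto (rough u) (𝓝[>] 0) (𝓝 (∑' _ : Fin 3 → ℤ, (0 : ℝ))) := by
    refine tendsto_tsum_of_dominated_convergence ((hasSum_fourierSq u).summable.mul_left 4)
      (fun k => ?_) (Eventually.of_forall fun ℓ k => ?_)
    · have h : Continuous fun ℓ => roughSymbol ℓ k * fourierSq u k := by
        unfold roughSymbol; fun_prop
      simpa [roughSymbol] using (h.tendsto 0).mono_left nhdsWithin_le_nhds
    · rw [Real.norm_of_nonneg (roughSymbol_mul_nonneg u ℓ k)]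
      exact roughSymbol_mul_le u ℓ k
  simpa using this

/-- Frequency by frequency, `1 - cos` is bounded both by 2 and by half the square of its argument.
The quadratic form thus loses a full power of `rough`, whereas a general pairing as in
`abs_inner_sub_corr_le` loses its square root by Cauchy–Schwarz. -/
lemma norm_sq_sub_corr_nonneg_le (u : L2) {ℓ : ℝ} {h : Vec} (hh : ‖h‖ ≤ 2 * ℓ) :
    0 ≤ ‖u‖ ^ 2 - corr u u h ∧ ‖u‖ ^ 2 - corr u u h ≤ 1 / 2 * rough u ℓ := by
  have h1 := (hasSum_fourierSq u).sub (hasSum_corr u h)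
  refine ⟨h1.nonneg fun k => ?_, hasSum_le (fun k => ?_) h1 ((summable_rough u ℓ).hasSum.mul_left _)⟩
  · have := Real.cos_le_one (inner ℝ (waveVec k) h)
    nlinarith [fourierSq_nonneg u k]
  · have h2 : 1 - Real.cos (inner ℝ (waveVec k) h) ≤ 1 / 2 * roughSymbol ℓ k := by
      rw [roughSymbol, mul_min_of_nonneg _ _ (by norm_num : (0 : ℝ) ≤ 1 / 2)]
      refine le_min (by linarith [Real.neg_one_le_cos (inner ℝ (waveVec k) h)]) ?_
      have h3 := Real.one_sub_sq_div_two_le_cos (x := inner ℝ (waveVec k) h)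
      have h4 : (inner ℝ (waveVec k) h) ^ 2 ≤ (2 * ℓ * ‖waveVec k‖) ^ 2 := by
        rw [← sq_abs]
        gcongr
        refine (abs_real_inner_le_norm _ _).trans ?_
        rw [mul_comm]
        gcongr
      linarith
    nlinarith [mul_le_mul_of_nonneg_right h2 (fourierSq_nonneg u k)]

/-- Translation on `L²`. -/
def translate (h : Vec) (u : L2) : L2 :=
  ((Lp.memLp u).comp_measurePreserving (measurePreserving_add_right torusMeasure (proj h))).toLp _

lemma coeFn_translate (h : Vec) (u : L2) :
    translate h u =ᵐ[torusMeasure] fun x => u (x + proj h) :=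
  MemLp.coeFn_toLp _

lemma inner_translate (w u : L2) (h : Vec) : inner ℝ w (translate h u) = corr w u h := by
  rw [L2.inner_def]
  refine integral_congr_ae ?_
  filter_upwards [coeFn_translate h u] with x hx
  rw [hx]

lemma norm_translate (u : L2) (h : Vec) : ‖translate h u‖ = ‖u‖ := by
  rw [Lp.norm_def, Lp.norm_def, eLpNorm_congr_ae (coeFn_translate h u)]
  congr 1
  exact eLpNorm_comp_measurePreserving (Lp.aestronglyMeasurable u)
    (measurePreserving_add_right torusMeasure (proj h))

lemma abs_inner_sub_corr_le (w u : L2) {ℓ : ℝ} {h : Vec} (hh : ‖h‖ ≤ 2 * ℓ) :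
    |inner ℝ w u - corr w u h| ≤ ‖w‖ * √(rough u ℓ) := by
  have h1 : ‖u - translate h u‖ ^ 2 ≤ rough u ℓ := by
    rw [norm_sub_sq_real, norm_translate, inner_translate]
    linarith [(norm_sq_sub_corr_nonneg_le u hh).2]
  rw [← inner_translate, ← inner_sub_right]
  refine (abs_real_inner_le_norm _ _).trans ?_
  gcongr
  exact Real.le_sqrt_of_sq_le h1

section Mollify
variable {a : ℝ → ℝ} {ℓ : ℝ} (ha : ContDiff ℝ (⊤ : ℕ∞) a) (h0 : ∀ s, 4 * ℓ ^ 2 < s → a s = 0)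
  (hpos : ∀ s, 0 ≤ a s)
include hpos

/-- The difference is an average of `⟨w, u⟩ - corr w u h` against a nonnegative kernel supported in
`|h| ≤ 2ℓ`, so a bound at each such separation passes to the average. -/
lemma abs_mass_mul_sub_inner_convL_le (hℓ : 0 ≤ ℓ) {c : ℝ} (w u : L2)
    (hb : ∀ h : Vec, ‖h‖ ≤ 2 * ℓ → |inner ℝ w u - corr w u h| ≤ c) :
    |(∫ h, radial a h) * inner ℝ w u
      - inner ℝ w (convL (radial a) (contDiff_radial ha) (hasCompactSupport_radial h0) u)|
      ≤ (∫ h, radial a h) * c := by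
  have hi : Integrable (radial a) :=
    (contDiff_radial ha).continuous.integrable_of_hasCompactSupport (hasCompactSupport_radial h0)
  have h2 := (integrable_kernel_inner hi (Lp.memLp u) (Lp.memLp w)).integral_prod_right
  have h3 : Integrable fun h => radial a h * corr w u h := by
    simpa only [integral_const_mul] using! h2
  rw [inner_convL, ← integral_mul_const, ← integral_mul_const, ← integral_sub (hi.mul_const _) h3,
    ← Real.norm_eq_abs]
  refine norm_integral_le_of_norm_le (hi.mul_const c) (ae_of_all _ fun h => ?_)
  rw [← mul_sub, norm_mul, Real.norm_of_nonneg (by exact hpos _)]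
  rcases le_or_gt ‖h‖ (2 * ℓ) with hh | hh
  · exact mul_le_mul_of_nonneg_left (hb h hh) (hpos _)
  · have : radial a h = 0 := h0 _ (by nlinarith)
    simp [this]

/-- The multiplier is bounded by `|ξ|² Z` at low frequencies and, by Fourier decay and `hline`, by
`10 Z / ℓ²` at high ones. Both are below `(10 Z / ℓ²)` times `roughSymbol`, so viscosity is
controlled without the `H¹` norm. -/
lemma abs_inner_laplacian_le (hanti : ∀ s, deriv a s ≤ 0) (hℓ : 0 < ℓ)
    (hline : 8 * Real.pi * ∫ r in Ioi (0 : ℝ), a (r ^ 2) ≤ 10 / ℓ ^ 2 * ∫ h, radial a h) (u : L2) :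
    |inner ℝ u (convL _ (contDiff_laplacian_kernel (contDiff_radial ha))
      (hasCompactSupport_laplacian_kernel (hasCompactSupport_radial h0)) u)|
      ≤ (∫ h, radial a h) * (10 / ℓ ^ 2 * rough u ℓ) := by
  have hi : Integrable (radial a) :=
    (contDiff_radial ha).continuous.integrable_of_hasCompactSupport (hasCompactSupport_radial h0)
  set Z := ∫ h, radial a h
  have hZ : 0 ≤ Z := integral_nonneg fun h => hpos _
  have hs := hasSum_inner_convL (contDiff_laplacian_kernel (contDiff_radial ha))
    (hasCompactSupport_laplacian_kernel (hasCompactSupport_radial h0)) u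
  have hr := ((summable_rough u ℓ).hasSum.mul_left (10 / ℓ ^ 2)).mul_left Z
  rw [← hs.tsum_eq, ← Real.norm_eq_abs]
  refine tsum_of_norm_bounded hr fun k => ?_
  rw [norm_mul, Real.norm_of_nonneg (fourierSq_nonneg u k), ← mul_assoc, ← mul_assoc]
  refine mul_le_mul_of_nonneg_right ?_ (fourierSq_nonneg u k)
  rw [integral_laplacian_mul_cos (contDiff_radial ha) (hasCompactSupport_radial h0), norm_neg, norm_mul,
    Real.norm_of_nonneg (sq_nonneg _), Real.norm_eq_abs]
  set X := ‖waveVec k‖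
  have h1 := norm_sq_mul_abs_integral_radial_cos_le ha h0 hpos hanti (waveVec k)
  have h2 : |∫ h, radial a h * Real.cos (inner ℝ (waveVec k) h)| ≤ Z := by
    rw [← Real.norm_eq_abs]
    refine norm_integral_le_of_norm_le hi (ae_of_all _ fun h => ?_)
    rw [norm_mul, Real.norm_of_nonneg (by exact hpos _)]
    exact mul_le_of_le_one_right (hpos _) (Real.abs_cos_le_one _)
  rw [roughSymbol, mul_min_of_nonneg _ _ (by positivity)]
  refine le_min ?_ ?_
  · calc _ ≤ 10 / ℓ ^ 2 * Z := h1.trans hline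
      _ ≤ Z * (10 / ℓ ^ 2) * 4 := by
        have : 0 ≤ 10 / ℓ ^ 2 * Z := by positivity
        linarith
  · calc _ ≤ X ^ 2 * Z := by gcongr
      _ ≤ 40 * (X ^ 2 * Z) := by
        have : 0 ≤ X ^ 2 * Z := by positivity
        linarith
      _ = _ := by field_simp; ring

end Mollify

/-- Interpolation between `L²` and `H^α`. -/
theorem ofReal_rough_le {α q : ℝ} (hα : α ∈ Ioo (0 : ℝ) 1) (hq : q ∈ Icc (1 : ℝ) 2) (u : L2) {ℓ : ℝ}
    (hℓ : 0 < ℓ) :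
    ENNReal.ofReal (rough u ℓ) ≤ ENNReal.ofReal (160 * ℓ ^ (α * q)) *
      (sobolevNorm α u ^ q * ENNReal.ofReal (‖u‖ ^ 2) ^ (1 - q / 2)) := by
  have hαq : 0 < α * q := mul_pos hα.1 (by linarith [hq.1])
  have hαq2 : α * q ≤ 2 := by nlinarith [hα.1, hα.2, hq.1, hq.2]
  -- As `0 < α q ≤ 2`, one has `min 1 (y²) ≤ y ^ (α q)`. The constant is `4 * 40`, with 40 bounding
  -- `(2π)²`.
  have hsym : ∀ k, roughSymbol ℓ k ≤ 160 * ℓ ^ (α * q) * ((1 + freqSq k) ^ α) ^ (q / 2) := by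
    intro k
    have hf : 0 ≤ freqSq k := Finset.sum_nonneg fun _ _ => sq_nonneg _
    set y := ℓ * ‖waveVec k‖
    have hy : 0 ≤ y := by positivity
    have h1 : roughSymbol ℓ k ≤ 4 * y ^ (α * q) := by
      have e : roughSymbol ℓ k = 4 * min 1 (y ^ 2) := by
        rw [roughSymbol, mul_min_of_nonneg _ _ (by norm_num : (0 : ℝ) ≤ 4)]
        congr 1 <;> ring
      rw [e]
      gcongr
      rcases le_total y 1 with h | h
      · refine (min_le_right _ _).trans ?_
        rcases hy.eq_or_lt with h' | h'
        · rw [← h']; simp [Real.zero_rpow hαq.ne']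
        · rw [← Real.rpow_two]
          exact Real.rpow_le_rpow_of_exponent_ge h' h hαq2
      · exact (min_le_left _ _).trans (Real.one_le_rpow h hαq.le)
    have h2 : ‖waveVec k‖ ^ (α * q) ≤ 40 * ((1 + freqSq k) ^ α) ^ (q / 2) := by
      have e : ‖waveVec k‖ ^ (α * q) = (2 * Real.pi) ^ (α * q) * (freqSq k) ^ (α * q / 2) := by
        have : ‖waveVec k‖ = (2 * Real.pi) * √(freqSq k) := by
          rw [← Real.sqrt_sq (norm_nonneg (waveVec k)), norm_waveVec_sq, Real.sqrt_mul (sq_nonneg _),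
            Real.sqrt_sq (by positivity)]
        rw [this, Real.mul_rpow (by positivity) (by positivity), Real.sqrt_eq_rpow, ← Real.rpow_mul hf]
        congr 2; ring
      rw [e, ← Real.rpow_mul (by positivity), mul_div_assoc]
      have h3 : (2 * Real.pi) ^ (α * q) ≤ 40 := by
        calc _ ≤ (2 * Real.pi) ^ (2 : ℝ) :=
              Real.rpow_le_rpow_of_exponent_le (by linarith [Real.pi_gt_three]) hαq2
          _ ≤ 40 := by
              rw [Real.rpow_two]; nlinarith [Real.pi_lt_d2, Real.pi_gt_three]
      gcongr
      · have := hα.1; have := hq.1; positivity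
      · linarith
    calc _ ≤ 4 * y ^ (α * q) := h1
      _ = 4 * (ℓ ^ (α * q) * ‖waveVec k‖ ^ (α * q)) := by
          rw [Real.mul_rpow hℓ.le (norm_nonneg _)]
      _ ≤ 4 * (ℓ ^ (α * q) * (40 * ((1 + freqSq k) ^ α) ^ (q / 2))) := by gcongr
      _ = _ := by ring
  have hS : sobolevNorm α u ^ q
      = (∑' k, ENNReal.ofReal ((1 + freqSq k) ^ α * fourierSq u k)) ^ (q / 2) := by
    rw [sobolevNorm, ← ENNReal.rpow_mul]; congr 1; ring
  rw [rough, ENNReal.ofReal_tsum_of_nonneg (roughSymbol_mul_nonneg u ℓ) (summable_rough u ℓ), hS,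
    ← (hasSum_fourierSq u).tsum_eq,
    ENNReal.ofReal_tsum_of_nonneg (fourierSq_nonneg u) (hasSum_fourierSq u).summable]
  -- Hölder over frequencies with weights `q / 2` and `1 - q / 2`, in a form that includes `q = 2`;
  -- this choice makes the power of the `H^α` norm exactly `q`, matching the time integrability.
  have hold := ENNReal.lintegral_mul_norm_pow_le (μ := Measure.count)
    (f := fun k => ENNReal.ofReal ((1 + freqSq k) ^ α * fourierSq u k))
    (g := fun k => ENNReal.ofReal (fourierSq u k)) (p := q / 2) (q := 1 - q / 2)
    (measurable_of_countable _).aemeasurable (measurable_of_countable _).aemeasurable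
    (by linarith [hq.1]) (by linarith [hq.2]) (by ring)
  simp only [lintegral_count] at hold
  refine le_trans ?_ (mul_le_mul_right hold _)
  rw [← ENNReal.tsum_mul_left]
  refine ENNReal.tsum_le_tsum fun k => ?_
  have hf : 0 ≤ freqSq k := Finset.sum_nonneg fun _ _ => sq_nonneg _
  have hF := fourierSq_nonneg u k
  rw [ENNReal.ofReal_rpow_of_nonneg (by positivity) (by linarith [hq.1]),
    ENNReal.ofReal_rpow_of_nonneg hF (by linarith [hq.2]), ← ENNReal.ofReal_mul (by positivity),
    ← ENNReal.ofReal_mul (by positivity)]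
  refine ENNReal.ofReal_le_ofReal ?_
  have e : fourierSq u k = fourierSq u k ^ (q / 2) * fourierSq u k ^ (1 - q / 2) := by
    rcases hF.eq_or_lt with h | h
    · rw [← h, Real.zero_rpow (by linarith [hq.1])]; simp
    · rw [← Real.rpow_add h]; simp
  rw [Real.mul_rpow (by positivity) hF, mul_assoc (_ ^ (q / 2)), ← e, ← mul_assoc]
  exact mul_le_mul_of_nonneg_right (hsym k) hF

end Roughness

/-! ### The embedding of `H¹` in `L³` -/

section SobolevEmbedding

lemma hasSum_norm_sub_partialSum {ι E : Type*} [DecidableEq ι] [NormedAddCommGroup E]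
    [InnerProductSpace ℂ E] (b : HilbertBasis ι ℂ E) (x : E) (s : Finset ι) :
    HasSum (fun k => if k ∈ s then 0 else ‖b.repr x k‖ ^ 2)
      (‖x - ∑ k ∈ s, b.repr x k • b k‖ ^ 2) := by
  set y := x - ∑ k ∈ s, b.repr x k • b k with hy
  have hk : ∀ k, inner ℂ (b k) y = if k ∈ s then 0 else b.repr x k := fun k => by
    rw [hy, inner_sub_right, inner_sum, ← b.repr_apply_apply]
    simp only [inner_smul_right, orthonormal_iff_ite.1 b.orthonormal k]
    simp
    split_ifs <;> simp
  have h := RCLike.hasSum_re ℂ (b.hasSum_inner_mul_inner y y)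
  rw [inner_self_eq_norm_sq] at h
  convert! h using 1
  ext k
  rw [← inner_conj_symm y, hk]
  split_ifs
  · simp
  · rw [RCLike.conj_mul]; norm_cast

/-- The frequencies of size at most `N`. -/
def freqBox (N : ℕ) : Finset (Fin 3 → ℤ) := Fintype.piFinset fun _ => Finset.Icc (-N : ℤ) N

lemma card_freqBox (N : ℕ) : (freqBox N).card = (2 * N + 1) ^ 3 := by
  simp only [freqBox, Fintype.card_piFinset, Int.card_Icc, Finset.prod_const, Finset.card_univ,
    Fintype.card_fin]
  congr 1; omega

/-- A size of the frequency `k`. -/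
def freqSize (k : Fin 3 → ℤ) : ℕ := ∑ j, (k j).natAbs

lemma mem_freqBox {k : Fin 3 → ℤ} {N : ℕ} (h : freqSize k ≤ N) : k ∈ freqBox N := by
  simp only [freqBox, Fintype.mem_piFinset, Finset.mem_Icc]
  intro j
  have h1 : (k j).natAbs ≤ freqSize k :=
    Finset.single_le_sum (f := fun j => (k j).natAbs) (fun _ _ => Nat.zero_le _) (Finset.mem_univ j)
  omega

lemma sq_freqSize_le (k : Fin 3 → ℤ) : (2 * freqSize k + 1 : ℝ) ^ 2 ≤ 24 * (1 + freqSq k) := by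
  have h1 : (freqSize k : ℝ) = ∑ j, |(k j : ℝ)| := by
    simp [freqSize, Nat.cast_natAbs]
  have h2 : (∑ j, |(k j : ℝ)|) ^ 2 ≤ 3 * freqSq k := by
    have := sq_sum_le_card_mul_sum_sq (s := Finset.univ) (f := fun j => |(k j : ℝ)|)
    simpa [freqSq] using this
  rw [h1]
  nlinarith [sq_nonneg (2 * ∑ j, |(k j : ℝ)| - 1)]

/-- A pointwise level set inequality. -/
lemma cube_le_sum {m M : ℝ} (hm : 0 ≤ m) (hM : 0 < M) {r : ℕ → ℝ}
    (h : ∀ N : ℕ, m ≤ (2 * N + 1) ^ 2 * M + r N) : ∃ K : ℕ, m ^ 3 ≤ 2 * M * m ^ 2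
      + ∑ N ∈ Finset.range K, 8 * ((2 * ((N + 1 : ℕ) : ℝ) + 1) ^ 2 * M - (2 * N + 1) ^ 2 * M) * r N ^ 2 := by
  set A : ℕ → ℝ := fun N => (2 * N + 1) ^ 2 * M
  have hA : ∀ N, A N ≤ A (N + 1) := fun N => by simp only [A]; push_cast; gcongr; linarith
  -- Raising the truncation level from `2 A K` to `2 A (K + 1)` costs something only when `m > 2 A
  -- K`. Then the level bound forces `r K ≥ m / 2`, and the cost is absorbed by the new term of the
  -- sum.
  have key : ∀ K, min m (2 * A K) * m ^ 2 ≤ 2 * M * m ^ 2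
      + ∑ N ∈ Finset.range K, 8 * (A (N + 1) - A N) * r N ^ 2 := by
    intro K
    induction K with
    | zero => simp [A]; gcongr; exact min_le_right _ _
    | succ K ih =>
      rw [Finset.sum_range_succ]
      have hd := sub_nonneg.2 (hA K)
      rcases le_or_gt m (2 * A K) with h1 | h1
      · have h2 : m ≤ 2 * A (K + 1) := h1.trans (by linarith [hA K])
        rw [min_eq_left h1] at ih
        rw [min_eq_left h2]
        have := mul_nonneg (mul_nonneg (by norm_num : (0 : ℝ) ≤ 8) hd) (sq_nonneg (r K))
        linarith
      · rw [min_eq_right h1.le] at ih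
        have h2 : m ≤ 2 * r K := by have := h K; simp only [A] at h1; linarith
        have h3 : m ^ 2 ≤ 4 * r K ^ 2 := by nlinarith
        have h4 := mul_le_mul_of_nonneg_left h3 hd
        have h5 : min m (2 * A (K + 1)) * m ^ 2 ≤ 2 * A (K + 1) * m ^ 2 := by
          gcongr; exact min_le_right _ _
        linarith
  obtain ⟨K, hK⟩ := exists_nat_ge (m / M)
  refine ⟨K, ?_⟩
  have h1 : m ≤ 2 * A K := by
    rw [div_le_iff₀ hM] at hK
    have : (K : ℝ) * M ≤ 2 * ((2 * K + 1) ^ 2 * M) := by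
      rw [← mul_assoc]; gcongr; nlinarith [(Nat.cast_nonneg K : (0 : ℝ) ≤ K)]
    linarith
  have := key K
  rw [min_eq_left h1] at this
  calc m ^ 3 = m * m ^ 2 := by ring
    _ ≤ _ := this

-- At level `N` the function splits into its Fourier partial sum, which is bounded, and a remainder
-- known in `L²`. Summing the level set inequality over `N` and exchanging sums weights each
-- coefficient by about `M |k|²`, which is where one derivative is spent.
open UnitAddTorus in
lemma lintegral_cube_le_of_complex (F : Lp ℂ 2 torusMeasure) {M : ℝ} (hM : 0 < M) (hF : ‖F‖ ≤ M) :
    ∫⁻ x, ‖F x‖ₑ ^ 3 ∂torusMeasure ≤ ENNReal.ofReal (200 * M) *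
      ∑' k, ENNReal.ofReal ((1 + freqSq k) * ‖mFourierCoeff F k‖ ^ 2) := by
  set c : (Fin 3 → ℤ) → ℂ := fun k => mFourierCoeff F k
  have hsum : HasSum (fun k => ‖c k‖ ^ 2) (‖F‖ ^ 2) := by
    have := hasSum_norm_sub_partialSum (mFourierBasis (d := Fin 3)) F ∅
    simp only [mFourierBasis_repr] at this
    simpa using this
  set g : ℕ → Torus → ℂ := fun N x => ∑ k ∈ freqBox N, c k * mFourier k x
  -- Cauchy–Schwarz over `(2N + 1)³` frequencies gives the power `3/2`; it is rounded up to 2, which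
  -- a full derivative still affords.
  have hgb : ∀ N x, ‖g N x‖ ≤ (2 * N + 1) ^ 2 * M := fun N x => by
    have h1 : ‖g N x‖ ≤ ∑ k ∈ freqBox N, ‖c k‖ := by
      refine (norm_sum_le _ _).trans (Finset.sum_le_sum fun k _ => ?_)
      rw [norm_mul]
      refine mul_le_of_le_one_right (norm_nonneg _) ?_
      exact ((mFourier k).norm_coe_le_norm x).trans mFourier_norm.le
    refine h1.trans (abs_le_of_sq_le_sq' ?_ (by positivity)).2
    calc _ ≤ ((freqBox N).card : ℝ) * ∑ k ∈ freqBox N, ‖c k‖ ^ 2 := sq_sum_le_card_mul_sum_sq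
      _ ≤ (2 * N + 1) ^ 4 * M ^ 2 := by
        rw [card_freqBox]
        push_cast
        have h2 : ∑ k ∈ freqBox N, ‖c k‖ ^ 2 ≤ M ^ 2 :=
          (sum_le_hasSum _ (fun _ _ => sq_nonneg _) hsum).trans (by gcongr)
        gcongr
        · simp
        · norm_num
      _ = _ := by ring
  have hgc : ∀ N, Continuous (g N) := fun N => by
    simp only [g]; fun_prop
  have hnorm : ∀ G : Lp ℂ 2 torusMeasure, ∫⁻ x, ‖G x‖ₑ ^ 2 ∂torusMeasure = ENNReal.ofReal (‖G‖ ^ 2) := by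
    intro G
    have := eLpNorm_nnreal_pow_eq_lintegral (μ := torusMeasure) (f := G) (p := 2) two_ne_zero
    simp only [NNReal.coe_ofNat, ENNReal.coe_ofNat, ENNReal.rpow_ofNat] at this
    rw [← this, ← Lp.enorm_def, ENNReal.ofReal_pow (norm_nonneg _), ofReal_norm]
  have hrem : ∀ N, ∫⁻ x, ‖F x - g N x‖ₑ ^ 2 ∂torusMeasure
      = ∑' k, ENNReal.ofReal (if k ∈ freqBox N then 0 else ‖c k‖ ^ 2) := fun N => by
    have h1 := hasSum_norm_sub_partialSum (mFourierBasis (d := Fin 3)) F (freqBox N)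
    simp only [mFourierBasis_repr, coe_mFourierBasis] at h1
    rw [← ENNReal.ofReal_tsum_of_nonneg (fun k => by split_ifs <;> positivity) h1.summable, h1.tsum_eq]
    refine Eq.trans (lintegral_congr_ae ?_) (hnorm _)
    have h2 : ∀ k : Fin 3 → ℤ, (mFourierLp 2 k : Lp ℂ 2 torusMeasure) =ᵐ[torusMeasure] mFourier k :=
      fun k => coeFn_mFourierLp 2 k
    have h3 : (∑ k ∈ freqBox N, mFourierCoeff F k • (mFourierLp 2 k : Lp ℂ 2 torusMeasure) :
        Lp ℂ 2 torusMeasure) =ᵐ[torusMeasure] g N := by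
      refine (Lp.coeFn_finsetSum _ _).trans ?_
      have h4 : ∀ k, (mFourierCoeff F k • (mFourierLp 2 k : Lp ℂ 2 torusMeasure) :
          Lp ℂ 2 torusMeasure) =ᵐ[torusMeasure] fun x => c k * mFourier k x := fun k => by
        filter_upwards [Lp.coeFn_smul (mFourierCoeff F k) (mFourierLp 2 k : Lp ℂ 2 torusMeasure), h2 k]
          with x hx hx2
        rw [hx, Pi.smul_apply, hx2, smul_eq_mul]
      filter_upwards [ae_all_iff.2 h4] with x hx
      simp only [Finset.sum_apply, g]
      exact Finset.sum_congr rfl fun k _ => hx k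
    filter_upwards [Lp.coeFn_sub F (∑ k ∈ freqBox N, mFourierCoeff F k •
      (mFourierLp 2 k : Lp ℂ 2 torusMeasure) : Lp ℂ 2 torusMeasure), h3] with x hx hx3
    rw [hx, Pi.sub_apply, hx3]
  set w : ℕ → ℝ := fun N => 8 * ((2 * ((N + 1 : ℕ) : ℝ) + 1) ^ 2 * M - (2 * N + 1) ^ 2 * M)
  have hw : ∀ N, 0 ≤ w N := fun N => by
    simp only [w]
    have : (2 * (N : ℝ) + 1) ^ 2 * M ≤ (2 * ((N + 1 : ℕ) : ℝ) + 1) ^ 2 * M := by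
      push_cast; gcongr; linarith
    linarith
  have hFm : AEStronglyMeasurable F torusMeasure := Lp.aestronglyMeasurable F
  have hpt : ∀ x, ‖F x‖ₑ ^ 3 ≤ ENNReal.ofReal (2 * M) * ‖F x‖ₑ ^ 2
      + ∑' N, ENNReal.ofReal (w N) * ‖F x - g N x‖ₑ ^ 2 := fun x => by
    obtain ⟨K, hK⟩ := cube_le_sum (norm_nonneg (F x)) hM (r := fun N => ‖F x - g N x‖) fun N => by
      have h1 := norm_le_norm_sub_add (F x) (g N x)
      linarith [hgb N x]
    calc ‖F x‖ₑ ^ 3 = ENNReal.ofReal (‖F x‖ ^ 3) := by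
          rw [ENNReal.ofReal_pow (norm_nonneg _), ofReal_norm]
      _ ≤ ENNReal.ofReal (2 * M * ‖F x‖ ^ 2 + ∑ N ∈ Finset.range K, w N * ‖F x - g N x‖ ^ 2) :=
          ENNReal.ofReal_le_ofReal hK
      _ = ENNReal.ofReal (2 * M) * ‖F x‖ₑ ^ 2
          + ∑ N ∈ Finset.range K, ENNReal.ofReal (w N) * ‖F x - g N x‖ₑ ^ 2 := by
        rw [ENNReal.ofReal_add (by positivity) (Finset.sum_nonneg fun N _ =>
          mul_nonneg (hw N) (sq_nonneg _)), ENNReal.ofReal_sum_of_nonneg fun N _ =>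
          mul_nonneg (hw N) (sq_nonneg _), ENNReal.ofReal_mul (by positivity),
          ENNReal.ofReal_pow (norm_nonneg _), ofReal_norm]
        congr 2; ext N
        rw [ENNReal.ofReal_mul (hw N), ENNReal.ofReal_pow (norm_nonneg _), ofReal_norm]
      _ ≤ _ := by gcongr; exact ENNReal.sum_le_tsum _
  -- The frequency `k` leaves the remainder as soon as `N ≥ freqSize k`, and the weights `w N`
  -- telescope up to that index.
  have htail : ∀ k, ∑' N, ENNReal.ofReal (w N) * ENNReal.ofReal (if k ∈ freqBox N then 0 else ‖c k‖ ^ 2)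
      ≤ ENNReal.ofReal (8 * ((2 * freqSize k + 1) ^ 2 * M) * ‖c k‖ ^ 2) := fun k => by
    rw [tsum_eq_sum (s := Finset.range (freqSize k)) fun N hN => by
      rw [if_pos (mem_freqBox (by simpa using hN))]; simp]
    calc _ ≤ ∑ N ∈ Finset.range (freqSize k), ENNReal.ofReal (w N) * ENNReal.ofReal (‖c k‖ ^ 2) := by
          gcongr with N; split_ifs <;> simp
      _ = ENNReal.ofReal ((∑ N ∈ Finset.range (freqSize k), w N) * ‖c k‖ ^ 2) := by
          rw [← Finset.sum_mul, ENNReal.ofReal_mul (Finset.sum_nonneg fun N _ => hw N),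
            ENNReal.ofReal_sum_of_nonneg fun N _ => hw N]
      _ ≤ _ := by
          refine ENNReal.ofReal_le_ofReal (mul_le_mul_of_nonneg_right ?_ (sq_nonneg _))
          simp only [w]
          rw [← Finset.mul_sum, Finset.sum_range_sub (fun N : ℕ => (2 * (N : ℝ) + 1) ^ 2 * M)]
          simp
          positivity
  have hfin : ∀ k, ENNReal.ofReal (2 * M) * ENNReal.ofReal (‖c k‖ ^ 2) +
      ENNReal.ofReal (8 * ((2 * freqSize k + 1) ^ 2 * M) * ‖c k‖ ^ 2)
      ≤ ENNReal.ofReal (200 * M) * ENNReal.ofReal ((1 + freqSq k) * ‖c k‖ ^ 2) := fun k => by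
    rw [← ENNReal.ofReal_mul (by positivity), ← ENNReal.ofReal_add (by positivity) (by positivity),
      ← ENNReal.ofReal_mul (by positivity)]
    refine ENNReal.ofReal_le_ofReal ?_
    have h1 := sq_freqSize_le k
    have h2 : 0 ≤ freqSq k := Finset.sum_nonneg fun _ _ => sq_nonneg _
    have h3 : 0 ≤ M * ‖c k‖ ^ 2 := by positivity
    nlinarith [mul_le_mul_of_nonneg_right h1 h3, mul_nonneg h2 h3]
  have hms : ∀ N, AEMeasurable (fun x => ENNReal.ofReal (w N) * ‖F x - g N x‖ₑ ^ 2) torusMeasure :=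
    fun N => ((hFm.sub (hgc N).aestronglyMeasurable).enorm.pow_const 2).const_mul _
  calc _ ≤ ∫⁻ x, (ENNReal.ofReal (2 * M) * ‖F x‖ₑ ^ 2
          + ∑' N, ENNReal.ofReal (w N) * ‖F x - g N x‖ₑ ^ 2) ∂torusMeasure := lintegral_mono hpt
    _ = ENNReal.ofReal (2 * M) * ∑' k, ENNReal.ofReal (‖c k‖ ^ 2)
          + ∑' N, ENNReal.ofReal (w N) * ∑' k, ENNReal.ofReal (if k ∈ freqBox N then 0 else ‖c k‖ ^ 2) := by
        rw [lintegral_add_left' ((hFm.enorm.pow_const 2).const_mul _), lintegral_const_mul' _ _ ENNReal.ofReal_ne_top,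
          hnorm, lintegral_tsum hms,
          ← ENNReal.ofReal_tsum_of_nonneg (fun _ => sq_nonneg _) hsum.summable, hsum.tsum_eq]
        congr 2; ext N
        rw [lintegral_const_mul' _ _ ENNReal.ofReal_ne_top, hrem]
    _ = ∑' k, (ENNReal.ofReal (2 * M) * ENNReal.ofReal (‖c k‖ ^ 2) + ∑' N, ENNReal.ofReal (w N) *
          ENNReal.ofReal (if k ∈ freqBox N then 0 else ‖c k‖ ^ 2)) := by
        rw [ENNReal.tsum_add, ENNReal.tsum_mul_left, ENNReal.tsum_comm]
        simp only [ENNReal.tsum_mul_left]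
    _ ≤ _ := by
        rw [← ENNReal.tsum_mul_left]
        exact ENNReal.tsum_le_tsum fun k => (add_le_add_right (htail k) _).trans (hfin k)

/-- The embedding of `H¹` into `L³`. -/
theorem lintegral_cube_le (u : L2) : ∫⁻ x, ‖u x‖ₑ ^ 3 ∂torusMeasure
    ≤ ENNReal.ofReal (1800 * (‖u‖ + 1)) * sobolevNorm 1 u ^ 2 := by
  have hcm := fun j => memLp_coord_complex (Lp.memLp u) j
  have hle : ∀ j, ‖(hcm j).toLp‖ ≤ ‖u‖ := fun j => by
    rw [Lp.norm_toLp, Lp.norm_def]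
    refine ENNReal.toReal_mono (Lp.eLpNorm_ne_top u) (eLpNorm_mono fun x => ?_)
    simpa using PiLp.norm_apply_le (u x) j
  have hj : ∀ j, ∫⁻ x, ‖u x j‖ₑ ^ 3 ∂torusMeasure ≤ ENNReal.ofReal (200 * (‖u‖ + 1)) *
      ∑' k, ENNReal.ofReal ((1 + freqSq k) *
        ‖UnitAddTorus.mFourierCoeff (fun x : Torus => ((u x j : ℝ) : ℂ)) k‖ ^ 2) := fun j => by
    have h1 := lintegral_cube_le_of_complex (hcm j).toLp (M := ‖u‖ + 1) (by positivity)
      ((hle j).trans (by linarith))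
    have h2 : ∀ k, UnitAddTorus.mFourierCoeff (hcm j).toLp k
        = UnitAddTorus.mFourierCoeff (fun x : Torus => ((u x j : ℝ) : ℂ)) k := fun k => by
      refine integral_congr_ae (μ := torusMeasure) ?_
      filter_upwards [(hcm j).coeFn_toLp] with x hx
      rw [hx]
    simp only [h2] at h1
    refine Eq.trans_le (lintegral_congr_ae ?_) h1
    filter_upwards [(hcm j).coeFn_toLp] with x hx
    rw [hx]
    congr 1
    rw [← ofReal_norm, ← ofReal_norm]; simp
  have hpt : ∀ x, ‖u x‖ₑ ^ 3 ≤ 9 * ∑ j, ‖u x j‖ₑ ^ 3 := fun x => by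
    have h1 : ‖u x‖ ≤ ∑ j, ‖u x j‖ := by
      have : u x = ∑ j, EuclideanSpace.single j (u x j) := by
        ext i; simp [Finset.sum_apply, Pi.single_apply]
      calc ‖u x‖ = ‖∑ j, (EuclideanSpace.single j (u x j) : Vec)‖ := by rw [← this]
        _ ≤ _ := (norm_sum_le _ _).trans (by simp)
    have h2 : ‖u x‖ ^ 3 ≤ 9 * ∑ j, ‖u x j‖ ^ 3 := by
      refine (pow_le_pow_left₀ (norm_nonneg _) h1 3).trans ?_
      have h3 := pow_sum_div_card_le_sum_pow (s := (Finset.univ : Finset (Fin 3)))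
        (f := fun j => ‖u x j‖) (fun _ _ => norm_nonneg _) 2
      simp at h3
      norm_num at h3 ⊢
      linarith
    simp only [← ofReal_norm, ← ENNReal.ofReal_pow (norm_nonneg _)]
    rw [← ENNReal.ofReal_sum_of_nonneg fun _ _ => by positivity,
      show (9 : ℝ≥0∞) = ENNReal.ofReal 9 by norm_num, ← ENNReal.ofReal_mul (by norm_num)]
    exact ENNReal.ofReal_le_ofReal h2
  have hS : sobolevNorm 1 u ^ 2 = ∑' k, ENNReal.ofReal ((1 + freqSq k) * fourierSq u k) := by
    rw [sobolevNorm, ← ENNReal.rpow_natCast, ← ENNReal.rpow_mul]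
    simp
  have hf : ∀ k, 0 ≤ 1 + freqSq k := fun k =>
    add_nonneg zero_le_one (Finset.sum_nonneg fun _ _ => sq_nonneg _)
  calc _ ≤ ∫⁻ x, 9 * ∑ j, ‖u x j‖ₑ ^ 3 ∂torusMeasure := lintegral_mono hpt
    _ = 9 * ∑ j, ∫⁻ x, ‖u x j‖ₑ ^ 3 ∂torusMeasure := by
      rw [lintegral_const_mul' _ _ (by norm_num), lintegral_finsetSum' _ fun j _ =>
        (memLp_coord (Lp.memLp u) j).1.enorm.pow_const 3]
    _ ≤ 9 * ∑ j, ENNReal.ofReal (200 * (‖u‖ + 1)) * ∑' k, ENNReal.ofReal ((1 + freqSq k) *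
        ‖UnitAddTorus.mFourierCoeff (fun x : Torus => ((u x j : ℝ) : ℂ)) k‖ ^ 2) := by
      gcongr with j; exact hj j
    _ = _ := by
      rw [← Finset.mul_sum, ← mul_assoc, hS, ← Summable.tsum_finsetSum fun _ _ => ENNReal.summable,
        show (9 : ℝ≥0∞) = ENNReal.ofReal 9 by norm_num, ← ENNReal.ofReal_mul (by norm_num)]
      congr 2
      · ring
      · ext k
        rw [← ENNReal.ofReal_sum_of_nonneg fun j _ => mul_nonneg (hf k) (sq_nonneg _), fourierSq,
          Finset.mul_sum]

end SobolevEmbedding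

/-! ### Deviation from the structure law at a fixed scale -/

section Deviation

lemma norm_mFourierCoeff_sub_le (u w : L2) (j : Fin 3) (k : Fin 3 → ℤ) :
    ‖UnitAddTorus.mFourierCoeff (fun x : Torus => ((u x j : ℝ) : ℂ)) k
      - UnitAddTorus.mFourierCoeff (fun x : Torus => ((w x j : ℝ) : ℂ)) k‖ ≤ ‖u - w‖ := by
  have hi : ∀ u : L2, Integrable (fun x => UnitAddTorus.mFourier (-k) x • ((u x j : ℝ) : ℂ))
      torusMeasure := fun u => by
    refine ((memLp_coord_complex (Lp.memLp u) j).integrable one_le_two).bdd_mul (c := 1)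
      (UnitAddTorus.mFourier (-k)).continuous.aestronglyMeasurable (ae_of_all _ fun x => ?_)
    exact ((UnitAddTorus.mFourier (-k)).norm_coe_le_norm x).trans UnitAddTorus.mFourier_norm.le
  have e : UnitAddTorus.mFourierCoeff (fun x : Torus => ((u x j : ℝ) : ℂ)) k
      - UnitAddTorus.mFourierCoeff (fun x : Torus => ((w x j : ℝ) : ℂ)) k
      = UnitAddTorus.mFourierCoeff (fun x : Torus => (((u - w) x j : ℝ) : ℂ)) k := by
    refine (integral_sub (hi u) (hi w)).symm.trans (integral_congr_ae (μ := torusMeasure) ?_)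
    filter_upwards [Lp.coeFn_sub u w] with x hx
    rw [hx]; simp [mul_sub]
  rw [e]
  refine abs_le_of_sq_le_sq' ?_ (norm_nonneg _) |>.2
  calc _ ≤ fourierSq (u - w) k :=
        Finset.single_le_sum (f := fun j => ‖UnitAddTorus.mFourierCoeff
          (fun x : Torus => (((u - w) x j : ℝ) : ℂ)) k‖ ^ 2) (fun _ _ => sq_nonneg _) (Finset.mem_univ j)
    _ ≤ _ := le_hasSum (hasSum_fourierSq (u - w)) k fun _ _ => fourierSq_nonneg _ _

/-- Supplies measurability in time of the Sobolev norms, which are sums of such terms. -/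
lemma continuous_fourierSq (k : Fin 3 → ℤ) : Continuous fun u : L2 => fourierSq u k := by
  unfold fourierSq
  refine continuous_finsetSum _ fun j _ => (Continuous.norm ?_).pow 2
  have : LipschitzWith 1 fun u : L2 => UnitAddTorus.mFourierCoeff (fun x : Torus => ((u x j : ℝ) : ℂ)) k :=
    LipschitzWith.of_dist_le_mul fun u w => by
      rw [dist_eq_norm, dist_eq_norm]; simpa using norm_mFourierCoeff_sub_le u w j k
  exact this.continuous

lemma memLp_three_of_sobolevNorm {u : L2} (hS : sobolevNorm 1 u ≠ ∞) : MemLp u 3 torusMeasure ∧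
    ∫ x, ‖u x‖ ^ 3 ∂torusMeasure ≤ 1800 * (‖u‖ + 1) * (sobolevNorm 1 u).toReal ^ 2 := by
  have h1 := lintegral_cube_le u
  have h2 : ENNReal.ofReal (1800 * (‖u‖ + 1)) * sobolevNorm 1 u ^ 2 ≠ ∞ :=
    ENNReal.mul_ne_top ENNReal.ofReal_ne_top (ENNReal.pow_ne_top hS)
  have h3 : ∫⁻ x, ‖u x‖ₑ ^ 3 ∂torusMeasure ≠ ∞ := ne_top_of_le_ne_top h2 h1
  refine ⟨⟨Lp.aestronglyMeasurable u, ?_⟩, ?_⟩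
  · rw [eLpNorm_lt_top_iff_lintegral_rpow_enorm_lt_top (by norm_num) (by norm_num)]
    simpa using h3.lt_top
  · have h4 : ∫ x, ‖u x‖ ^ 3 ∂torusMeasure = (∫⁻ x, ‖u x‖ₑ ^ 3 ∂torusMeasure).toReal := by
      have hm : AEStronglyMeasurable (fun x => ‖u x‖ ^ 3) torusMeasure :=
        (Lp.aestronglyMeasurable u).norm.pow 3
      rw [integral_eq_lintegral_of_nonneg_ae (ae_of_all _ fun x => by positivity) hm]
      simp only [← ofReal_norm, ← ENNReal.ofReal_pow (norm_nonneg _)]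
    rw [h4]
    refine (ENNReal.toReal_mono h2 h1).trans_eq ?_
    rw [ENNReal.toReal_mul, ENNReal.toReal_ofReal (by positivity), ENNReal.toReal_pow]

section
variable {ν : ℝ} {vin : L2} {f v : ℝ → L2}

lemma IsLerayHopf.lintegral_sobolevNorm_lt_top (h : IsLerayHopf ν vin f v) :
    ∫⁻ r, sobolevNorm 1 (v r) ^ 2 ∂timeMeasure < ∞ := by
  have := (eLpNorm_lt_top_iff_lintegral_rpow_enorm_lt_top (by norm_num) (by norm_num)).1 h.l2_H1
  simpa using this

lemma IsLerayHopf.aemeasurable_sobolevNorm (h : IsLerayHopf ν vin f v) (s : ℝ) :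
    AEMeasurable (fun r => sobolevNorm s (v r)) timeMeasure :=
  (AEMeasurable.tsum fun k => (((continuous_fourierSq k).comp_aestronglyMeasurable
    h.linfty_L2.1).aemeasurable.const_mul _).ennreal_ofReal).pow_const _

lemma IsLerayHopf.ae_sobolevNorm_ne_top (h : IsLerayHopf ν vin f v) :
    ∀ᵐ r ∂timeMeasure, sobolevNorm 1 (v r) ≠ ∞ := by
  filter_upwards [ae_lt_top' ((h.aemeasurable_sobolevNorm 1).pow_const 2)
    h.lintegral_sobolevNorm_lt_top.ne] with r hr htop
  simp [htop] at hr

lemma IsLerayHopf.memLp_three (h : IsLerayHopf ν vin f v) :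
    ∀ᵐ r ∂timeMeasure, MemLp (v r) 3 torusMeasure := by
  filter_upwards [h.ae_sobolevNorm_ne_top] with r hr using (memLp_three_of_sobolevNorm hr).1

lemma IsLerayHopf.integrable_sobolevNorm_sq (h : IsLerayHopf ν vin f v) :
    Integrable (fun r => (sobolevNorm 1 (v r)).toReal ^ 2) timeMeasure := by
  simp only [← ENNReal.toReal_pow]
  exact integrable_toReal_of_lintegral_ne_top ((h.aemeasurable_sobolevNorm 1).pow_const 2)
    h.lintegral_sobolevNorm_lt_top.ne

lemma timeMeasure_ae_mem : ∀ᵐ r ∂timeMeasure, r ∈ Icc (0 : ℝ) 1 :=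
  (ae_restrict_mem measurableSet_Ioo).mono fun _ hr => Ioo_subset_Icc_self hr

lemma enorm_intervalIntegral_le {φ : ℝ → ℝ} {t : ℝ} (ht : t ∈ Icc (0 : ℝ) 1) :
    ‖∫ r in 0..t, φ r‖ₑ ≤ ∫⁻ r, ‖φ r‖ₑ ∂timeMeasure := by
  rw [intervalIntegral.integral_of_le ht.1]
  exact (enorm_integral_le_lintegral_enorm _).trans
    (lintegral_mono' (restrict_Ioc_le_timeMeasure ht.2) le_rfl)

variable {S : L2 → ℝ → ℝ} {c ℓ : ℝ} {a : ℕ → ℝ → ℝ}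

/-- The normalized energy flux through the regularization converges in time average. -/
lemma IsLerayHopf.flux_limit (h : IsLerayHopf ν vin f v) (hν : 0 < ν) (hℓ : 0 < ℓ)
    (ha : IsStructureProfile S c ℓ a) :
    Integrable (fun r => c * (S (v r) ℓ / ℓ)) timeMeasure ∧ ∀ t ∈ Icc (0 : ℝ) 1,
      Tendsto (fun n => ∫ r in 0..t, convection (v r) (conv (radial (a n)) (v r)) / ∫ h, radial (a n) h)
        atTop (𝓝 (∫ r in 0..t, c * (S (v r) ℓ / ℓ))) := by
  obtain ⟨M, hM0, hM⟩ := h.norm_ae_le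
  -- The profile bound `flux_le` combined with the embedding of `H¹` in `L³`. The majorant may
  -- depend badly on `ν` and `ℓ`, since both are fixed while the profile index tends to infinity.
  set G : ℝ → ℝ := fun r => 10 / ℓ * (1800 * (M + 1) * (sobolevNorm 1 (v r)).toReal ^ 2)
  have hG : Integrable G timeMeasure := (h.integrable_sobolevNorm_sq.const_mul _).const_mul _
  have hFi : ∀ n, Integrable (fun r => convection (v r) (conv (radial (a n)) (v r)) /
      ∫ h, radial (a n) h) timeMeasure := fun n =>
    (h.energy_balance hν (contDiff_radial (ha.smooth n)) (hasCompactSupport_radial (ha.eq_zero n))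
      (radial_neg _)).1.div_const _
  have hgood : ∀ᵐ r ∂timeMeasure, (∀ n, ‖convection (v r) (conv (radial (a n)) (v r)) /
      ∫ h, radial (a n) h‖ ≤ G r) ∧ Tendsto (fun n => convection (v r) (conv (radial (a n)) (v r)) /
      ∫ h, radial (a n) h) atTop (𝓝 (c * (S (v r) ℓ / ℓ))) := by
    filter_upwards [hM, h.ae_sobolevNorm_ne_top, timeMeasure_ae_mem] with r hr1 hr2 hr3
    obtain ⟨h1, h2⟩ := memLp_three_of_sobolevNorm hr2
    refine ⟨fun n => (ha.flux_le _ h1 (h.divFree r hr3) n).trans ?_,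
      ha.flux_tendsto _ h1 (h.divFree r hr3)⟩
    simp only [G]
    gcongr
    exact h2.trans (by gcongr)
  -- Measurability in time of the structure function is inherited from the regularized fluxes.
  have hm : AEStronglyMeasurable (fun r => c * (S (v r) ℓ / ℓ)) timeMeasure :=
    aestronglyMeasurable_of_tendsto_ae atTop (fun n => (hFi n).1) (hgood.mono fun r hr => hr.2)
  refine ⟨hG.mono' hm (hgood.mono fun r hr =>
    le_of_tendsto hr.2.norm (Eventually.of_forall hr.1)), fun t ht => ?_⟩
  have hle := restrict_Ioc_le_timeMeasure ht.2
  simp only [intervalIntegral.integral_of_le ht.1]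
  refine tendsto_integral_of_dominated_convergence G (fun n => (hFi n).1.mono_measure hle)
    (hG.mono_measure hle) (fun n => ?_) ?_
  · filter_upwards [ae_mono hle hgood] with r hr using hr.1 n
  · filter_upwards [ae_mono hle hgood] with r hr using hr.2

/-- The deviation from the structure function law at scale `ℓ`. -/
theorem IsLerayHopf.deviation_le (h : IsLerayHopf ν vin f v) (hν : 0 < ν) (hℓ : 0 < ℓ)
    (ha : IsStructureProfile S c ℓ a) {t : ℝ} (ht : t ∈ Icc (0 : ℝ) 1) :
    ‖(∫ r in 0..t, c * (S (v r) ℓ / ℓ)) + dissipation f v t‖ₑ ≤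
      ENNReal.ofReal (rough vin ℓ) + ENNReal.ofReal (rough (v t) ℓ)
      + ENNReal.ofReal (10 * ν / ℓ ^ 2) * ∫⁻ r, ENNReal.ofReal (rough (v r) ℓ) ∂timeMeasure
      + ∫⁻ r, ‖f r‖ₑ * ENNReal.ofReal √(rough (v r) ℓ) ∂timeMeasure := by
  -- The right side does not depend on the profile, so it is enough to prove the estimate for each
  -- smooth kernel.
  refine le_of_tendsto ((((h.flux_limit hν hℓ ha).2 t ht).add_const _).enorm) (Eventually.of_forall fun n => ?_)
  set Z := ∫ h, radial (a n) h with hZdef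
  have hZ : 0 < Z := ha.mass_pos n
  have hk := contDiff_radial (ha.smooth n)
  have hc := hasCompactSupport_radial (ha.eq_zero n)
  set A := convL _ hk hc with hA
  set L := convL _ (contDiff_laplacian_kernel hk) (hasCompactSupport_laplacian_kernel hc) with hL
  obtain ⟨hi, hb⟩ := h.energy_balance hν hk hc (radial_neg _)
  replace hb := hb t ht
  rw [← hA, ← hL] at hb
  have mass : ∀ w u : L2, ∀ c : ℝ, (∀ h : Vec, ‖h‖ ≤ 2 * ℓ → |inner ℝ w u - corr w u h| ≤ c) →
      |inner ℝ w u - inner ℝ w (A u) / Z| ≤ c := fun w u c hwu => by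
    have := abs_mass_mul_sub_inner_convL_le (ha.smooth n) (ha.eq_zero n) (ha.nonneg n) hℓ.le w u hwu
    rw [sub_div' hZ.ne', abs_div, abs_of_pos hZ, div_le_iff₀ hZ, mul_comm _ Z, mul_comm c]
    exact this
  have hD : ∀ u : L2, |‖u‖ ^ 2 - inner ℝ u (A u) / Z| ≤ 1 / 2 * rough u ℓ := fun u => by
    rw [← real_inner_self_eq_norm_sq]
    refine mass u u _ fun h hh => ?_
    have := norm_sq_sub_corr_nonneg_le u hh
    rw [real_inner_self_eq_norm_sq, abs_of_nonneg this.1]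
    exact this.2
  have hF : ∀ r, |inner ℝ (f r) (v r) - inner ℝ (f r) (A (v r)) / Z| ≤ ‖f r‖ * √(rough (v r) ℓ) :=
    fun r => mass _ _ _ fun h hh => abs_inner_sub_corr_le _ _ hh
  have hV : ∀ r, |inner ℝ (v r) (L (v r)) / Z| ≤ 10 / ℓ ^ 2 * rough (v r) ℓ := fun r => by
    rw [abs_div, abs_of_pos hZ, div_le_iff₀ hZ, mul_comm _ Z]
    exact abs_inner_laplacian_le (ha.smooth n) (ha.eq_zero n) (ha.nonneg n) (ha.deriv_nonpos n) hℓ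
      (ha.line_le n) (v r)
  have z0 : (0 : ℝ) ∈ Icc (0 : ℝ) 1 := by simp
  have j1 := intervalIntegrable_of_timeMeasure h.integrable_inner z0 ht
  have j2 : IntervalIntegrable (fun r => inner ℝ (f r) (A (v r)) / Z) volume 0 t := by
    obtain ⟨M, hM0, hM⟩ := h.norm_ae_le
    refine (intervalIntegrable_of_timeMeasure ?_ z0 ht).div_const _
    refine (h.integrable_force.norm.mul_const (‖A‖ * M)).mono'
      (h.force_L1L2.1.inner (A.continuous.comp_aestronglyMeasurable h.linfty_L2.1)) ?_
    filter_upwards [hM] with r hr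
    exact (norm_inner_le_norm _ _).trans (by gcongr; exact A.le_of_opNorm_le_of_le le_rfl hr)
  -- The balance divided by `2 Z`, compared with the definition of `dissipation`: every remaining
  -- term is the defect of regularization in an energy or in the force pairing, or the viscous term.
  have key : (∫ r in 0..t, convection (v r) (conv (radial (a n)) (v r)) / Z) + dissipation f v t
      = 1 / 2 * (‖vin‖ ^ 2 - inner ℝ vin (A vin) / Z) - 1 / 2 * (‖v t‖ ^ 2 - inner ℝ (v t) (A (v t)) / Z)
        - ν * (∫ r in 0..t, inner ℝ (v r) (L (v r)) / Z)
        + ∫ r in 0..t, (inner ℝ (f r) (v r) - inner ℝ (f r) (A (v r)) / Z) := by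
    rw [intervalIntegral.integral_sub j1 j2]
    simp only [intervalIntegral.integral_div, dissipation]
    rw [h.initial] at hb ⊢
    field_simp
    linarith
  rw [key]
  have b1 : ∀ u : L2, ‖1 / 2 * (‖u‖ ^ 2 - inner ℝ u (A u) / Z)‖ₑ ≤ ENNReal.ofReal (rough u ℓ) := fun u => by
    rw [← ofReal_norm, Real.norm_eq_abs, abs_mul]
    refine ENNReal.ofReal_le_ofReal ?_
    norm_num
    linarith [hD u, rough_nonneg u ℓ]
  refine (enorm_add_le _ _).trans (add_le_add ((enorm_sub_le).trans (add_le_add (enorm_sub_le.trans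
    (add_le_add (b1 _) (b1 _))) ?_)) ?_)
  · rw [enorm_mul]
    calc _ ≤ ‖ν‖ₑ * ∫⁻ r, ENNReal.ofReal (10 / ℓ ^ 2) * ENNReal.ofReal (rough (v r) ℓ) ∂timeMeasure := by
          gcongr
          refine (enorm_intervalIntegral_le ht).trans (lintegral_mono fun r => ?_)
          rw [← ofReal_norm, ← ENNReal.ofReal_mul (by positivity)]
          exact ENNReal.ofReal_le_ofReal (hV r)
      _ = _ := by
          rw [lintegral_const_mul' _ _ ENNReal.ofReal_ne_top, ← mul_assoc, ← ofReal_norm,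
            ← ENNReal.ofReal_mul (norm_nonneg _), Real.norm_of_nonneg hν.le]
          congr 2; ring
  · refine (enorm_intervalIntegral_le ht).trans (lintegral_mono fun r => ?_)
    rw [← ofReal_norm, ← ofReal_norm, ← ENNReal.ofReal_mul (norm_nonneg _)]
    exact ENNReal.ofReal_le_ofReal (hF r)

end

end Deviation

/-! ### Uniform estimates and passage to the limit -/

section StructureLaws

/-- The limit `ν → 0`, `ℓ → 0` in the range `ν ^ K ≤ ℓ`. -/
def scaleFilter (K : ℝ) : Filter (ℝ × ℝ) := (𝓝[>] 0 ×ˢ 𝓝[>] 0) ⊓ 𝓟 {p | p.1 ^ K ≤ p.2}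

lemma tendsto_fst_scaleFilter (K : ℝ) : Tendsto Prod.fst (scaleFilter K) (𝓝[>] 0) :=
  tendsto_fst.mono_left inf_le_left

lemma tendsto_snd_scaleFilter (K : ℝ) : Tendsto Prod.snd (scaleFilter K) (𝓝[>] 0) :=
  tendsto_snd.mono_left inf_le_left

lemma eventually_scaleFilter (K : ℝ) :
    ∀ᶠ p in scaleFilter K, p.1 ∈ Ioo (0 : ℝ) 1 ∧ 0 < p.2 ∧ p.1 ^ K ≤ p.2 := by
  have h1 := (tendsto_fst_scaleFilter K).eventually (Ioo_mem_nhdsGT one_pos)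
  have h2 := (tendsto_snd_scaleFilter K).eventually self_mem_nhdsWithin
  have h3 : ∀ᶠ p in scaleFilter K, p ∈ {p : ℝ × ℝ | p.1 ^ K ≤ p.2} := mem_inf_of_right (mem_principal_self _)
  filter_upwards [h1, h2, h3] with p a b c using ⟨a, b, c⟩

/-- The iterated limit is implied by a joint limit in `(ν, ℓ)` restricted to `ν ^ K ≤ ℓ`. For a
given tolerance, once `ℓI` is small all admissible `ℓ` lie in the region where the joint bound
holds; empty ranges are harmless, as the supremum is then 0. -/
lemma tendsto_limsup_iSup_of_scaleFilter {K : ℝ} {g : ℝ → ℝ → ℝ≥0∞}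
    (hg : Tendsto (fun p : ℝ × ℝ => g p.1 p.2) (scaleFilter K) (𝓝 0)) :
    Tendsto (fun ℓI => limsup (fun ν => ⨆ ℓ ∈ Icc (ν ^ K) ℓI, g ν ℓ) (𝓝[>] 0)) (𝓝[>] 0) (𝓝 0) := by
  rw [ENNReal.tendsto_nhds_zero]
  intro ε hε
  have h1 := ENNReal.tendsto_nhds_zero.1 hg ε hε
  rw [scaleFilter, eventually_inf_principal, eventually_prod_iff] at h1
  obtain ⟨pa, ha, pb, hb, H⟩ := h1
  obtain ⟨u, hu, hb⟩ := mem_nhdsGT_iff_exists_Ioo_subset.1 hb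
  filter_upwards [Ioo_mem_nhdsGT hu] with ℓI hℓI
  refine limsup_le_of_le (by isBoundedDefault) ?_
  filter_upwards [ha, self_mem_nhdsWithin] with ν hν hν0
  refine iSup₂_le fun ℓ hℓ => ?_
  exact H hν (hb ⟨(Real.rpow_pos_of_pos hν0 K).trans_le hℓ.1, hℓ.2.trans_lt hℓI.2⟩) hℓ.1

lemma lintegral_const_timeMeasure (c : ℝ≥0∞) : ∫⁻ _, c ∂timeMeasure = c := by
  simp

/-- A truncated Young inequality. -/
lemma mul_sqrt_le {σ x d M s : ℝ} (hσ : 0 < σ) (hx : 0 ≤ x) (hd : 0 ≤ d) (hM : √d ≤ 2 * M) (hs : 0 < s) :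
    x * √d ≤ s ^ (1 / 4 : ℝ) + s ^ (-(3 / 4) : ℝ) * d + 2 * M * s ^ (σ / 4) * x ^ (1 + σ) := by
  have hM0 : 0 ≤ 2 * M := (Real.sqrt_nonneg d).trans hM
  -- The threshold for the size of the force. Below it, `√d ≤ δ + d / δ` with `δ = s ^ (1 / 2)`;
  -- above it, `√d ≤ 2 * M` and the factor `(x / lam) ^ σ ≥ 1` spends the extra integrability of the
  -- force. With `s = ℓ ^ (α q)` and `∫ d ≤ C s`, every term has a positive power of `s`.
  set lam := s ^ (-(1 / 4) : ℝ)
  have hl : 0 < lam := by positivity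
  have e1 : s ^ (1 / 4 : ℝ) = lam * s ^ (1 / 2 : ℝ) := by
    rw [← Real.rpow_add hs]; norm_num
  have e2 : s ^ (-(3 / 4) : ℝ) = lam / s ^ (1 / 2 : ℝ) := by
    rw [← Real.rpow_sub hs]; norm_num
  rcases le_or_gt x lam with h | h
  · have hδ : 0 < s ^ (1 / 2 : ℝ) := by positivity
    set δ := s ^ (1 / 2 : ℝ)
    have h1 : √d ≤ δ + d / δ := by
      rcases le_or_gt (√d) δ with h' | h'
      · have : 0 ≤ d / δ := by positivity
        linarith
      · have : √d ≤ d / δ := by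
          rw [le_div_iff₀ hδ]
          nlinarith [Real.mul_self_sqrt hd, Real.sqrt_nonneg d]
        linarith
    have h2 : 0 ≤ 2 * M * s ^ (σ / 4) * x ^ (1 + σ) := by positivity
    calc x * √d ≤ lam * (δ + d / δ) := by gcongr
      _ = s ^ (1 / 4 : ℝ) + s ^ (-(3 / 4) : ℝ) * d := by rw [e1, e2]; ring
      _ ≤ _ := by linarith
  · have hx0 : 0 < x := hl.trans h
    have h1 : 1 ≤ s ^ (σ / 4) * x ^ σ := by
      have : s ^ (σ / 4) * lam ^ σ = 1 := by
        rw [← Real.rpow_mul hs.le, ← Real.rpow_add hs]; ring_nf; simp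
      rw [← this]
      gcongr
    have h2 : 0 ≤ s ^ (1 / 4 : ℝ) + s ^ (-(3 / 4) : ℝ) * d := by positivity
    calc x * √d ≤ x * (2 * M) := by gcongr
      _ ≤ x * (2 * M) * (s ^ (σ / 4) * x ^ σ) := le_mul_of_one_le_right (by positivity) h1
      _ = 2 * M * s ^ (σ / 4) * x ^ (1 + σ) := by
          rw [Real.rpow_add hx0, Real.rpow_one]; ring
      _ ≤ _ := by linarith

section
variable {σ α q : ℝ} {f v : ℝ → ℝ → L2}

/-- The consequences of the uniform bound, in the form used below. -/
lemma exists_uniform_constants (hσ : 0 < σ) (hα : α ∈ Ioo (0 : ℝ) 1) (hq : q ∈ Icc (1 : ℝ) 2)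
    (hH : UniformBound σ α q f v) :
    ∃ (M : ℝ) (C F : ℝ≥0∞), 0 ≤ M ∧ C ≠ ∞ ∧ F ≠ ∞ ∧ ∀ ν ∈ Ioo (0 : ℝ) 1,
      (∀ᵐ r ∂timeMeasure, ‖v ν r‖ ≤ M) ∧
      ∫⁻ r, ‖f ν r‖ₑ ^ (1 + σ) ∂timeMeasure ≤ F ∧
      ∀ ℓ, 0 < ℓ → ∫⁻ r, ENNReal.ofReal (rough (v ν r) ℓ) ∂timeMeasure
        ≤ C * ENNReal.ofReal (ℓ ^ (α * q)) := by
  unfold UniformBound at hH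
  set B := ⨆ ν ∈ Ioo (0 : ℝ) 1, (eLpNorm (v ν) ∞ timeMeasure
      + eLpNorm (fun t => sobolevNorm α (v ν t)) (ENNReal.ofReal q) timeMeasure
      + eLpNorm (f ν) (ENNReal.ofReal (1 + σ)) timeMeasure)
  have hq0 : 0 < q := by linarith [hq.1]
  refine ⟨B.toReal, ENNReal.ofReal 160 * (ENNReal.ofReal (B.toReal ^ 2) ^ (1 - q / 2) * B ^ q), B ^ (1 + σ),
    ENNReal.toReal_nonneg, ?_, ENNReal.rpow_ne_top_of_nonneg (by linarith) hH.ne, fun ν hν => ?_⟩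
  · exact ENNReal.mul_ne_top ENNReal.ofReal_ne_top (ENNReal.mul_ne_top
      (ENNReal.rpow_ne_top_of_nonneg (by linarith [hq.2]) ENNReal.ofReal_ne_top)
      (ENNReal.rpow_ne_top_of_nonneg hq0.le hH.ne))
  have hB : eLpNorm (v ν) ∞ timeMeasure
      + eLpNorm (fun t => sobolevNorm α (v ν t)) (ENNReal.ofReal q) timeMeasure
      + eLpNorm (f ν) (ENNReal.ofReal (1 + σ)) timeMeasure ≤ B :=
    le_iSup₂ (f := fun ν (_ : ν ∈ Ioo (0 : ℝ) 1) => eLpNorm (v ν) ∞ timeMeasure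
      + eLpNorm (fun t => sobolevNorm α (v ν t)) (ENNReal.ofReal q) timeMeasure
      + eLpNorm (f ν) (ENNReal.ofReal (1 + σ)) timeMeasure) ν hν
  have b1 := (le_self_add.trans le_self_add).trans hB
  have b2 := (le_add_self.trans le_self_add).trans hB
  have b3 := le_add_self.trans hB
  have pow_le : ∀ {p : ℝ}, 0 < p → ∀ {g : ℝ → ℝ≥0∞}, (∫⁻ r, g r ^ p ∂timeMeasure) ^ (1 / p) ≤ B →
      ∫⁻ r, g r ^ p ∂timeMeasure ≤ B ^ p := fun {p} hp {g} hg => by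
    have := ENNReal.rpow_le_rpow hg hp.le
    rwa [← ENNReal.rpow_mul, one_div_mul_cancel hp.ne', ENNReal.rpow_one] at this
  have hM : ∀ᵐ r ∂timeMeasure, ‖v ν r‖ ≤ B.toReal := by
    filter_upwards [ae_le_eLpNormEssSup (f := v ν) (μ := timeMeasure)] with r hr
    rw [← eLpNorm_exponent_top] at hr
    rw [← toReal_enorm]
    exact ENNReal.toReal_mono hH.ne (hr.trans b1)
  refine ⟨hM, ?_, fun ℓ hℓ => ?_⟩
  · refine pow_le (by linarith) ?_
    rwa [eLpNorm_eq_lintegral_rpow_enorm_toReal (by simp; linarith) (by simp),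
      ENNReal.toReal_ofReal (by linarith)] at b3
  · have hS : ∫⁻ r, sobolevNorm α (v ν r) ^ q ∂timeMeasure ≤ B ^ q := by
      refine pow_le hq0 ?_
      rwa [eLpNorm_eq_lintegral_rpow_enorm_toReal (by simp; linarith) (by simp),
        ENNReal.toReal_ofReal hq0.le] at b2
    have hD : ENNReal.ofReal (B.toReal ^ 2) ^ (1 - q / 2) ≠ ∞ :=
      ENNReal.rpow_ne_top_of_nonneg (by linarith [hq.2]) ENNReal.ofReal_ne_top
    calc _ ≤ ∫⁻ r, ENNReal.ofReal (160 * ℓ ^ (α * q)) *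
          (sobolevNorm α (v ν r) ^ q * ENNReal.ofReal (B.toReal ^ 2) ^ (1 - q / 2)) ∂timeMeasure := by
          refine lintegral_mono_ae ?_
          filter_upwards [hM] with r hr
          refine (ofReal_rough_le hα hq (v ν r) hℓ).trans ?_
          gcongr
          linarith [hq.2]
      _ ≤ ENNReal.ofReal (160 * ℓ ^ (α * q)) * (B ^ q * ENNReal.ofReal (B.toReal ^ 2) ^ (1 - q / 2)) := by
          rw [lintegral_const_mul' _ _ ENNReal.ofReal_ne_top, lintegral_mul_const' _ _ hD]
          gcongr
      _ = _ := by
          rw [ENNReal.ofReal_mul (by norm_num)]; ring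

lemma tendsto_ofReal_rpow_nhdsGT {κ : ℝ} (hκ : 0 < κ) :
    Tendsto (fun x : ℝ => ENNReal.ofReal (x ^ κ)) (𝓝[>] 0) (𝓝 0) := by
  have : Continuous fun x : ℝ => ENNReal.ofReal (x ^ κ) :=
    ENNReal.continuous_ofReal.comp (Real.continuous_rpow_const hκ.le)
  simpa [Real.zero_rpow hκ.ne'] using (this.tendsto 0).mono_left nhdsWithin_le_nhds

/-- Both laws follow from here, with `(c, c')` equal to `(5/4, 4/5)` or `(3/4, 4/3)`. The bound `c'
≤ 2` only serves to absorb the prefactor into a fixed constant. -/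
theorem structureLaw_of_profiles {vin : L2} (hσ : 0 < σ) (hα : α ∈ Ioo (0 : ℝ) 1)
    (hq : q ∈ Icc (1 : ℝ) 2) (hv : ∀ ν ∈ Ioo (0 : ℝ) 1, IsLerayHopf ν vin (f ν) (v ν))
    (hH : UniformBound σ α q f v) {S : L2 → ℝ → ℝ} {c c' : ℝ} (hc' : 0 ≤ c' ∧ c' ≤ 2) (hc : c' * c = 1)
    (hS : ∀ ℓ, 0 < ℓ → ∃ a, IsStructureProfile S c ℓ a) {K : ℝ} (hK : K < 1 / (2 - α * q)) {p : ℝ}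
    (hp : 1 ≤ p) : StructureLaw S c' K p f v := by
  refine tendsto_limsup_iSup_of_scaleFilter ?_
  obtain ⟨M, C, F, hM0, hC, hF, H⟩ := exists_uniform_constants hσ hα hq hH
  have hαq : 0 < α * q := mul_pos hα.1 (by linarith [hq.1])
  have hαq2 : 0 < 2 - α * q := by nlinarith [hα.1, hα.2, hq.1, hq.2]
  have hK' : 0 < 1 - K * (2 - α * q) := by rw [lt_div_iff₀ hαq2] at hK; linarith
  have hfst := tendsto_fst_scaleFilter K
  have hsnd := tendsto_snd_scaleFilter K
  have hp0 : 0 < p := by linarith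
  set E1 : ℝ × ℝ → ℝ≥0∞ := fun z => C * ENNReal.ofReal 10 * ENNReal.ofReal (z.1 ^ (1 - K * (2 - α * q)))
  set E2 : ℝ × ℝ → ℝ≥0∞ := fun z => (1 + C) * ENNReal.ofReal (z.2 ^ (α * q / 4))
    + ENNReal.ofReal (2 * M) * F * ENNReal.ofReal (z.2 ^ (α * q * σ / 4))
  -- The errors that are uniform in time. The remaining one, `rough (v ν t) ℓ`, is kept apart and
  -- enters only through its time integral.
  set A : ℝ × ℝ → ℝ≥0∞ := fun z => ENNReal.ofReal (rough vin z.2) + E1 z + E2 z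
  set D := ENNReal.ofReal (4 * M ^ 2)
  set G : ℝ × ℝ → ℝ≥0∞ := fun z => (2 ^ p * (2 ^ (p - 1) *
    (A z ^ p + D ^ (p - 1) * (C * ENNReal.ofReal (z.2 ^ (α * q)))))) ^ (1 / p)
  have hrough : Tendsto (fun z : ℝ × ℝ => ENNReal.ofReal (rough vin z.2)) (scaleFilter K) (𝓝 0) := by
    have := (ENNReal.continuous_ofReal.tendsto 0).comp ((tendsto_rough vin).comp hsnd)
    simpa [Function.comp_def] using this
  have hsmall : ∀ {κ : ℝ}, 0 < κ → ∀ {c : ℝ≥0∞}, c ≠ ∞ → ∀ {π : ℝ × ℝ → ℝ},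
      Tendsto π (scaleFilter K) (𝓝[>] 0) →
      Tendsto (fun z => c * ENNReal.ofReal (π z ^ κ)) (scaleFilter K) (𝓝 0) := fun hκ c hc π hπ => by
    have := ENNReal.Tendsto.const_mul (a := c) ((tendsto_ofReal_rpow_nhdsGT hκ).comp hπ) (Or.inr hc)
    simpa using this
  have hA : Tendsto A (scaleFilter K) (𝓝 0) := by
    have h1 := hsmall hK' (ENNReal.mul_ne_top hC (ENNReal.ofReal_ne_top (r := 10))) hfst
    have h2 := hsmall (κ := α * q / 4) (by positivity) (ENNReal.add_ne_top.2 ⟨ENNReal.one_ne_top, hC⟩) hsnd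
    have h3 := hsmall (κ := α * q * σ / 4) (by positivity)
      (ENNReal.mul_ne_top (ENNReal.ofReal_ne_top (r := 2 * M)) hF) hsnd
    have := (hrough.add h1).add (h2.add h3)
    simp only [add_zero] at this
    exact this
  have hG : Tendsto G (scaleFilter K) (𝓝 0) := by
    have hD : D ^ (p - 1) * C ≠ ∞ :=
      ENNReal.mul_ne_top (ENNReal.rpow_ne_top_of_nonneg (by linarith) ENNReal.ofReal_ne_top) hC
    have h1 := hsmall hαq hD hsnd
    have h2 := (hA.ennrpow_const p).add h1
    rw [ENNReal.zero_rpow_of_pos hp0, add_zero] at h2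
    have h3 := ENNReal.Tendsto.const_mul (a := 2 ^ p * 2 ^ (p - 1)) h2 (Or.inr (ENNReal.mul_ne_top
      (ENNReal.rpow_ne_top_of_nonneg hp0.le (by simp))
      (ENNReal.rpow_ne_top_of_nonneg (by linarith) (by simp))))
    have h4 := h3.ennrpow_const (1 / p)
    rw [mul_zero, ENNReal.zero_rpow_of_pos (by positivity)] at h4
    refine h4.congr fun z => ?_
    simp only [G, mul_assoc]
  refine tendsto_of_tendsto_of_tendsto_of_le_of_le' tendsto_const_nhds hG
    (Eventually.of_forall fun _ => zero_le) ?_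
  filter_upwards [eventually_scaleFilter K] with z ⟨hν, hℓ, hz⟩
  obtain ⟨ν, ℓ⟩ := z
  simp only at hν hℓ hz ⊢
  obtain ⟨hM, hF', hR⟩ := H ν hν
  replace hR := hR ℓ hℓ
  obtain ⟨a, ha⟩ := hS ℓ hℓ
  have hrM : ∀ᵐ r ∂timeMeasure, rough (v ν r) ℓ ≤ 4 * M ^ 2 := by
    filter_upwards [hM] with r hr
    exact (rough_le _ _).trans (by gcongr)
  have hE1 : ENNReal.ofReal (10 * ν / ℓ ^ 2) * ∫⁻ r, ENNReal.ofReal (rough (v ν r) ℓ) ∂timeMeasure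
      ≤ E1 (ν, ℓ) := by
    -- The exponent of `ℓ` on the left is negative, so the worst case is `ℓ = ν ^ K`; this is where
    -- the dissipative cutoff enters.
    have h1 : ν / ℓ ^ 2 * ℓ ^ (α * q) ≤ ν ^ (1 - K * (2 - α * q)) := by
      have e1 : ν / ℓ ^ 2 * ℓ ^ (α * q) = ν * ℓ ^ (-(2 - α * q)) := by
        rw [← Real.rpow_two, div_mul_eq_mul_div, mul_div_assoc, ← Real.rpow_sub hℓ]; congr 2; ring
      have e2 : ν ^ (1 - K * (2 - α * q)) = ν * (ν ^ K) ^ (-(2 - α * q)) := by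
        rw [← Real.rpow_mul hν.1.le, sub_eq_add_neg, Real.rpow_add hν.1, Real.rpow_one]; congr 2; ring
      rw [e1, e2]
      refine mul_le_mul_of_nonneg_left ?_ hν.1.le
      exact Real.rpow_le_rpow_of_nonpos (Real.rpow_pos_of_pos hν.1 K) hz (by linarith)
    calc _ ≤ ENNReal.ofReal (10 * ν / ℓ ^ 2) * (C * ENNReal.ofReal (ℓ ^ (α * q))) := by gcongr
      _ = C * ENNReal.ofReal 10 * ENNReal.ofReal (ν / ℓ ^ 2 * ℓ ^ (α * q)) := by
        have hν0 := hν.1.le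
        rw [mul_div_assoc, ENNReal.ofReal_mul (by norm_num), ENNReal.ofReal_mul (by positivity)]; ring
      _ ≤ _ := by simp only [E1]; gcongr
  have hE2 : ∫⁻ r, ‖f ν r‖ₑ * ENNReal.ofReal √(rough (v ν r) ℓ) ∂timeMeasure ≤ E2 (ν, ℓ) := by
    set s := ℓ ^ (α * q) with hs
    have hs0 : 0 < s := by positivity
    have e1 : s ^ (1 / 4 : ℝ) = ℓ ^ (α * q / 4) := by rw [hs, ← Real.rpow_mul hℓ.le]; congr 1; ring
    have e2 : s ^ (σ / 4) = ℓ ^ (α * q * σ / 4) := by rw [hs, ← Real.rpow_mul hℓ.le]; congr 1; ring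
    have e3 : s ^ (-(3 / 4) : ℝ) * s = s ^ (1 / 4 : ℝ) := by
      rw [← Real.rpow_add_one hs0.ne']; norm_num
    have hfm : AEMeasurable (fun r => ENNReal.ofReal (2 * M * s ^ (σ / 4)) * ‖f ν r‖ₑ ^ (1 + σ)) timeMeasure :=
      ((hv ν hν).force_L1L2.1.enorm.pow_const _).const_mul _
    calc _ ≤ ∫⁻ r, (ENNReal.ofReal (s ^ (1 / 4 : ℝ)) + (ENNReal.ofReal (2 * M * s ^ (σ / 4)) * ‖f ν r‖ₑ ^ (1 + σ)
          + ENNReal.ofReal (s ^ (-(3 / 4) : ℝ)) * ENNReal.ofReal (rough (v ν r) ℓ))) ∂timeMeasure := by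
          refine lintegral_mono_ae ?_
          filter_upwards [hrM] with r hr
          have h0 := rough_nonneg (v ν r) ℓ
          have hsq : √(rough (v ν r) ℓ) ≤ 2 * M := by
            rw [show 2 * M = √(4 * M ^ 2) by
              rw [show 4 * M ^ 2 = (2 * M) ^ 2 by ring, Real.sqrt_sq (by positivity)]]
            exact Real.sqrt_le_sqrt hr
          rw [← ofReal_norm, ENNReal.ofReal_rpow_of_nonneg (norm_nonneg _) (by linarith),
            ← ENNReal.ofReal_mul (norm_nonneg _), ← ENNReal.ofReal_mul (by positivity),
            ← ENNReal.ofReal_mul (by positivity), ← ENNReal.ofReal_add (by positivity) (by positivity),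
            ← ENNReal.ofReal_add (by positivity) (by positivity)]
          refine ENNReal.ofReal_le_ofReal ((mul_sqrt_le hσ (norm_nonneg _) h0 hsq hs0).trans_eq ?_)
          ring
      _ = ENNReal.ofReal (s ^ (1 / 4 : ℝ)) + (ENNReal.ofReal (2 * M * s ^ (σ / 4)) *
            ∫⁻ r, ‖f ν r‖ₑ ^ (1 + σ) ∂timeMeasure
          + ENNReal.ofReal (s ^ (-(3 / 4) : ℝ)) * ∫⁻ r, ENNReal.ofReal (rough (v ν r) ℓ) ∂timeMeasure) := by
          rw [lintegral_add_left measurable_const, lintegral_const_timeMeasure, lintegral_add_left' hfm,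
            lintegral_const_mul' _ _ ENNReal.ofReal_ne_top, lintegral_const_mul' _ _ ENNReal.ofReal_ne_top]
      _ ≤ ENNReal.ofReal (s ^ (1 / 4 : ℝ)) + (ENNReal.ofReal (2 * M * s ^ (σ / 4)) * F
          + ENNReal.ofReal (s ^ (-(3 / 4) : ℝ)) * (C * ENNReal.ofReal s)) := by gcongr
      _ = ENNReal.ofReal (s ^ (1 / 4 : ℝ)) + (ENNReal.ofReal (2 * M) * ENNReal.ofReal (s ^ (σ / 4)) * F
          + C * ENNReal.ofReal (s ^ (1 / 4 : ℝ))) := by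
          rw [← e3, ENNReal.ofReal_mul (by positivity : (0 : ℝ) ≤ s ^ (-(3 / 4) : ℝ)),
            ENNReal.ofReal_mul (by positivity : (0 : ℝ) ≤ 2 * M)]
          ring
      _ = _ := by simp only [E2]; rw [← e1, ← e2]; ring
  have hX : ∀ᵐ t ∂timeMeasure,
      ‖(∫ r in (0 : ℝ)..t, S (v ν r) ℓ / ℓ) + c' * dissipation (f ν) (v ν) t‖ₑ ^ p
        ≤ 2 ^ p * (2 ^ (p - 1) * (A (ν, ℓ) ^ p + D ^ (p - 1) * ENNReal.ofReal (rough (v ν t) ℓ))) := by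
    filter_upwards [timeMeasure_ae_mem, hrM] with t ht hrt
    have h1 := (hv ν hν).deviation_le hν.1 hℓ ha ht
    have h2 : ‖(∫ r in (0 : ℝ)..t, S (v ν r) ℓ / ℓ) + c' * dissipation (f ν) (v ν) t‖ₑ
        ≤ 2 * (A (ν, ℓ) + ENNReal.ofReal (rough (v ν t) ℓ)) := by
      have e : (∫ r in (0 : ℝ)..t, S (v ν r) ℓ / ℓ) + c' * dissipation (f ν) (v ν) t
          = c' * ((∫ r in 0..t, c * (S (v ν r) ℓ / ℓ)) + dissipation (f ν) (v ν) t) := by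
        rw [intervalIntegral.integral_const_mul, mul_add, ← mul_assoc, hc, one_mul]
      rw [e, enorm_mul]
      refine mul_le_mul' ?_ (h1.trans ?_)
      · rw [← ofReal_norm, Real.norm_of_nonneg hc'.1, show (2 : ℝ≥0∞) = ENNReal.ofReal 2 by norm_num]
        exact ENNReal.ofReal_le_ofReal hc'.2
      · calc _ ≤ ENNReal.ofReal (rough vin ℓ) + ENNReal.ofReal (rough (v ν t) ℓ) + E1 (ν, ℓ) + E2 (ν, ℓ) := by
              gcongr
          _ = _ := by simp only [A]; ring
    calc _ ≤ (2 * (A (ν, ℓ) + ENNReal.ofReal (rough (v ν t) ℓ))) ^ p := ENNReal.rpow_le_rpow h2 hp0.le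
      _ = 2 ^ p * (A (ν, ℓ) + ENNReal.ofReal (rough (v ν t) ℓ)) ^ p := ENNReal.mul_rpow_of_nonneg _ _ hp0.le
      _ ≤ 2 ^ p * (2 ^ (p - 1) * (A (ν, ℓ) ^ p + ENNReal.ofReal (rough (v ν t) ℓ) ^ p)) := by
        gcongr; exact ENNReal.rpow_add_le_mul_rpow_add_rpow _ _ hp
      _ ≤ _ := by
        gcongr
        -- All but one power of `rough` is spent on its bound `4 * M ^ 2`, since only the first
        -- power has a small time integral.
        calc ENNReal.ofReal (rough (v ν t) ℓ) ^ p
            = ENNReal.ofReal (rough (v ν t) ℓ) ^ (p - 1) * ENNReal.ofReal (rough (v ν t) ℓ) := by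
              conv_lhs => rw [← sub_add_cancel p 1]
              rw [ENNReal.rpow_add_of_nonneg _ _ (by linarith) zero_le_one, ENNReal.rpow_one]
          _ ≤ _ := mul_le_mul' (ENNReal.rpow_le_rpow (ENNReal.ofReal_le_ofReal hrt) (by linarith)) le_rfl
  rw [eLpNorm_eq_lintegral_rpow_enorm_toReal (by simp; linarith) (by simp), ENNReal.toReal_ofReal hp0.le]
  simp only [G]
  refine ENNReal.rpow_le_rpow ?_ (by positivity)
  have t1 : (2 : ℝ≥0∞) ^ p ≠ ∞ := ENNReal.rpow_ne_top_of_nonneg hp0.le (by simp)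
  have t2 : (2 : ℝ≥0∞) ^ (p - 1) ≠ ∞ := ENNReal.rpow_ne_top_of_nonneg (by linarith) (by simp)
  have t3 : D ^ (p - 1) ≠ ∞ := ENNReal.rpow_ne_top_of_nonneg (by linarith) ENNReal.ofReal_ne_top
  refine (lintegral_mono_ae hX).trans ?_
  rw [lintegral_const_mul' _ _ t1, lintegral_const_mul' _ _ t2, lintegral_add_left measurable_const,
    lintegral_const_timeMeasure, lintegral_const_mul' _ _ t3]
  gcongr

end

lemma dissipation_eq_of_energyEquality {ν : ℝ} {f v : ℝ → L2} (h : EnergyEquality ν f v) {t : ℝ}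
    (ht : t ∈ Icc (0 : ℝ) 1) : dissipation f v t = ν * gradEnergy v t := by
  rcases ht.1.eq_or_lt with rfl | h0
  · simp [dissipation, gradEnergy]
  · have := h t ⟨h0, ht.2⟩
    unfold dissipation
    linarith

/-- A by-product of the limit of profiles, whose dominated convergence already yields integrability
of the limiting flux. -/
lemma IsLerayHopf.intervalIntegrable_structure {ν : ℝ} {vin : L2} {f v : ℝ → L2}
    (h : IsLerayHopf ν vin f v) (hν : 0 < ν) {S : L2 → ℝ → ℝ} {c ℓ : ℝ} (hc : c ≠ 0) (hℓ : 0 < ℓ)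
    (ha : ∃ a, IsStructureProfile S c ℓ a) : IntervalIntegrable (fun r => S (v r) ℓ) volume 0 1 := by
  obtain ⟨a, ha⟩ := ha
  have h1 := (h.flux_limit hν hℓ ha).1
  have h2 : Integrable (fun r => S (v r) ℓ) timeMeasure := by
    refine (h1.const_mul (ℓ / c)).congr (ae_of_all _ fun r => ?_)
    field_simp
  exact intervalIntegrable_of_timeMeasure h2 (by simp) (by simp)

end StructureLaws

end NavierStokes

end

theorem theorem1p1 (σ α q : ℝ) (hσ : 0 < σ) (hα : α ∈ Set.Ioo (0 : ℝ) 1)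
    (hq : q ∈ Set.Icc (1 : ℝ) 2)
    (vin : NavierStokes.L2) (f v : ℝ → ℝ → NavierStokes.L2)
    (hv : ∀ ν ∈ Set.Ioo (0 : ℝ) 1, NavierStokes.IsLerayHopf ν vin (f ν) (v ν))
    (hH : NavierStokes.UniformBound σ α q f v) :
    -- the structure functions are well defined for almost every time, and integrable in time
    (∀ ν ∈ Set.Ioo (0 : ℝ) 1,
      (∀ᵐ r ∂NavierStokes.timeMeasure, MeasureTheory.MemLp (v ν r) 3 NavierStokes.torusMeasure) ∧
      ∀ ℓ : ℝ, 0 < ℓ →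
        IntervalIntegrable (fun r => NavierStokes.Spar (v ν r) ℓ) MeasureTheory.volume 0 1 ∧
        IntervalIntegrable (fun r => NavierStokes.Szero (v ν r) ℓ) MeasureTheory.volume 0 1) ∧
    -- the 4/5 law and the 4/3 law
    (∀ K : ℝ, K < 1 / (2 - α * q) → ∀ p : ℝ, 1 ≤ p →
      NavierStokes.StructureLaw NavierStokes.Spar (4 / 5) K p f v ∧
      NavierStokes.StructureLaw NavierStokes.Szero (4 / 3) K p f v) ∧
    -- the dissipation under the energy equality
    (∀ ν ∈ Set.Ioo (0 : ℝ) 1, NavierStokes.EnergyEquality ν (f ν) (v ν) →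
      ∀ t ∈ Set.Icc (0 : ℝ) 1,
        NavierStokes.dissipation (f ν) (v ν) t = ν * NavierStokes.gradEnergy (v ν) t) := by
  refine ⟨fun ν hν => ⟨(hv ν hν).memLp_three, fun ℓ hℓ => ⟨?_, ?_⟩⟩, fun K hK p hp => ⟨?_, ?_⟩,
    fun ν _ h t ht => NavierStokes.dissipation_eq_of_energyEquality h ht⟩
  · exact (hv ν hν).intervalIntegrable_structure hν.1 (by norm_num) hℓ
      (NavierStokes.exists_structureProfile_par hℓ)
  · exact (hv ν hν).intervalIntegrable_structure hν.1 (by norm_num) hℓ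
      (NavierStokes.exists_structureProfile_zero hℓ)
  · exact NavierStokes.structureLaw_of_profiles hσ hα hq hv hH (by norm_num) (by norm_num)
      (fun ℓ hℓ => NavierStokes.exists_structureProfile_par hℓ) hK hp
  · exact NavierStokes.structureLaw_of_profiles hσ hα hq hv hH (by norm_num) (by norm_num)
      (fun ℓ hℓ => NavierStokes.exists_structureProfile_zero hℓ) hK hp
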